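/- Let $\Sigma$ be a smooth complete fan in $\mathbb R^n$ with primitive ray generators $v_1,\dots,v_p\in\mathbb Z^n$, and let $\lambda_1,\dots,\lambda_p\in\mathbb R$ be such that the toric ($\mathbb R$-)divisor $\sum_k\lambda_kD_k$ is ample, i.e. for every maximal cone $\sigma$ there is $m_\sigma\in\mathbb R^n$ with $\langle v_i,m_\sigma\rangle=-\lambda_i$ if $v_i\in\sigma$ and $\langle v_k,m_\sigma\rangle>-\lambda_k$ if $v_k\notin\sigma$. (The case of the Hori–Vafa mirror in normalized form is $v_i=e_i$, $\lambda_i=0$ for $i\le n$.) Put $\chi_k(x)=\lambda_k+\langle v_k,x\rangle$ and let $$F_{j}=\{x\in\mathbb R^n : \chi_k(x)\ge 0 \text{ for all } k,\ \chi_j(x)=0\}$$ be the facet dual to $v_j$. For $t>0$ let $$W(z)=1+\sum_{k=1}^p t^{\lambda_k}z^{v_k},\qquad Y^t=\{(z,u,v)\in(\mathbb C^*)^n\times\mathbb C^2 : uv=W(z)\}.$$ Let $\operatorname{Log}(z)=(\log|z_1|,\dots,\log|z_n|)$, $\operatorname{Log}_t=\operatorname{Log}/\log t$, $\mu_0(z,u,v)=(\operatorname{Log}(z),\tfrac12|u|^2,\tfrac12|v|^2)$,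 and let $$\omega_0=\sum_i\frac{dz_i\wedge d\bar z_i}{|z_i|^2}+du\wedge d\bar u+dv\wedge d\bar v$$ be the standard symplectic form on $(\mathbb C^*)^n\times\mathbb C^2$ (up to the constant factor $-2\sqrt{-1}$). For $U\subset\mathbb R^n$ and $R>0$ write $B_t(R,U)=\mu_0^{-1}\big((\log t\cdot U)\times[0,R]^2\big)$. Write $A\Subset B$ if the closure of $A$ is compact and contained in $B$. Then for each $j$ there are open sets $U_j''\Subset U_j'\Subset U_j$ in $\mathbb R^n$, with $U_j''$ containing a nonempty relatively open subset of $F_j$, such that for all sufficiently small $t>0$ there are real numbers $R>R'>R''$ with $$R''>\max\Big\{\tfrac12\sup_{z\in\operatorname{Log}_t^{-1}(U_j)}\Big(1+\sum_{k=1}^p|t^{\lambda_k}z^{v_k}|\Big),\,1\Big\}$$ (the supremum being finite), and smooth cutoff functions $\tau:\mathbb C^2\to[0,1]$ and $\rho:(\mathbb C^*)^n\to[0,1]$, where $\tau=1$ if $\tfrac12|u|^2,\tfrac12|v|^2\le R''$, $\tau=0$ unless $\tfrac12|u|^2,\tfrac12|v|^2\le R'$, $\rho=1$ on $\operatorname{Log}_t^{-1}(U_j'')$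 and $\rho=0$ off $\operatorname{Log}_t^{-1}(U_j')$, such that, setting $$Y^t_j=Y^t\cap B_t(R,U_j),\qquad Y^t_{j,\mathrm{simple}}=\Big\{uv=W(z)-\tau(u,v)\rho(z)\sum_{k\ne j}t^{\lambda_k}z^{v_k}\Big\}\cap B_t(R,U_j),$$ the following hold. 1. $Y^t_j$ and $Y^t_{j,\mathrm{simple}}$ are smooth submanifolds (with boundary) of $(\mathbb C^*)^n\times\mathbb C^2$ of real codimension two on which $\omega_0$ restricts to symplectic forms, and there is a symplectomorphism $\Phi_j:Y^t_j\to Y^t_{j,\mathrm{simple}}$ for these induced forms. 2. $Y^t_{j,\mathrm{simple}}\cap B_t(R'',U_j'')=\{uv=1+t^{\lambda_j}z^{v_j}\}\cap B_t(R'',U_j'')$. 3. $\Phi_j$ is the identity on $Y^t_j\setminus B_t(R',U_j')$. 4. For every $x\in U_j\cap F_j$ the set $(x+\mathbb R v_j)\cap\operatorname{Log}_t\big(\{z : (z,0,0)\in Y^t_{j,\mathrm{simple}}\}\big)$ is nonempty and connected. -/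

import Mathlib

open Set
open scoped ContDiff Pointwise

noncomputable section

namespace HoriVafa

/-! ### The toric data -/

/-- The rational polyhedral cone spanned by the vectors `ray i`, `i ∈ σ`. -/
def coneOf {n p : ℕ} (ray : Fin p → Fin n → ℤ) (σ : Finset (Fin p)) : Set (Fin n → ℝ) :=
  {x | ∃ c : Fin p → ℝ, (∀ i, 0 ≤ c i) ∧ (∀ i, i ∉ σ → c i = 0) ∧
    x = ∑ i, c i • (fun l => (ray i l : ℝ))}

/-- A smooth complete fan in `ℝⁿ` with `p` rays, given by the primitive generators of its rays and
by the sets of rays of its maximal cones: the generators of each maximal cone are a `ℤ`-basis of the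
lattice, the maximal cones cover `ℝⁿ`, and two of them meet along their common face. -/
structure SmoothCompleteFan (n p : ℕ) where
  ray : Fin p → Fin n → ℤ
  maxCones : Finset (Finset (Fin p))
  linInd : ∀ σ ∈ maxCones, LinearIndependent ℤ (fun i : σ => ray i)
  spans : ∀ σ ∈ maxCones, Submodule.span ℤ (ray '' (σ : Set (Fin p))) = ⊤
  covers : ∀ x : Fin n → ℝ, ∃ σ ∈ maxCones, x ∈ coneOf ray σ
  inter : ∀ σ ∈ maxCones, ∀ σ' ∈ maxCones, coneOf ray σ ∩ coneOf ray σ' = coneOf ray (σ ∩ σ')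
  ray_mem : ∀ j, ∃ σ ∈ maxCones, j ∈ σ

/-- The pairing `⟨v, x⟩` of a lattice vector with a point of `ℝⁿ`. -/
def pairing {n : ℕ} (v : Fin n → ℤ) (x : Fin n → ℝ) : ℝ := ∑ i, (v i : ℝ) * x i

/-- The toric divisor `∑ lam j • D j` is ample: its support function is strictly convex, that is,
for each maximal cone `σ` the linear function agreeing with it on `σ` is strictly on one side of it
at the other ray generators. -/
def SmoothCompleteFan.IsAmple {n p : ℕ} (fan : SmoothCompleteFan n p) (lam : Fin p → ℝ) : Prop :=
  ∀ σ ∈ fan.maxCones, ∃ m : Fin n → ℝ,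
    (∀ i ∈ σ, pairing (fan.ray i) m = -lam i) ∧ ∀ k, k ∉ σ → -lam k < pairing (fan.ray k) m

/-- `χ_j(x) = λ_j + ⟨v_j, x⟩`. -/
def chi {n p : ℕ} (fan : SmoothCompleteFan n p) (lam : Fin p → ℝ) (j : Fin p)
    (x : Fin n → ℝ) : ℝ := lam j + pairing (fan.ray j) x

/-- The polytope `{x | χ_k(x) ≥ 0 for all k}`. -/
def polytope {n p : ℕ} (fan : SmoothCompleteFan n p) (lam : Fin p → ℝ) : Set (Fin n → ℝ) :=
  {x | ∀ k, 0 ≤ chi fan lam k x}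

/-- The facet of the polytope dual to the ray `j`. -/
def facet {n p : ℕ} (fan : SmoothCompleteFan n p) (lam : Fin p → ℝ) (j : Fin p) :
    Set (Fin n → ℝ) :=
  {x | x ∈ polytope fan lam ∧ chi fan lam j x = 0}

/-! ### The ambient space `(ℂ^*)ⁿ × ℂ²` -/

/-- Points `(z, u, v)` of `ℂⁿ × ℂ²`; the space `(ℂ^*)ⁿ × ℂ²` is the open subset `z ∈ torus n`. -/
abbrev Ambient (n : ℕ) : Type := (Fin n → ℂ) × ℂ × ℂ

/-- The complex torus `(ℂ^*)ⁿ`. -/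
def torus (n : ℕ) : Set (Fin n → ℂ) := {z | ∀ i, z i ≠ 0}

/-- `Log(z) = (log |z_1|, …, log |z_n|)`. -/
def logMap {n : ℕ} (z : Fin n → ℂ) : Fin n → ℝ := fun i => Real.log ‖z i‖

/-- `Log_t = Log / log t`. -/
def logMapT {n : ℕ} (t : ℝ) (z : Fin n → ℂ) : Fin n → ℝ := (Real.log t)⁻¹ • logMap z

/-- The moment map `(z, u, v) ↦ (Log z, |u|²/2, |v|²/2)`. -/
def momentMap {n : ℕ} (q : Ambient n) : (Fin n → ℝ) × ℝ × ℝ :=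
  (logMap q.1, ‖q.2.1‖ ^ 2 / 2, ‖q.2.2‖ ^ 2 / 2)

/-- The subset `μ₀⁻¹((log t · U) × [0,R]²)` of `(ℂ^*)ⁿ × ℂ²`. -/
def box {n : ℕ} (t R : ℝ) (U : Set (Fin n → ℝ)) : Set (Ambient n) :=
  {q | q.1 ∈ torus n ∧ momentMap q ∈ (Real.log t • U) ×ˢ (Icc 0 R ×ˢ Icc 0 R)}

/-- The form `ω₀ = ∑ dz_i ∧ dz̄_i / |z_i|² + du ∧ dū + dv ∧ dv̄` at the point `q`. It is `-2√-1` times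
a real symplectic form. -/
def omega {n : ℕ} (q ξ η : Ambient n) : ℂ :=
  (∑ i, (ξ.1 i * star (η.1 i) - η.1 i * star (ξ.1 i)) / ((‖q.1 i‖ : ℂ) ^ 2)) +
    (ξ.2.1 * star η.2.1 - η.2.1 * star ξ.2.1) + (ξ.2.2 * star η.2.2 - η.2.2 * star ξ.2.2)

/-- The tangent space at `q` of a subset `S` of the ambient space (the usual one if `S` is a
submanifold, with or without boundary). -/
def tangentAt {n : ℕ} (S : Set (Ambient n)) (q : Ambient n) : Submodule ℝ (Ambient n) :=
  Submodule.span ℝ (tangentConeAt ℝ S q)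

/-- `S` is a smooth submanifold of `(ℂ^*)ⁿ × ℂ²` of real codimension two, possibly with boundary, on
which `ω₀` induces a symplectic form: near each of its points it is the set `{F = 0, g ≤ 0}` where
`dF` is onto and, at a boundary point `g = 0`, `(dF, dg)` is onto; the restriction of
`ω₀` to each tangent space is nondegenerate. -/
def IsSymplecticSubmanifold {n : ℕ} (S : Set (Ambient n)) : Prop :=
  ∀ q ∈ S, q.1 ∈ torus n ∧
    (∃ (V : Set (Ambient n)) (F : Ambient n → ℂ) (g : Ambient n → ℝ),
      IsOpen V ∧ q ∈ V ∧ ContDiffOn ℝ ∞ F V ∧ ContDiffOn ℝ ∞ g V ∧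
      S ∩ V = {x | x ∈ V ∧ F x = 0 ∧ g x ≤ 0} ∧
      Function.Surjective (fderiv ℝ F q) ∧
      (g q = 0 → Function.Surjective ((fderiv ℝ F q).prod (fderiv ℝ g q)))) ∧
    ∀ ξ ∈ tangentAt S q, (∀ η ∈ tangentAt S q, omega q ξ η = 0) → ξ = 0

/-- `Φ` restricts to a symplectomorphism from `S` to `T`, with the forms induced by `ω₀`: a
diffeomorphism (smooth with a smooth inverse) with `Φ^* (ω₀|_T) = ω₀|_S`. On the tangent spaces
of `S` the derivative does not depend on the choice of `L`. -/
structure IsSymplectomorphism {n : ℕ} (S T : Set (Ambient n)) (Φ : Ambient n → Ambient n) :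
    Prop where
  source : IsSymplecticSubmanifold S
  target : IsSymplecticSubmanifold T
  bijOn : BijOn Φ S T
  smooth : ContDiffOn ℝ ∞ Φ S
  smooth_inv : ∃ Ψ : Ambient n → Ambient n, InvOn Ψ Φ S T ∧ ContDiffOn ℝ ∞ Ψ T
  pullback : ∀ q ∈ S, ∀ L : Ambient n →L[ℝ] Ambient n, HasFDerivWithinAt Φ L S q →
    ∀ ξ ∈ tangentAt S q, ∀ η ∈ tangentAt S q, omega (Φ q) (L ξ) (L η) = omega q ξ η

/-! ### The mirror and its simplification near a facet -/

/-- The term `t^{λ_k} z^{v_k}`. -/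
def term {n p : ℕ} (fan : SmoothCompleteFan n p) (lam : Fin p → ℝ) (t : ℝ) (k : Fin p)
    (z : Fin n → ℂ) : ℂ :=
  ((t ^ lam k : ℝ) : ℂ) * ∏ i, z i ^ fan.ray k i

/-- `W(z) = 1 + ∑_k t^{λ_k} z^{v_k}`. -/
def potential {n p : ℕ} (fan : SmoothCompleteFan n p) (lam : Fin p → ℝ) (t : ℝ)
    (z : Fin n → ℂ) : ℂ := 1 + ∑ k, term fan lam t k z

/-- The Hori-Vafa mirror `Y^t = {uv = W(z)}` in `(ℂ^*)ⁿ × ℂ²`. -/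
def mirror {n p : ℕ} (fan : SmoothCompleteFan n p) (lam : Fin p → ℝ) (t : ℝ) :
    Set (Ambient n) :=
  {q | q.1 ∈ torus n ∧ q.2.1 * q.2.2 = potential fan lam t q.1}

/-- The locus `uv = 1 + t^{λ_j} z^{v_j}` in `(ℂ^*)ⁿ × ℂ²`. -/
def binomialLocus {n p : ℕ} (fan : SmoothCompleteFan n p) (lam : Fin p → ℝ) (t : ℝ)
    (j : Fin p) : Set (Ambient n) :=
  {q | q.1 ∈ torus n ∧ q.2.1 * q.2.2 = 1 + term fan lam t j q.1}

/-- `W_j(u,v,z) = W(z) - τ(u,v) ρ(z) ∑_{k ≠ j} t^{λ_k} z^{v_k}`. -/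
def cutPotential {n p : ℕ} (fan : SmoothCompleteFan n p) (lam : Fin p → ℝ) (t : ℝ)
    (j : Fin p) (τ : ℂ × ℂ → ℝ) (ρ : (Fin n → ℂ) → ℝ) (q : Ambient n) : ℂ :=
  potential fan lam t q.1 -
    (τ q.2 : ℂ) * (ρ q.1 : ℂ) * ∑ k ∈ Finset.univ.erase j, term fan lam t k q.1

/-- The locus `uv = W_j(u,v,z)` in `(ℂ^*)ⁿ × ℂ²`. -/
def cutMirror {n p : ℕ} (fan : SmoothCompleteFan n p) (lam : Fin p → ℝ) (t : ℝ)
    (j : Fin p) (τ : ℂ × ℂ → ℝ) (ρ : (Fin n → ℂ) → ℝ) : Set (Ambient n) :=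
  {q | q.1 ∈ torus n ∧ q.2.1 * q.2.2 = cutPotential fan lam t j τ ρ q}

/-- `τ` is a smooth cutoff function on `ℂ²`, equal to `1` where `|u|²/2, |v|²/2 ≤ r` and to `0`
off the set where `|u|²/2, |v|²/2 ≤ r'`. -/
structure IsFiberCutoff (r r' : ℝ) (τ : ℂ × ℂ → ℝ) : Prop where
  smooth : ContDiff ℝ ∞ τ
  mem_Icc : ∀ w, τ w ∈ Icc (0 : ℝ) 1
  eq_one : ∀ w : ℂ × ℂ, ‖w.1‖ ^ 2 / 2 ≤ r → ‖w.2‖ ^ 2 / 2 ≤ r → τ w = 1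
  eq_zero : ∀ w : ℂ × ℂ, ¬ (‖w.1‖ ^ 2 / 2 ≤ r' ∧ ‖w.2‖ ^ 2 / 2 ≤ r') → τ w = 0

/-- `ρ` is a smooth cutoff function on `(ℂ^*)ⁿ`, equal to `1` on `Log_t⁻¹(U'')` and to `0` off
`Log_t⁻¹(U')`. -/
structure IsBaseCutoff {n : ℕ} (t : ℝ) (U'' U' : Set (Fin n → ℝ)) (ρ : (Fin n → ℂ) → ℝ) :
    Prop where
  smooth : ContDiffOn ℝ ∞ ρ (torus n)
  mem_Icc : ∀ z ∈ torus n, ρ z ∈ Icc (0 : ℝ) 1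
  eq_one : ∀ z ∈ torus n, logMapT t z ∈ U'' → ρ z = 1
  eq_zero : ∀ z ∈ torus n, logMapT t z ∉ U' → ρ z = 0

/-- The image under `Log_t` of `{z | (z, 0, 0) ∈ S}`. -/
def amoebaOf {n : ℕ} (t : ℝ) (S : Set (Ambient n)) : Set (Fin n → ℝ) :=
  logMapT t '' {z | z ∈ torus n ∧ ((z, 0, 0) : Ambient n) ∈ S}

/-- The line `x + ℝ v_j`. -/
def rayLine {n p : ℕ} (fan : SmoothCompleteFan n p) (j : Fin p) (x : Fin n → ℝ) :
    Set (Fin n → ℝ) :=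
  {y | ∃ s : ℝ, y = x + s • (fun i => (fan.ray j i : ℝ))}

/-- `A ⊂⊂ B`: the closure of `A` is compact and contained in `B`. -/
def RelCompactIn {n : ℕ} (A B : Set (Fin n → ℝ)) : Prop :=
  IsCompact (closure A) ∧ closure A ⊆ B

end HoriVafa

end

/-!
At a point `x₀` of the facet where the other `χ_k` are positive, the terms `t^{λ_k} z^{v_k}`
with `k ≠ j` and their logarithmic differentials are exponentially small in `|log t|` on a
cylinder around `x₀` with axis `v_j`. The linear family of hypersurfaces
`uv = W - s τ ρ ∑_{k ≠ j} t^{λ_k} z^{v_k}`, `s ∈ [0,1]`, is therefore a small perturbation of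
`uv = 1 + t^{λ_j} z^{v_j}`, whose defining function `F` has `{Im F, Re F}` bounded below near
its zero locus; so is that of the family, and all its members are symplectic. Where this Poisson
bracket is positive one can write down a Hamiltonian, supported where the perturbation is, whose
flow moves with the family; it is the parallel transport and gives the symplectomorphism. The
boundary `|u|² / 2 = R` or `|v|² / 2 = R` is off the support and is transverse there because of
the symmetry `(z, u, v) ↦ (z, e⁻ᶜ u, eᶜ v)`.

Over a line `x + ℝ v_j` the equation of the simplified hypersurface at `u = v = 0` becomes
`exp ζ = 1 + small`. For each choice of the angles transverse to `v_j` it has exactly one small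
solution `ζ`, which depends continuously on the angles, and the angles range over a connected
space.
-/

noncomputable section

namespace HoriVafa

/-! ### Superposition operators on spaces of continuous functions -/

section Superposition

universe u
variable {K : Type*} [TopologicalSpace K] [CompactSpace K]
variable {E F : Type u} [NormedAddCommGroup E] [NormedSpace ℝ E]
  [NormedAddCommGroup F] [NormedSpace ℝ F]

/-- Pointwise application of a continuous family of operators to a continuous family of vectors,
as a bounded bilinear map. The derivative of a superposition operator `γ ↦ f ∘ γ` has this form. -/
def pointwiseApply : C(K, E →L[ℝ] F) →L[ℝ] C(K, E) →L[ℝ] C(K, F) :=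
  LinearMap.mkContinuous₂
    (LinearMap.mk₂ ℝ (fun (A : C(K, E →L[ℝ] F)) (h : C(K, E)) =>
        (⟨fun s => A s (h s), A.continuous.clm_apply h.continuous⟩ : C(K, F)))
      (fun A B h => by ext; simp) (fun c A h => by ext; simp)
      (fun A h k => by ext; simp) (fun c A h => by ext; simp)) 1
    (fun A h => by
      rw [one_mul]
      refine (ContinuousMap.norm_le _ (by positivity)).2 fun s => ?_
      exact (A s).le_of_opNorm_le_of_le (A.norm_coe_le_norm s) (h.norm_coe_le_norm s))

@[simp] theorem pointwiseApply_apply (A : C(K, E →L[ℝ] F)) (h : C(K, E)) (s : K) :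
    pointwiseApply A h s = A s (h s) := rfl

theorem hasFDerivAt_comp_continuousMap (f : C(E, F)) (f' : C(E, E →L[ℝ] F))
    (hf : ∀ x, HasFDerivAt f (f' x) x) (γ : C(K, E)) :
    HasFDerivAt (fun γ : C(K, E) => f.comp γ) (pointwiseApply (f'.comp γ)) γ := by
  rw [hasFDerivAt_iff_isLittleO_nhds_zero, Asymptotics.isLittleO_iff]
  intro c hc
  -- `f'` is uniformly continuous at the compact range of `γ`, so one `δ` serves all points of `K`.
  obtain ⟨δ, hδ, hδ'⟩ := Metric.mem_uniformity_dist.1 <|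
    (isCompact_range γ.continuous).uniformContinuousAt_of_continuousAt f'
      (fun a _ => f'.continuous.continuousAt) (Metric.dist_mem_uniformity hc)
  filter_upwards [Metric.ball_mem_nhds (0 : C(K, E)) hδ] with h hh
  refine (ContinuousMap.norm_le _ (by positivity)).2 fun s => ?_
  simp only [ContinuousMap.sub_apply, ContinuousMap.comp_apply, ContinuousMap.add_apply,
    pointwiseApply_apply]
  have hf'_near : ∀ x ∈ Metric.ball (γ s) δ, ‖f' x - f' (γ s)‖ ≤ c := by
    intro x hx
    have hdist := hδ' (a := γ s) (b := x) (by rwa [dist_comm]) (mem_range_self s)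
    simp only [mem_ofPred_eq] at hdist
    rw [← dist_eq_norm, dist_comm]
    exact hdist.le
  have hmem : γ s + h s ∈ Metric.ball (γ s) δ := by
    simpa using (h.norm_coe_le_norm s).trans_lt (by simpa using hh : ‖h‖ < δ)
  have hmean := (convex_ball (γ s) δ).norm_image_sub_le_of_norm_hasFDerivWithin_le'
    (fun x _ => (hf x).hasFDerivWithinAt) hf'_near (Metric.mem_ball_self hδ) hmem
  simp only [add_sub_cancel_left] at hmean
  exact hmean.trans (by gcongr; exact h.norm_coe_le_norm s)

theorem contDiff_comp_continuousMap_nat (m : ℕ) : ∀ {F : Type u} [NormedAddCommGroup F]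
    [NormedSpace ℝ F] (f : C(E, F)), ContDiff ℝ m f →
      ContDiff ℝ m (fun γ : C(K, E) => f.comp γ) := by
  induction m with
  | zero =>
    intro F _ _ f _
    exact contDiff_zero.2 (ContinuousMap.continuous_postcomp f)
  | succ m ih =>
    intro F _ _ f hf
    have hf'_smooth : ContDiff ℝ m (fderiv ℝ f) := hf.fderiv_right (by norm_cast)
    let f' : C(E, E →L[ℝ] F) := ⟨fderiv ℝ f, hf'_smooth.continuous⟩
    have hderiv := hasFDerivAt_comp_continuousMap (K := K) f f' fun x =>
      (hf.differentiable (by simp) x).hasFDerivAt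
    have hfderiv : fderiv ℝ (fun γ : C(K, E) => f.comp γ) =
        fun γ => pointwiseApply (f'.comp γ) := funext fun γ => (hderiv γ).fderiv
    push_cast
    rw [contDiff_succ_iff_fderiv, hfderiv]
    refine ⟨fun γ => (hderiv γ).differentiableAt, by simp, ?_⟩
    exact pointwiseApply.contDiff.comp (ih f' hf'_smooth)

theorem contDiff_comp_continuousMap {m : ℕ∞} (f : C(E, F)) (hf : ContDiff ℝ m f) :
    ContDiff ℝ m (fun γ : C(K, E) => f.comp γ) :=
  contDiff_iff_forall_nat_le.2 fun k hk =>
    contDiff_comp_continuousMap_nat k f (contDiff_iff_forall_nat_le.1 hf k hk)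

/-- The inclusion of `E` into `C(K, E)` as the constant functions. -/
def constCLM : E →L[ℝ] C(K, E) :=
  LinearMap.mkContinuous
    { toFun := ContinuousMap.const K
      map_add' := fun _ _ => rfl
      map_smul' := fun _ _ => rfl } 1
    (fun x => by
      rw [one_mul]
      exact (ContinuousMap.norm_le _ (norm_nonneg x)).2 fun _ => le_rfl)

end Superposition

section LipschitzPerturbation

variable {E : Type*} [NormedAddCommGroup E] [NormedSpace ℝ E] [CompleteSpace E]

theorem isUnit_fderiv_of_lipschitzWith_sub_id {f : E → E} {c : NNReal} (hc : c < 1)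
    (hl : LipschitzWith c (fun x => f x - x)) {a : E} (hf : DifferentiableAt ℝ f a) :
    IsUnit (fderiv ℝ f a) := by
  have hsub : HasFDerivAt (fun x => f x - x) (fderiv ℝ f a - 1) a :=
    hf.hasFDerivAt.sub (hasFDerivAt_id a)
  have hnorm : ‖1 - fderiv ℝ f a‖ < 1 := by
    rw [norm_sub_rev]
    exact (hsub.le_of_lipschitz hl).trans_lt (by exact_mod_cast hc)
  simpa using (Units.oneSub _ hnorm).isUnit

theorem exists_contDiff_inverse_of_lipschitzWith_sub_id {m : WithTop ℕ∞} (hm : m ≠ 0) {f : E → E}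
    (hf : ContDiff ℝ m f) {c : NNReal} (hc : c < 1) (hl : LipschitzWith c (fun x => f x - x)) :
    ∃ g : E → E, ContDiff ℝ m g ∧ Function.LeftInverse g f ∧ Function.RightInverse g f := by
  have happrox : ApproximatesLinearOn f (ContinuousLinearEquiv.refl ℝ E : E →L[ℝ] E) univ c := by
    rw [ApproximatesLinearOn.approximatesLinearOn_iff_lipschitzOnWith]
    exact lipschitzOnWith_univ.2 hl
  have hcond : Subsingleton E ∨
      c < ‖((ContinuousLinearEquiv.refl ℝ E).symm : E →L[ℝ] E)‖₊⁻¹ := by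
    rcases subsingleton_or_nontrivial E with h | h
    · exact Or.inl h
    · right
      change c < ‖ContinuousLinearMap.id ℝ E‖₊⁻¹
      simpa using hc
  let e : E ≃ₜ E := happrox.toHomeomorph f hcond
  have hdiff : Differentiable ℝ f := hf.differentiable hm
  let f' : E → E ≃L[ℝ] E := fun a => ContinuousLinearEquiv.unitsEquiv ℝ E
    (isUnit_fderiv_of_lipschitzWith_sub_id hc hl (hdiff a)).unit
  have hf' : ∀ a, HasFDerivAt e (f' a : E →L[ℝ] E) a := fun a => (hdiff a).hasFDerivAt
  exact ⟨e.symm, e.contDiff_symm hf' hf, e.symm_apply_apply, e.apply_symm_apply⟩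

end LipschitzPerturbation

/-! ### Smooth flows of time-dependent vector fields -/

section Volterra

universe u
variable {V : Type u} [NormedAddCommGroup V] [NormedSpace ℝ V]

/-- The primitive vanishing at `0` of a continuous function on `[0,1]`. -/
def primitive : C(unitInterval, V) →L[ℝ] C(unitInterval, V) :=
  LinearMap.mkContinuous
    { toFun := fun h => ⟨fun t => ∫ s in (0 : ℝ)..t, IccExtend zero_le_one h s, by
        have hc : Continuous (IccExtend (zero_le_one (α := ℝ)) h) := h.continuous.Icc_extend'
        exact (intervalIntegral.continuous_primitive (fun a b => hc.intervalIntegrable a b) 0).comp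
          continuous_subtype_val⟩
      map_add' := fun h k => by
        ext t
        have hc : Continuous (IccExtend (zero_le_one (α := ℝ)) h) := h.continuous.Icc_extend'
        have kc : Continuous (IccExtend (zero_le_one (α := ℝ)) k) := k.continuous.Icc_extend'
        exact intervalIntegral.integral_add (hc.intervalIntegrable _ _) (kc.intervalIntegrable _ _)
      map_smul' := fun c h => by
        ext t
        exact intervalIntegral.integral_smul c _ } 1
    (fun h => by
      rw [one_mul]
      refine (ContinuousMap.norm_le _ (by positivity)).2 fun t => ?_
      have hle := intervalIntegral.norm_integral_le_of_norm_le_const (a := 0) (b := (t : ℝ))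
        (f := IccExtend (zero_le_one (α := ℝ)) h) (C := ‖h‖)
        (fun s _ => h.norm_coe_le_norm _)
      rw [sub_zero, abs_of_nonneg t.2.1] at hle
      exact hle.trans (mul_le_of_le_one_right (norm_nonneg _) t.2.2))

theorem primitive_apply (h : C(unitInterval, V)) (t : unitInterval) :
    primitive h t = ∫ s in (0 : ℝ)..t, IccExtend zero_le_one h s := rfl

@[simp] theorem primitive_apply_zero (h : C(unitInterval, V)) : primitive h 0 = 0 := by
  simp [primitive_apply]

theorem hasDerivWithinAt_primitive [CompleteSpace V] (h : C(unitInterval, V)) {s : ℝ}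
    (hs : s ∈ Icc (0 : ℝ) 1) :
    HasDerivWithinAt (fun t => primitive h (projIcc 0 1 zero_le_one t)) (h ⟨s, hs⟩)
      (Icc 0 1) s := by
  have hc : Continuous (IccExtend (zero_le_one (α := ℝ)) h) := h.continuous.Icc_extend'
  have hderiv := (intervalIntegral.integral_hasDerivAt_right (hc.intervalIntegrable 0 s)
    (hc.stronglyMeasurableAtFilter _ _) hc.continuousAt).hasDerivWithinAt (s := Icc 0 1)
  rw [IccExtend_of_mem _ _ hs] at hderiv
  refine hderiv.congr (fun t ht => ?_) ?_
  · rw [primitive_apply, projIcc_of_mem _ ht]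
  · rw [primitive_apply, projIcc_of_mem _ hs]

/-- Multiplication of paths by `s ↦ exp (M s)`. Conjugation by it amounts to the use of a weighted
norm, for which Volterra operators are contractions. -/
def expWeight (M : ℝ) : C(unitInterval, V) →L[ℝ] C(unitInterval, V) :=
  pointwiseApply ⟨fun s => Real.exp (M * s) • ContinuousLinearMap.id ℝ V, by fun_prop⟩

@[simp] theorem expWeight_apply (M : ℝ) (γ : C(unitInterval, V)) (s : unitInterval) :
    expWeight M γ s = Real.exp (M * s) • γ s := rfl

@[simp] theorem expWeight_expWeight_neg (M : ℝ) (γ : C(unitInterval, V)) :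
    expWeight M (expWeight (-M) γ) = γ := by
  ext s
  simp [smul_smul, ← Real.exp_add]

@[simp] theorem expWeight_neg_expWeight (M : ℝ) (γ : C(unitInterval, V)) :
    expWeight (-M) (expWeight M γ) = γ := by
  simpa using expWeight_expWeight_neg (-M) γ

theorem norm_expWeight_neg_primitive_le {M C : ℝ} (hM : 0 < M) (hC : 0 ≤ C)
    {h : C(unitInterval, V)} (hh : ∀ s, ‖h s‖ ≤ C * Real.exp (M * s)) :
    ‖expWeight (-M) (primitive h)‖ ≤ C / M := by
  refine (ContinuousMap.norm_le _ (by positivity)).2 fun t => ?_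
  have hle : ‖primitive h t‖ ≤ ∫ s in (0 : ℝ)..t, C * Real.exp (M * s) := by
    refine intervalIntegral.norm_integral_le_of_norm_le t.2.1
      (MeasureTheory.ae_of_all _ fun s hs => ?_)
      (Continuous.intervalIntegrable (by fun_prop) _ _)
    rw [IccExtend_of_mem _ _ ⟨hs.1.le, hs.2.trans t.2.2⟩]
    exact hh _
  have hint : ∫ s in (0 : ℝ)..t, C * Real.exp (M * s) ≤ C / M * Real.exp (M * t) := by
    rw [intervalIntegral.integral_const_mul, intervalIntegral.integral_comp_mul_left _ hM.ne',
      integral_exp, mul_zero, Real.exp_zero, smul_eq_mul, ← mul_assoc, ← div_eq_mul_inv]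
    gcongr
    linarith
  calc ‖expWeight (-M) (primitive h) t‖ = Real.exp (-M * t) * ‖primitive h t‖ := by
        rw [expWeight_apply, norm_smul, Real.norm_of_nonneg (Real.exp_pos _).le]
    _ ≤ Real.exp (-M * t) * (C / M * Real.exp (M * t)) := by gcongr; exact hle.trans hint
    _ = C / M := by rw [mul_left_comm, ← Real.exp_add]; simp

theorem exists_contDiff_inverse_sub_primitive [CompleteSpace V] {m : WithTop ℕ∞} (hm : m ≠ 0)
    {N : C(unitInterval, V) → C(unitInterval, V)} (hN : ContDiff ℝ m N) {K : NNReal}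
    (hK : ∀ γ δ s, ‖N γ s - N δ s‖ ≤ K * ‖γ s - δ s‖) :
    ∃ S : C(unitInterval, V) → C(unitInterval, V), ContDiff ℝ m S ∧
      Function.LeftInverse S (fun γ => γ - primitive (N γ)) ∧
      Function.RightInverse S (fun γ => γ - primitive (N γ)) := by
  let M : NNReal := 2 * K + 1
  have hM : 0 < (M : ℝ) := by positivity
  let T : C(unitInterval, V) → C(unitInterval, V) := fun γ =>
    γ - expWeight (-M) (primitive (N (expWeight M γ)))
  have hT : ContDiff ℝ m T := contDiff_id.sub <| (expWeight _).contDiff.comp <|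
    primitive.contDiff.comp <| hN.comp (expWeight _).contDiff
  have hTl : LipschitzWith (K / M) (fun γ => T γ - γ) := by
    refine LipschitzWith.of_dist_le_mul fun γ δ => ?_
    rw [dist_eq_norm, dist_eq_norm]
    have hsub : T γ - γ - (T δ - δ) =
        expWeight (-M) (primitive (N (expWeight M δ) - N (expWeight M γ))) := by
      simp only [T, map_sub]
      abel
    rw [hsub, NNReal.coe_div, div_mul_eq_mul_div]
    refine norm_expWeight_neg_primitive_le hM (by positivity) fun s => ?_
    calc ‖(N (expWeight M δ) - N (expWeight M γ)) s‖
        ≤ K * ‖expWeight M δ s - expWeight M γ s‖ := hK _ _ s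
      _ = K * (Real.exp (M * s) * ‖(γ - δ) s‖) := by
        rw [expWeight_apply, expWeight_apply, ← smul_sub, norm_smul,
          Real.norm_of_nonneg (Real.exp_pos _).le, norm_sub_rev, ContinuousMap.sub_apply]
      _ ≤ K * (Real.exp (M * s) * ‖γ - δ‖) := by gcongr; exact (γ - δ).norm_coe_le_norm s
      _ = K * ‖γ - δ‖ * Real.exp (M * s) := by ring
  have hlt : K / M < 1 := by
    rw [div_lt_one (by positivity), ← NNReal.coe_lt_coe]
    push_cast [M]
    linarith [K.2]
  obtain ⟨S, hS, hleft, hright⟩ := exists_contDiff_inverse_of_lipschitzWith_sub_id hm hT hlt hTl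
  have hconj : ∀ γ, expWeight (-M) (expWeight M γ - primitive (N (expWeight M γ))) = T γ :=
    fun γ => by simp only [map_sub, expWeight_neg_expWeight, T]
  refine ⟨fun c => expWeight M (S (expWeight (-M) c)),
    (expWeight _).contDiff.comp (hS.comp (expWeight _).contDiff), fun γ => ?_, fun c => ?_⟩
  · have h := hconj (expWeight (-M) γ)
    rw [expWeight_expWeight_neg] at h
    simp only [h, hleft _, expWeight_expWeight_neg]
  · have h := congrArg (expWeight (M : ℝ)) (hconj (S (expWeight (-M) c)))
    rwa [expWeight_expWeight_neg, hright, expWeight_expWeight_neg] at h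

end Volterra

section Flow

universe u
variable {V : Type u} [NormedAddCommGroup V] [NormedSpace ℝ V]

/-- The substitution operator `γ ↦ (s ↦ v (s, γ s))` on paths. -/
def substitution (v : C(ℝ × V, V)) (γ : C(unitInterval, V)) : C(unitInterval, V) :=
  v.comp ⟨fun s => (s, γ s), by fun_prop⟩

theorem contDiff_substitution {m : ℕ∞} {v : C(ℝ × V, V)} (hv : ContDiff ℝ m v) :
    ContDiff ℝ m (substitution v) := by
  let graph : C(unitInterval, V) → C(unitInterval, ℝ × V) := fun γ =>
    ⟨fun s => (s, γ s), by fun_prop⟩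
  let times : C(unitInterval, ℝ × V) := ⟨fun s => (s, 0), by fun_prop⟩
  have hgraph : graph = fun γ =>
      times + (ContinuousLinearMap.inr ℝ ℝ V).compLeftContinuous ℝ unitInterval γ := by
    funext γ
    ext s <;> simp [graph, times]
  have hgraph_smooth : ContDiff ℝ m graph := by
    rw [hgraph]
    exact contDiff_const.add (ContinuousLinearMap.contDiff _)
  exact (contDiff_comp_continuousMap v hv).comp hgraph_smooth

theorem fderiv_substitution_apply {v : C(ℝ × V, V)} (hv : ContDiff ℝ ∞ v)
    (γ h : C(unitInterval, V)) (s : unitInterval) :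
    fderiv ℝ (substitution v) γ h s = fderiv ℝ (fun q => v (s, q)) (γ s) (h s) := by
  let eval : C(unitInterval, V) →L[ℝ] V := ContinuousMap.evalCLM ℝ s
  have hleft : HasFDerivAt (fun γ => v (s, γ s)) (eval ∘L fderiv ℝ (substitution v) γ) γ :=
    eval.hasFDerivAt.comp γ ((contDiff_substitution hv).differentiable (by simp) γ).hasFDerivAt
  have hvs : ContDiff ℝ ∞ (fun q => v (s, q)) := hv.comp (contDiff_const.prodMk contDiff_id)
  have hright : HasFDerivAt (fun γ => v (s, γ s)) (fderiv ℝ (fun q => v (s, q)) (γ s) ∘L eval) γ :=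
    (hvs.differentiable (by simp) (eval γ)).hasFDerivAt.comp γ eval.hasFDerivAt
  exact congrArg (fun L => L h) (hleft.unique hright)

/-- `φ` is the flow on `[0,1]` of the time-dependent vector field `v`: it starts at the identity,
its orbits are integral curves, every `φ s` is smooth, and the derivatives `D(φ s)` solve the
variational equation. -/
structure IsSmoothFlow (v φ : ℝ → V → V) : Prop where
  map_zero : ∀ q, φ 0 q = q
  isIntegralCurveOn : ∀ q, IsIntegralCurveOn (fun s => φ s q) v (Icc 0 1)
  contDiff : ∀ s, ContDiff ℝ ∞ (φ s)
  variational : ∀ q ξ, IsIntegralCurveOn (fun s => fderiv ℝ (φ s) q ξ)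
    (fun s => fderiv ℝ (v s) (φ s q)) (Icc 0 1)

theorem eval_zero_of_eq_add_primitive {γ h : C(unitInterval, V)} {q : V}
    (hγ : γ = constCLM q + primitive h) : γ (projIcc 0 1 zero_le_one 0) = q := by
  rw [hγ, projIcc_left]
  change q + primitive h 0 = q
  simp

theorem hasDerivWithinAt_of_eq_add_primitive [CompleteSpace V] {γ h : C(unitInterval, V)} {q : V}
    (hγ : γ = constCLM q + primitive h) {s : ℝ} (hs : s ∈ Icc (0 : ℝ) 1) :
    HasDerivWithinAt (fun t => γ (projIcc 0 1 zero_le_one t)) (h ⟨s, hs⟩) (Icc 0 1) s := by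
  rw [hγ]
  exact (hasDerivWithinAt_primitive h hs).const_add q

theorem exists_isSmoothFlow [CompleteSpace V] {v : ℝ → V → V}
    (hv : ContDiff ℝ ∞ (Function.uncurry v)) {K : NNReal}
    (hK : ∀ s ∈ Icc (0 : ℝ) 1, LipschitzWith K (v s)) : ∃ φ, IsSmoothFlow v φ := by
  let vc : C(ℝ × V, V) := ⟨Function.uncurry v, hv.continuous⟩
  have hN : ContDiff ℝ ∞ (substitution vc) := contDiff_substitution hv
  obtain ⟨S, hS, -, hSright⟩ := exists_contDiff_inverse_sub_primitive (by simp) hN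
    fun γ δ s => (hK s s.2).norm_sub_le (γ s) (δ s)
  have hSeq : ∀ c, S c = c + primitive (substitution vc (S c)) :=
    fun c => sub_eq_iff_eq_add.1 (hSright c)
  have hS_at : ∀ c, HasFDerivAt S (fderiv ℝ S c) c :=
    fun c => (hS.differentiable (by simp) c).hasFDerivAt
  have hSfderiv : ∀ c h, fderiv ℝ S c h =
      h + primitive (fderiv ℝ (substitution vc) (S c) (fderiv ℝ S c h)) := by
    intro c h
    have hright := (hasFDerivAt_id (𝕜 := ℝ) c).add (primitive.hasFDerivAt.comp c
      ((hN.differentiable (by simp) (S c)).hasFDerivAt.comp c (hS_at c)))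
    exact congrArg (fun L => L h) ((hS_at c).unique (hright.congr_of_eventuallyEq
      (Filter.Eventually.of_forall hSeq)))
  let eval : ℝ → C(unitInterval, V) →L[ℝ] V := fun t =>
    ContinuousMap.evalCLM ℝ (projIcc 0 1 zero_le_one t)
  let φ : ℝ → V → V := fun t q => eval t (S (constCLM q))
  have hφ : ∀ t q ξ, fderiv ℝ (φ t) q ξ = eval t (fderiv ℝ S (constCLM q) (constCLM ξ)) :=
    fun t q ξ => congrArg (fun L => L ξ) ((eval t).hasFDerivAt.comp q
      ((hS_at (constCLM q)).comp q (constCLM (E := V)).hasFDerivAt)).fderiv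
  refine ⟨φ, fun q => eval_zero_of_eq_add_primitive (hSeq _), fun q s hs => ?_,
    fun t => (eval t).contDiff.comp
      (hS.comp (constCLM (K := unitInterval) (E := V)).contDiff), fun q ξ s hs => ?_⟩
  · refine (hasDerivWithinAt_of_eq_add_primitive (hSeq (constCLM q)) hs).congr_deriv ?_
    simp only [φ, eval, projIcc_of_mem _ hs]
    rfl
  · simp only [hφ]
    refine (hasDerivWithinAt_of_eq_add_primitive
      (hSfderiv (constCLM q) (constCLM ξ)) hs).congr_deriv ?_
    rw [fderiv_substitution_apply (v := vc) hv]
    simp only [φ, eval, projIcc_of_mem _ hs]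
    rfl

theorem eq_zero_of_norm_deriv_le_mul_norm_right {E : Type*} [NormedAddCommGroup E]
    [NormedSpace ℝ E] {g g' : ℝ → E} {a b C : ℝ}
    (hg : ∀ s ∈ Icc a b, HasDerivWithinAt g (g' s) (Icc a b) s)
    (hC : ∀ s ∈ Icc a b, ‖g' s‖ ≤ C * ‖g s‖) (hga : g a = 0) {s : ℝ} (hs : s ∈ Icc a b) :
    g s = 0 :=
  eq_zero_of_abs_deriv_le_mul_abs_self_of_eq_zero_right
    (fun x hx => (hg x hx).continuousWithinAt)
    (fun x hx => (hg x (Ico_subset_Icc_self hx)).mono_of_mem_nhdsWithin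
      (Filter.mem_of_superset (Icc_mem_nhdsGE hx.2) (Icc_subset_Icc_left hx.1)))
    hga (fun x hx => hC x (Ico_subset_Icc_self hx)) s hs

theorem eq_zero_of_norm_deriv_le_mul_norm {E : Type*} [NormedAddCommGroup E] [NormedSpace ℝ E]
    {g g' : ℝ → E} {a b C : ℝ} (hg : ∀ s ∈ Icc a b, HasDerivWithinAt g (g' s) (Icc a b) s)
    (hC : ∀ s ∈ Icc a b, ‖g' s‖ ≤ C * ‖g s‖) {s₀ : ℝ} (hs₀ : s₀ ∈ Icc a b) (h₀ : g s₀ = 0)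
    {s : ℝ} (hs : s ∈ Icc a b) : g s = 0 := by
  rcases le_total s₀ s with h | h
  · have hsub : Icc s₀ b ⊆ Icc a b := Icc_subset_Icc_left hs₀.1
    exact eq_zero_of_norm_deriv_le_mul_norm_right (fun x hx => (hg x (hsub hx)).mono hsub)
      (fun x hx => hC x (hsub hx)) h₀ ⟨h, hs.2⟩
  · have hmaps : MapsTo Neg.neg (Icc (-s₀) (-a)) (Icc a b) := fun x hx =>
      ⟨by linarith [hx.2], by linarith [hx.1, hs₀.2]⟩
    have hreflect : ∀ x ∈ Icc (-s₀) (-a),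
        HasDerivWithinAt (fun x => g (-x)) (-g' (-x)) (Icc (-s₀) (-a)) x := fun x hx => by
      simpa [Function.comp_def] using
        (hg (-x) (hmaps hx)).scomp x (hasDerivAt_neg x).hasDerivWithinAt hmaps
    simpa using eq_zero_of_norm_deriv_le_mul_norm_right hreflect
      (fun x hx => (norm_neg (g' (-x))).trans_le (hC _ (hmaps hx))) (by simpa using h₀)
      (s := -s) ⟨by linarith, by linarith [hs.1]⟩

theorem eqOn_of_isIntegralCurveOn {v : ℝ → V → V} {a b : ℝ} {K : NNReal}
    (hK : ∀ s ∈ Icc a b, LipschitzWith K (v s)) {γ δ : ℝ → V}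
    (hγ : IsIntegralCurveOn γ v (Icc a b)) (hδ : IsIntegralCurveOn δ v (Icc a b)) {s₀ : ℝ}
    (hs₀ : s₀ ∈ Icc a b) (h₀ : γ s₀ = δ s₀) : EqOn γ δ (Icc a b) := fun _ hs =>
  sub_eq_zero.1 <| eq_zero_of_norm_deriv_le_mul_norm (g := fun s => γ s - δ s)
    (fun s hs => (hγ s hs).sub (hδ s hs)) (fun s hs => (hK s hs).norm_sub_le _ _) hs₀
    (sub_eq_zero.2 h₀) hs

theorem isIntegralCurveOn_reverse {v : ℝ → V → V} {γ : ℝ → V}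
    (hγ : IsIntegralCurveOn γ v (Icc 0 1)) :
    IsIntegralCurveOn (fun s => γ (1 - s)) (fun s q => -v (1 - s) q) (Icc 0 1) := by
  have hmaps : MapsTo (fun s : ℝ => 1 - s) (Icc 0 1) (Icc 0 1) := fun s hs =>
    ⟨by linarith [hs.2], by linarith [hs.1]⟩
  intro s hs
  simpa [Function.comp_def] using (hγ (1 - s) (hmaps hs)).scomp s
    ((hasDerivAt_id s).const_sub 1).hasDerivWithinAt hmaps

theorem leftInverse_of_isSmoothFlow {v φ ψ : ℝ → V → V} {K : NNReal}
    (hK : ∀ s ∈ Icc (0 : ℝ) 1, LipschitzWith K (v s)) (hφ : IsSmoothFlow v φ)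
    (hψ : IsSmoothFlow (fun s q => -v (1 - s) q) ψ) :
    Function.LeftInverse (φ 1) (ψ 1) := fun q => by
  have hreverse : IsIntegralCurveOn (fun s => ψ (1 - s) q) v (Icc 0 1) := by
    simpa using isIntegralCurveOn_reverse (hψ.isIntegralCurveOn q)
  have heq := eqOn_of_isIntegralCurveOn hK (hφ.isIntegralCurveOn (ψ 1 q)) hreverse
    (left_mem_Icc.2 zero_le_one) (by simp [hφ.map_zero])
  simpa [hψ.map_zero] using heq (right_mem_Icc.2 zero_le_one)

theorem IsSmoothFlow.exists_inverse [CompleteSpace V] {v φ : ℝ → V → V}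
    (hv : ContDiff ℝ ∞ (Function.uncurry v)) {K : NNReal}
    (hK : ∀ s ∈ Icc (0 : ℝ) 1, LipschitzWith K (v s)) (hφ : IsSmoothFlow v φ) :
    ∃ Ψ, ContDiff ℝ ∞ Ψ ∧ Function.LeftInverse Ψ (φ 1) ∧ Function.RightInverse Ψ (φ 1) := by
  have hKrev : ∀ s ∈ Icc (0 : ℝ) 1, LipschitzWith K (fun q => -v (1 - s) q) := fun s hs =>
    (hK (1 - s) ⟨by linarith [hs.2], by linarith [hs.1]⟩).neg
  have hvrev : ContDiff ℝ ∞ (Function.uncurry fun s q => -v (1 - s) q) :=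
    (hv.comp ((contDiff_const.sub contDiff_fst).prodMk contDiff_snd)).neg
  obtain ⟨ψ, hψ⟩ := exists_isSmoothFlow hvrev hKrev
  exact ⟨ψ 1, hψ.contDiff 1, leftInverse_of_isSmoothFlow hKrev hψ (by simpa using hφ),
    leftInverse_of_isSmoothFlow hK hφ hψ⟩

theorem IsSmoothFlow.eq_of_eq_zero {v φ : ℝ → V → V} (hφ : IsSmoothFlow v φ) {K : NNReal}
    (hK : ∀ s ∈ Icc (0 : ℝ) 1, LipschitzWith K (v s)) {q : V} {s₀ s : ℝ}
    (hs₀ : s₀ ∈ Icc (0 : ℝ) 1) (h₀ : ∀ s, v s (φ s₀ q) = 0) (hs : s ∈ Icc (0 : ℝ) 1) :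
    φ s q = φ s₀ q :=
  eqOn_of_isIntegralCurveOn hK (hφ.isIntegralCurveOn q)
    (fun s _ => (hasDerivWithinAt_const s _ _).congr_deriv (h₀ s).symm) hs₀ rfl hs

theorem IsSmoothFlow.mem_of_eq_zero_off {v φ : ℝ → V → V} (hφ : IsSmoothFlow v φ) {K : NNReal}
    (hK : ∀ s ∈ Icc (0 : ℝ) 1, LipschitzWith K (v s)) {S : Set V}
    (hS : ∀ s, ∀ q ∉ S, v s q = 0) {q : V} (hq : q ∈ S) {s : ℝ} (hs : s ∈ Icc (0 : ℝ) 1) :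
    φ s q ∈ S := by
  by_contra hout
  have heq := hφ.eq_of_eq_zero hK hs (fun r => hS r _ hout) (left_mem_Icc.2 zero_le_one)
  rw [hφ.map_zero] at heq
  exact hout (heq ▸ hq)

theorem exists_lipschitzWith_of_eq_zero_off_isCompact {v : ℝ → V → V}
    (hv : ContDiff ℝ ∞ (Function.uncurry v)) {K : Set V} (hK : IsCompact K)
    (h₀ : ∀ s, ∀ q ∉ K, v s q = 0) :
    ∃ L : NNReal, ∀ s ∈ Icc (0 : ℝ) 1, LipschitzWith L (v s) := by
  have hfderiv : ContDiff ℝ ∞ (fun x : ℝ × V => fderiv ℝ (v x.1) x.2) :=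
    ContDiff.fderiv (f := fun (x : ℝ × V) q => v x.1 q)
      (hv.comp ((contDiff_fst.comp contDiff_fst).prodMk contDiff_snd)) contDiff_snd (by simp)
  obtain ⟨L, hL⟩ := ((isCompact_Icc (a := (0 : ℝ)) (b := 1)).prod hK).exists_bound_of_continuousOn
    hfderiv.continuous.continuousOn
  refine ⟨L.toNNReal, fun s hs => lipschitzWith_of_nnnorm_fderiv_le
    ((hv.comp (contDiff_const.prodMk contDiff_id)).differentiable (by simp)) fun q => ?_⟩
  by_cases hq : q ∈ K
  · exact NNReal.le_toNNReal_of_coe_le (hL (s, q) ⟨hs, hq⟩)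
  · have hzero : v s =ᶠ[nhds q] fun _ => 0 :=
      Filter.eventuallyEq_of_mem (hK.isClosed.isOpen_compl.mem_nhds hq) (h₀ s)
    simp [hzero.fderiv_eq]

end Flow

/-! ### Linear symplectic algebra on the ambient space -/

section Symplectic

variable {n : ℕ}

/-- The constant symplectic form `Im (∑ ξᵢ η̄ᵢ)`, which is `ω₀ / 2i` in logarithmic coordinates. -/
def sympl : Ambient n →ₗ[ℝ] Ambient n →ₗ[ℝ] ℝ :=
  LinearMap.mk₂ ℝ (fun ξ η => (∑ i, (ξ.1 i * star (η.1 i)).im) + (ξ.2.1 * star η.2.1).im +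
      (ξ.2.2 * star η.2.2).im)
    (fun ξ ξ' η => by simp [add_mul, Finset.sum_add_distrib]; ring)
    (fun c ξ η => by simp [Finset.mul_sum, mul_add, mul_assoc])
    (fun ξ η η' => by simp [mul_add, Finset.sum_add_distrib]; ring)
    (fun c ξ η => by
      simp only [Prod.smul_fst, Prod.smul_snd, Pi.smul_apply, star_smul, star_trivial,
        mul_smul_comm, Complex.smul_im, smul_eq_mul, Finset.mul_sum, mul_add])

theorem sympl_apply (ξ η : Ambient n) : sympl ξ η =
    (∑ i, (ξ.1 i * star (η.1 i)).im) + (ξ.2.1 * star η.2.1).im + (ξ.2.2 * star η.2.2).im := rfl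

theorem sympl_antisymm (ξ η : Ambient n) : sympl ξ η = -sympl η ξ := by
  have hflip : ∀ z w : ℂ, (z * star w).im = -(w * star z).im := fun z w => by simp; ring
  rw [sympl_apply, sympl_apply, hflip ξ.2.1, hflip ξ.2.2,
    Finset.sum_congr rfl fun i _ => hflip (ξ.1 i) _, Finset.sum_neg_distrib]
  ring

theorem sympl_self (ξ : Ambient n) : sympl ξ ξ = 0 := by
  linarith [sympl_antisymm ξ ξ]

theorem sympl_I_smul_self (ξ : Ambient n) : sympl (Complex.I • ξ) ξ =
    (∑ i, Complex.normSq (ξ.1 i)) + Complex.normSq ξ.2.1 + Complex.normSq ξ.2.2 := by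
  simp [sympl_apply, Complex.normSq_apply, add_comm]

theorem eq_zero_of_forall_sympl_eq_zero {ξ : Ambient n} (h : ∀ η, sympl ξ η = 0) : ξ = 0 := by
  have hsum := sympl_I_smul_self ξ
  rw [sympl_antisymm, h, neg_zero] at hsum
  have hnonneg : ∀ i ∈ Finset.univ, 0 ≤ Complex.normSq (ξ.1 i) := fun i _ => Complex.normSq_nonneg _
  have hz := Finset.sum_nonneg hnonneg
  have hu := Complex.normSq_nonneg ξ.2.1
  have hv := Complex.normSq_nonneg ξ.2.2
  have hz_eq := (Finset.sum_eq_zero_iff_of_nonneg hnonneg).1 (by linarith)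
  exact Prod.ext (funext fun i => Complex.normSq_eq_zero.1 (hz_eq i (Finset.mem_univ i)))
    (Prod.ext (Complex.normSq_eq_zero.1 (by linarith)) (Complex.normSq_eq_zero.1 (by linarith)))

theorem hasDerivWithinAt_sympl {y₁ y₂ : ℝ → Ambient n} {y₁' y₂' : Ambient n} {s : ℝ} {S : Set ℝ}
    (h₁ : HasDerivWithinAt y₁ y₁' S s) (h₂ : HasDerivWithinAt y₂ y₂' S s) :
    HasDerivWithinAt (fun s => sympl (y₁ s) (y₂ s)) (sympl y₁' (y₂ s) + sympl (y₁ s) y₂') S s := by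
  have hbilin := (LinearMap.toContinuousBilinearMap (sympl (n := n))).hasFDerivWithinAt_of_bilinear
    h₁.hasFDerivWithinAt h₂.hasFDerivWithinAt
  exact hbilin.hasDerivWithinAt.congr_deriv (by simp [add_comm])

/-- The coordinate vector of `zᵢ`. -/
def basisZ (i : Fin n) : Ambient n := (Pi.single i 1, 0, 0)

/-- The coordinate vector of `u`. -/
def basisU : Ambient n := (0, 1, 0)

/-- The coordinate vector of `v`. -/
def basisV : Ambient n := (0, 0, 1)

theorem eq_sum_basis (η : Ambient n) : η = (∑ i, η.1 i • basisZ i) + η.2.1 • basisU +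
    η.2.2 • basisV := by
  refine Prod.ext ?_ (Prod.ext ?_ ?_)
  · ext l
    simp [basisZ, basisU, basisV, Prod.fst_sum, Finset.sum_apply, Pi.single_apply]
  · simp [basisZ, basisU, basisV, Prod.snd_sum]
  · simp [basisZ, basisU, basisV, Prod.snd_sum]

/-- The coordinate of a symplectic gradient along the complex line spanned by `e`. -/
def gradCoord (e : Ambient n) : (Ambient n →L[ℝ] ℝ) →L[ℝ] ℂ :=
  Complex.I • (Complex.ofRealCLM ∘L ContinuousLinearMap.apply ℝ ℝ e) -
    Complex.ofRealCLM ∘L ContinuousLinearMap.apply ℝ ℝ (Complex.I • e)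

theorem gradCoord_apply (e : Ambient n) (ℓ : Ambient n →L[ℝ] ℝ) :
    gradCoord e ℓ = Complex.I * ℓ e - ℓ (Complex.I • e) := by
  simp [gradCoord]

theorem im_gradCoord_mul (e : Ambient n) (ℓ : Ambient n →L[ℝ] ℝ) (w : ℂ) :
    (gradCoord e ℓ * star w).im = ℓ (w • e) := by
  have hw : w • e = w.re • e + w.im • (Complex.I • e) := by
    conv_lhs => rw [← Complex.re_add_im w]
    rw [add_smul, mul_smul]
    simp
  rw [hw, map_add, map_smul, map_smul, gradCoord_apply]
  simp
  ring

/-- The symplectic gradient of a linear form: the vector dual to it with respect to `sympl`. -/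
def sgrad : (Ambient n →L[ℝ] ℝ) →L[ℝ] Ambient n :=
  (ContinuousLinearMap.pi fun i => gradCoord (basisZ i)).prod
    ((gradCoord basisU).prod (gradCoord basisV))

theorem sympl_sgrad (ℓ : Ambient n →L[ℝ] ℝ) (η : Ambient n) : sympl (sgrad ℓ) η = ℓ η := by
  conv_rhs => rw [eq_sum_basis η]
  simp only [map_add, map_sum, ← im_gradCoord_mul]
  rfl

/-- The Poisson bracket of the imaginary and the real part of a complex valued linear form. -/
def poisson (L : Ambient n →L[ℝ] ℂ) : ℝ :=
  sympl (sgrad (Complex.imCLM ∘L L)) (sgrad (Complex.reCLM ∘L L))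

theorem eq_sgrad_of_forall_sympl_eq {ξ : Ambient n} {ℓ : Ambient n →L[ℝ] ℝ}
    (h : ∀ η, sympl ξ η = ℓ η) : ξ = sgrad ℓ :=
  sub_eq_zero.1 (eq_zero_of_forall_sympl_eq_zero fun η => by
    rw [map_sub, LinearMap.sub_apply, h, sympl_sgrad, sub_self])

theorem apply_sgrad_re (L : Ambient n →L[ℝ] ℂ) :
    L (sgrad (Complex.reCLM ∘L L)) = (poisson L : ℂ) * Complex.I := by
  have hre := sympl_sgrad (Complex.reCLM ∘L L) (sgrad (Complex.reCLM ∘L L))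
  have him := sympl_sgrad (Complex.imCLM ∘L L) (sgrad (Complex.reCLM ∘L L))
  rw [sympl_self] at hre
  apply Complex.ext
  · simpa using hre.symm
  · simpa [poisson] using him.symm

theorem apply_sgrad_im (L : Ambient n →L[ℝ] ℂ) :
    L (sgrad (Complex.imCLM ∘L L)) = -(poisson L : ℂ) := by
  have hre := sympl_sgrad (Complex.reCLM ∘L L) (sgrad (Complex.imCLM ∘L L))
  have him := sympl_sgrad (Complex.imCLM ∘L L) (sgrad (Complex.imCLM ∘L L))
  rw [sympl_antisymm] at hre
  rw [sympl_self] at him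
  apply Complex.ext
  · simpa [poisson] using hre.symm
  · simpa using him.symm

theorem exists_preimage_mem_span_sgrad {L : Ambient n →L[ℝ] ℂ} (h : poisson L ≠ 0) (w : ℂ) :
    ∃ a b : ℝ, L (a • sgrad (Complex.reCLM ∘L L) + b • sgrad (Complex.imCLM ∘L L)) = w := by
  refine ⟨w.im / poisson L, -(w.re / poisson L), ?_⟩
  rw [map_add, map_smul, map_smul, apply_sgrad_re, apply_sgrad_im]
  apply Complex.ext <;> simp <;> field_simp

theorem surjective_of_poisson_ne_zero {L : Ambient n →L[ℝ] ℂ} (h : poisson L ≠ 0) :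
    Function.Surjective L := fun w =>
  let ⟨_, _, hab⟩ := exists_preimage_mem_span_sgrad h w
  ⟨_, hab⟩

theorem eq_zero_of_poisson_ne_zero {L : Ambient n →L[ℝ] ℂ} (h : poisson L ≠ 0) {ξ : Ambient n}
    (hξ : L ξ = 0) (hω : ∀ η, L η = 0 → sympl ξ η = 0) : ξ = 0 := by
  refine eq_zero_of_forall_sympl_eq_zero fun η => ?_
  obtain ⟨a, b, hab⟩ := exists_preimage_mem_span_sgrad h (L η)
  set ζ := a • sgrad (Complex.reCLM ∘L L) + b • sgrad (Complex.imCLM ∘L L) with hζ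
  have hζξ : sympl ξ ζ = 0 := by
    rw [sympl_antisymm, hζ]
    simp [sympl_sgrad, hξ]
  have hker : sympl ξ (η - ζ) = 0 := hω _ (by rw [map_sub, hab, sub_self])
  rwa [map_sub, hζξ, sub_zero] at hker

theorem contDiff_poisson : ContDiff ℝ ∞ (poisson (n := n)) := by
  have hgrad : ∀ A : ℂ →L[ℝ] ℝ, ContDiff ℝ ∞ (fun L : Ambient n →L[ℝ] ℂ => sgrad (A ∘L L)) :=
    fun A => sgrad.contDiff.comp (contDiff_const.clm_comp contDiff_id)
  exact ((LinearMap.toContinuousBilinearMap (sympl (n := n))).contDiff.comp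
    (hgrad Complex.imCLM)).clm_apply (hgrad Complex.reCLM)

end Symplectic

/-! ### Hamiltonian vector fields in logarithmic coordinates -/

section Hamiltonian

variable {n : ℕ}

/-- The open subset `(ℂ^*)ⁿ × ℂ²` of the ambient space. -/
def space (n : ℕ) : Set (Ambient n) := {q | q.1 ∈ torus n}

theorem isOpen_torus : IsOpen (torus n) := by
  have h : torus n = ⋂ i, {z : Fin n → ℂ | z i ≠ 0} := by ext; simp [torus]
  rw [h]
  exact isOpen_iInter_of_finite fun i => isOpen_ne_fun (continuous_apply i) continuous_const

theorem isOpen_space : IsOpen (space n) := isOpen_torus.preimage continuous_fst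

/-- The linear map sending the logarithmic coordinates `(dzᵢ / zᵢ, du, dv)` of a tangent vector at
`q` to the vector. -/
def twist (q : Ambient n) : Ambient n →L[ℝ] Ambient n :=
  ContinuousLinearMap.mul ℝ (Ambient n) (q.1, 1)

theorem twist_apply (q ξ : Ambient n) : twist q ξ = (q.1 * ξ.1, ξ.2) := by
  simp [twist, Prod.mul_def]

theorem contDiff_twist : ContDiff ℝ ∞ (twist (n := n)) :=
  (ContinuousLinearMap.mul ℝ (Ambient n)).contDiff.comp (contDiff_fst.prodMk contDiff_const)

/-- The logarithmic coordinates of a tangent vector at `q`. -/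
def untwist (q ξ : Ambient n) : Ambient n := (fun i => ξ.1 i / q.1 i, ξ.2)

theorem twist_untwist {q : Ambient n} (hq : q ∈ space n) (ξ : Ambient n) :
    twist q (untwist q ξ) = ξ := by
  rw [twist_apply]
  exact Prod.ext (funext fun i => mul_div_cancel₀ _ (hq i)) rfl

theorem untwist_twist {q : Ambient n} (hq : q ∈ space n) (ξ : Ambient n) :
    untwist q (twist q ξ) = ξ := by
  rw [twist_apply]
  exact Prod.ext (funext fun i => mul_div_cancel_left₀ _ (hq i)) rfl

theorem omega_eq (q ξ η : Ambient n) :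
    omega q ξ η = 2 * Complex.I * (sympl (untwist q ξ) (untwist q η) : ℂ) := by
  have hsub : ∀ z w : ℂ, z * star w - w * star z = 2 * Complex.I * ((z * star w).im : ℂ) := by
    intro z w
    apply Complex.ext <;> simp <;> ring
  have hdiv : ∀ z w a : ℂ, (z * star w - w * star z) / ((‖a‖ : ℂ) ^ 2) =
      2 * Complex.I * ((z / a * star (w / a)).im : ℂ) := by
    intro z w a
    rw [← hsub, star_div₀, star_div₀, ← Complex.mul_conj', ← Complex.star_def, div_mul_div_comm,
      div_mul_div_comm, sub_div]
  rw [sympl_apply, omega, hsub ξ.2.1, hsub ξ.2.2, Finset.sum_congr rfl fun i _ => hdiv _ _ _]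
  push_cast
  simp only [untwist, mul_add, Finset.mul_sum]

/-- The differential in logarithmic coordinates. -/
def logForm {E : Type*} [NormedAddCommGroup E] [NormedSpace ℝ E] (F : Ambient n → E)
    (q : Ambient n) : Ambient n →L[ℝ] E := fderiv ℝ F q ∘L twist q

/-- The Hamiltonian vector field in logarithmic coordinates. -/
def logHam (F : Ambient n → ℝ) (q : Ambient n) : Ambient n := sgrad (logForm F q)

/-- The Hamiltonian vector field of `F` with respect to `ω₀ / 2i`. -/
def hamField (F : Ambient n → ℝ) (q : Ambient n) : Ambient n := twist q (logHam F q)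

theorem contDiff_logForm {E : Type*} [NormedAddCommGroup E] [NormedSpace ℝ E]
    {F : Ambient n → E} (hF : ContDiff ℝ ∞ F) : ContDiff ℝ ∞ (logForm F) :=
  (hF.fderiv_right (by simp)).clm_comp contDiff_twist

theorem contDiffOn_logForm {E : Type*} [NormedAddCommGroup E] [NormedSpace ℝ E]
    {F : Ambient n → E} (hF : ContDiffOn ℝ ∞ F (space n)) :
    ContDiffOn ℝ ∞ (logForm F) (space n) :=
  (hF.fderiv_of_isOpen isOpen_space (by simp)).clm_comp contDiff_twist.contDiffOn

theorem contDiff_logHam {F : Ambient n → ℝ} (hF : ContDiff ℝ ∞ F) : ContDiff ℝ ∞ (logHam F) :=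
  sgrad.contDiff.comp (contDiff_logForm hF)

theorem contDiff_logHam_uncurry {H : ℝ → Ambient n → ℝ}
    (hH : ContDiff ℝ ∞ (Function.uncurry H)) :
    ContDiff ℝ ∞ (Function.uncurry fun s => logHam (H s)) := by
  have hfderiv : ContDiff ℝ ∞ (fun x : ℝ × Ambient n => fderiv ℝ (H x.1) x.2) :=
    ContDiff.fderiv (f := fun (x : ℝ × Ambient n) q => H x.1 q)
      (hH.comp ((contDiff_fst.comp contDiff_fst).prodMk contDiff_snd)) contDiff_snd (by simp)
  exact sgrad.contDiff.comp (hfderiv.clm_comp (contDiff_twist.comp contDiff_snd))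

theorem contDiff_hamField_uncurry {H : ℝ → Ambient n → ℝ}
    (hH : ContDiff ℝ ∞ (Function.uncurry H)) :
    ContDiff ℝ ∞ (Function.uncurry fun s => hamField (H s)) :=
  (contDiff_twist.comp contDiff_snd).clm_apply (contDiff_logHam_uncurry hH)

/-- The derivative of `q ↦ twist q y`. -/
def twistDeriv (y : Ambient n) : Ambient n →L[ℝ] Ambient n :=
  ((ContinuousLinearMap.mul ℝ (Fin n → ℂ)).flip y.1 ∘L ContinuousLinearMap.fst ℝ _ _).prod 0

theorem twistDeriv_apply (y ξ : Ambient n) : twistDeriv y ξ = (ξ.1 * y.1, 0) := rfl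

theorem hasFDerivAt_twist (y q : Ambient n) :
    HasFDerivAt (fun q => twist q y) (twistDeriv y) q := by
  have haffine : (fun q : Ambient n => twist q y) = fun q => twistDeriv y q + (0, y.2) := by
    funext q; simp [twist_apply, twistDeriv_apply]
  rw [haffine]
  exact (twistDeriv y).hasFDerivAt.add_const _

theorem hasFDerivAt_twist_clm_apply {y : Ambient n → Ambient n} {y' : Ambient n →L[ℝ] Ambient n}
    {q : Ambient n} (hy : HasFDerivAt y y' q) :
    HasFDerivAt (fun q => twist q (y q)) (twist q ∘L y' + twistDeriv (y q)) q := by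
  have htwist := (contDiff_twist.differentiable (by simp) q).hasFDerivAt
  have hconst := (htwist.clm_apply (hasFDerivAt_const (y q) q)).unique (hasFDerivAt_twist _ q)
  refine (htwist.clm_apply hy).congr_fderiv ?_
  rw [← hconst]
  simp

theorem sympl_fderiv_logHam_apply {F : Ambient n → ℝ} (hF : ContDiff ℝ ∞ F) (q ξ y : Ambient n) :
    sympl (fderiv ℝ (logHam F) q ξ) y =
      fderiv ℝ (fderiv ℝ F) q ξ (twist q y) + fderiv ℝ F q (twistDeriv y ξ) := by
  let pairing : Ambient n →L[ℝ] ℝ := LinearMap.toContinuousLinearMap (sympl.flip y)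
  have hleft : HasFDerivAt (fun q => sympl (logHam F q) y)
      (pairing ∘L fderiv ℝ (logHam F) q) q :=
    pairing.hasFDerivAt.comp q ((contDiff_logHam hF).differentiable (by simp) q).hasFDerivAt
  have hright := (((hF.fderiv_right (m := ∞) (by simp)).differentiable
    (by simp) q).hasFDerivAt).clm_apply (hasFDerivAt_twist y q)
  have hpair : (fun q => sympl (logHam F q) y) = fun q => fderiv ℝ F q (twist q y) :=
    funext fun q => sympl_sgrad _ _
  rw [hpair] at hleft
  simpa [add_comm, pairing] using congrArg (fun L => L ξ) (hleft.unique hright)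

-- Symmetry of the second derivative: Hamiltonian vector fields are infinitesimally symplectic.
theorem sympl_fderiv_logHam {F : Ambient n → ℝ} (hF : ContDiff ℝ ∞ F) {q : Ambient n}
    (hq : q ∈ space n) (ξ η : Ambient n) :
    sympl (fderiv ℝ (logHam F) q ξ) (untwist q η) +
      sympl (untwist q ξ) (fderiv ℝ (logHam F) q η) = 0 := by
  have hsymm : IsSymmSndFDerivAt ℝ F q :=
    hF.contDiffAt.isSymmSndFDerivAt (by simpa using WithTop.coe_le_coe.2 (le_top : (2 : ℕ∞) ≤ ⊤))
  have hcomm : twistDeriv (untwist q η) ξ = twistDeriv (untwist q ξ) η := by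
    rw [twistDeriv_apply, twistDeriv_apply]
    refine Prod.ext (funext fun i => ?_) rfl
    simp only [untwist, Pi.mul_apply]
    ring
  rw [sympl_antisymm (untwist q ξ), sympl_fderiv_logHam_apply hF, sympl_fderiv_logHam_apply hF,
    twist_untwist hq, twist_untwist hq, hsymm.eq, hcomm, add_neg_cancel]

theorem fderiv_hamField {F : Ambient n → ℝ} (hF : ContDiff ℝ ∞ F) (q ξ : Ambient n) :
    fderiv ℝ (hamField F) q ξ =
      twist q (fderiv ℝ (logHam F) q ξ) + twistDeriv (logHam F q) ξ :=
  congrArg (fun L => L ξ) (hasFDerivAt_twist_clm_apply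
    ((contDiff_logHam hF).differentiable (by simp) q).hasFDerivAt).fderiv

theorem hasDerivWithinAt_untwist {γ J : ℝ → Ambient n} {h k : Ambient n} {s : ℝ} {S : Set ℝ}
    (hq : γ s ∈ space n) (hγ : HasDerivWithinAt γ (twist (γ s) h) S s)
    (hJ : HasDerivWithinAt J (twist (γ s) k + twistDeriv h (J s)) S s) :
    HasDerivWithinAt (fun s => untwist (γ s) (J s)) k S s := by
  let coord : Fin n → Ambient n →L[ℝ] ℂ := fun i =>
    ContinuousLinearMap.proj i ∘L ContinuousLinearMap.fst ℝ (Fin n → ℂ) (ℂ × ℂ)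
  have hγ_coord : ∀ i, HasDerivWithinAt (fun s => (γ s).1 i) ((γ s).1 i * h.1 i) S s := fun i =>
    ((coord i).hasFDerivAt.comp_hasDerivWithinAt s hγ).congr_deriv (by simp [coord, twist_apply])
  have hJ_coord : ∀ i, HasDerivWithinAt (fun s => (J s).1 i)
      ((γ s).1 i * k.1 i + (J s).1 i * h.1 i) S s := fun i =>
    ((coord i).hasFDerivAt.comp_hasDerivWithinAt s hJ).congr_deriv
      (by simp [coord, twist_apply, twistDeriv_apply])
  have hfst : HasDerivWithinAt (fun s => (untwist (γ s) (J s)).1) k.1 S s := by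
    refine hasDerivWithinAt_pi.2 fun i => ((hJ_coord i).div (hγ_coord i) (hq i)).congr_deriv ?_
    have hne := hq i
    field_simp
    ring
  have hsnd : HasDerivWithinAt (fun s => (J s).2) k.2 S s :=
    ((ContinuousLinearMap.snd ℝ (Fin n → ℂ) (ℂ × ℂ)).hasFDerivAt.comp_hasDerivWithinAt
      s hJ).congr_deriv (by simp [twist_apply, twistDeriv_apply])
  exact hfst.prodMk hsnd

end Hamiltonian

section SmoothExtension

theorem contDiff_of_contDiffOn_of_eq_zero {E F : Type*} [NormedAddCommGroup E] [NormedSpace ℝ E]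
    [NormedAddCommGroup F] [NormedSpace ℝ F] {f : E → F} {Ω K : Set E} {m : WithTop ℕ∞}
    (hΩ : IsOpen Ω) (hK : IsClosed K) (hKΩ : K ⊆ Ω) (hf : ContDiffOn ℝ m f Ω)
    (h₀ : ∀ x ∉ K, f x = 0) : ContDiff ℝ m f := by
  rw [contDiff_iff_contDiffAt]
  intro x
  by_cases hx : x ∈ K
  · exact hf.contDiffAt (hΩ.mem_nhds (hKΩ hx))
  · exact contDiffAt_const.congr_of_eventuallyEq
      (Filter.eventuallyEq_of_mem (hK.isOpen_compl.mem_nhds hx) h₀)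

theorem exists_contDiff_eq_inv_of_le {c : ℝ} (hc : 0 < c) :
    ∃ κ : ℝ → ℝ, ContDiff ℝ ∞ κ ∧ ∀ x, c ≤ x → κ x = x⁻¹ := by
  refine ⟨fun x => Real.smoothTransition (2 * x / c - 1) * x⁻¹, ?_, fun x hx => ?_⟩
  · refine contDiff_of_contDiffOn_of_eq_zero (Ω := {0}ᶜ) (K := Ici (c / 2)) isOpen_compl_singleton
      isClosed_Ici (fun x hx => ((half_pos hc).trans_le hx).ne') ?_ fun x hx => ?_
    · have hcut : ContDiff ℝ ∞ fun x : ℝ => Real.smoothTransition (2 * x / c - 1) :=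
        Real.smoothTransition.contDiff.comp (by fun_prop)
      exact hcut.contDiffOn.mul (contDiffOn_inv ℝ)
    · have hlt : x < c / 2 := not_le.1 hx
      rw [Real.smoothTransition.zero_of_nonpos, zero_mul]
      rw [sub_nonpos, div_le_one hc]
      linarith
  · dsimp only
    rw [Real.smoothTransition.one_of_one_le, one_mul]
    rw [le_sub_iff_add_le, le_div_iff₀ hc]
    linarith

end SmoothExtension

/-! ### Symplectic parallel transport in a linear family of hypersurfaces -/

section HamiltonianFlow

variable {n : ℕ} {K : Set (Ambient n)} {φ : ℝ → Ambient n → Ambient n}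

/-- `Φ` is a diffeomorphism with inverse `Ψ`, equal to the identity off `K`, that preserves
`ω₀` on `(ℂ^*)ⁿ × ℂ²`. -/
structure IsSupportedSymplecto (K : Set (Ambient n)) (Φ Ψ : Ambient n → Ambient n) : Prop where
  smooth : ContDiff ℝ ∞ Φ
  smooth_inv : ContDiff ℝ ∞ Ψ
  left_inv : Function.LeftInverse Ψ Φ
  right_inv : Function.RightInverse Ψ Φ
  eq_self : ∀ q, q ∉ K → Φ q = q
  omega_eq : ∀ q ∈ space n, ∀ ξ η, omega (Φ q) (fderiv ℝ Φ q ξ) (fderiv ℝ Φ q η) = omega q ξ η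

theorem IsSupportedSymplecto.mem_iff {Φ Ψ : Ambient n → Ambient n}
    (h : IsSupportedSymplecto K Φ Ψ) {S : Set (Ambient n)} (hS : K ⊆ S) (q : Ambient n) :
    Φ q ∈ S ↔ q ∈ S := by
  by_cases hq : q ∈ K
  · have hΦq : Φ q ∈ K := by
      by_contra hout
      have hfix : q = Φ q := h.left_inv.injective (h.eq_self _ hout).symm
      exact hout (hfix ▸ hq)
    exact iff_of_true (hS hΦq) (hS hq)
  · rw [h.eq_self q hq]

variable {H : ℝ → Ambient n → ℝ}

theorem IsSmoothFlow.hasDerivWithinAt_untwist (hφ : IsSmoothFlow (fun s => hamField (H s)) φ)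
    (hH : ContDiff ℝ ∞ (Function.uncurry H)) {q : Ambient n} {s : ℝ} (hs : s ∈ Icc (0 : ℝ) 1)
    (hq : φ s q ∈ space n) (ξ : Ambient n) :
    HasDerivWithinAt (fun s => untwist (φ s q) (fderiv ℝ (φ s) q ξ))
      (fderiv ℝ (logHam (H s)) (φ s q) (fderiv ℝ (φ s) q ξ)) (Icc 0 1) s :=
  HoriVafa.hasDerivWithinAt_untwist hq (hφ.isIntegralCurveOn q s hs)
    ((hφ.variational q ξ s hs).congr_deriv
      (fderiv_hamField (hH.comp (contDiff_const.prodMk contDiff_id)) _ _))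

theorem IsSmoothFlow.omega_eq (hφ : IsSmoothFlow (fun s => hamField (H s)) φ)
    (hH : ContDiff ℝ ∞ (Function.uncurry H)) {q : Ambient n}
    (hq : ∀ s ∈ Icc (0 : ℝ) 1, φ s q ∈ space n) (ξ η : Ambient n) {s : ℝ}
    (hs : s ∈ Icc (0 : ℝ) 1) :
    omega (φ s q) (fderiv ℝ (φ s) q ξ) (fderiv ℝ (φ s) q η) = omega q ξ η := by
  have hφ₀ : φ 0 = id := funext hφ.map_zero
  let pairing : ℝ → ℝ := fun s =>
    sympl (untwist (φ s q) (fderiv ℝ (φ s) q ξ)) (untwist (φ s q) (fderiv ℝ (φ s) q η))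
  have hderiv : ∀ s ∈ Icc (0 : ℝ) 1,
      HasDerivWithinAt (fun s => pairing s - pairing 0) 0 (Icc 0 1) s := fun s hs =>
    ((hasDerivWithinAt_sympl (hφ.hasDerivWithinAt_untwist hH hs (hq s hs) ξ)
      (hφ.hasDerivWithinAt_untwist hH hs (hq s hs) η)).sub_const _).congr_deriv
      (sympl_fderiv_logHam (hH.comp (contDiff_const.prodMk contDiff_id)) (hq s hs) _ _)
  have hconst : pairing s = pairing 0 := sub_eq_zero.1 <|
    eq_zero_of_norm_deriv_le_mul_norm (g := fun s => pairing s - pairing 0) (C := 0) hderiv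
      (fun _ _ => by simp) (left_mem_Icc.2 zero_le_one) (sub_self _) hs
  rw [HoriVafa.omega_eq, HoriVafa.omega_eq]
  change 2 * Complex.I * (pairing s : ℂ) = _
  rw [hconst]
  simp [pairing, hφ₀]

theorem exists_hamiltonian_flow (hK : IsCompact K) (hKspace : K ⊆ space n)
    (hH : ContDiff ℝ ∞ (Function.uncurry H)) (h₀ : ∀ s, ∀ q ∉ K, hamField (H s) q = 0) :
    ∃ φ Ψ, IsSmoothFlow (fun s => hamField (H s)) φ ∧ IsSupportedSymplecto K (φ 1) Ψ ∧
      ∀ q ∈ space n, ∀ s ∈ Icc (0 : ℝ) 1, φ s q ∈ space n := by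
  have hv := contDiff_hamField_uncurry hH
  obtain ⟨L, hL⟩ := exists_lipschitzWith_of_eq_zero_off_isCompact hv hK h₀
  obtain ⟨φ, hφ⟩ := exists_isSmoothFlow hv hL
  obtain ⟨Ψ, hΨ, hleft, hright⟩ := hφ.exists_inverse hv hL
  have hspace : ∀ q ∈ space n, ∀ s ∈ Icc (0 : ℝ) 1, φ s q ∈ space n := fun q hq s hs =>
    hφ.mem_of_eq_zero_off hL (fun s q hq => h₀ s q fun hqK => hq (hKspace hqK)) hq hs
  have hone : (1 : ℝ) ∈ Icc (0 : ℝ) 1 := right_mem_Icc.2 zero_le_one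
  have hfix : ∀ q ∉ K, φ 1 q = q := fun q hq => by
    have hq₀ : ∀ s, hamField (H s) (φ 0 q) = 0 := fun s => by
      rw [hφ.map_zero]
      exact h₀ s q hq
    rw [hφ.eq_of_eq_zero hL (left_mem_Icc.2 zero_le_one) hq₀ hone, hφ.map_zero]
  exact ⟨φ, Ψ, hφ, ⟨hφ.contDiff 1, hΨ, hleft, hright, hfix,
    fun q hq ξ η => hφ.omega_eq hH (hspace q hq) ξ η hone⟩, hspace⟩

end HamiltonianFlow

section Transport

variable {n : ℕ}

/-- The linear family of functions `G_s = G + s N`. -/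
def family (G N : Ambient n → ℂ) (s : ℝ) (q : Ambient n) : ℂ := G q + s * N q

/-- The coefficient of `Re G_s` in `transportHam`. -/
def transportRe (κ : ℝ → ℝ) (G N : Ambient n → ℂ) (s : ℝ) (q : Ambient n) : ℝ :=
  -(κ (poisson (logForm (family G N s) q)) * (N q).im)

/-- The coefficient of `Im G_s` in `transportHam`. -/
def transportIm (κ : ℝ → ℝ) (G N : Ambient n → ℂ) (s : ℝ) (q : Ambient n) : ℝ :=
  κ (poisson (logForm (family G N s) q)) * (N q).re

/-- The Hamiltonian of the parallel transport. Where `κ P = P⁻¹` for the Poisson bracket `P` of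
`Im G_s` and `Re G_s`, its vector field moves `{G_s = 0}` along with `s`. -/
def transportHam (κ : ℝ → ℝ) (G N : Ambient n → ℂ) (s : ℝ) (q : Ambient n) : ℝ :=
  transportRe κ G N s q * (family G N s q).re + transportIm κ G N s q * (family G N s q).im

/-- The data of a parallel transport: the function `G` is smooth on `(ℂ^*)ⁿ × ℂ²`, and the
perturbation `N` is smooth and supported in the compact subset `K` of `(ℂ^*)ⁿ × ℂ²`. -/
structure IsTransportData (G N : Ambient n → ℂ) (K : Set (Ambient n)) : Prop where
  smooth : ContDiffOn ℝ ∞ G (space n)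
  smooth_pert : ContDiff ℝ ∞ N
  isCompact : IsCompact K
  subset : K ⊆ space n
  eq_zero : ∀ q, q ∉ K → N q = 0

variable {G N : Ambient n → ℂ} {K : Set (Ambient n)}

theorem isOpen_univ_prod_space : IsOpen ((univ : Set ℝ) ×ˢ space n) :=
  isOpen_univ.prod isOpen_space

theorem contDiffOn_family (hG : ContDiffOn ℝ ∞ G (space n)) (hN : ContDiff ℝ ∞ N) :
    ContDiffOn ℝ ∞ (Function.uncurry (family G N)) (univ ×ˢ space n) :=
  (hG.comp contDiffOn_snd fun _ hx => hx.2).add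
    ((Complex.ofRealCLM.contDiff.comp contDiff_fst).mul (hN.comp contDiff_snd)).contDiffOn

theorem hasFDerivAt_family (hG : ContDiffOn ℝ ∞ G (space n)) (hN : ContDiff ℝ ∞ N) (s : ℝ)
    {q : Ambient n} (hq : q ∈ space n) :
    HasFDerivAt (family G N s) (fderiv ℝ G q + s • fderiv ℝ N q) q := by
  have hG' : HasFDerivAt G (fderiv ℝ G q) q :=
    ((hG.contDiffAt (isOpen_space.mem_nhds hq)).differentiableAt (by simp)).hasFDerivAt
  refine (hG'.add ((hN.differentiable (by simp) q).hasFDerivAt.const_smul s)).congr_of_eventuallyEq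
    (Filter.Eventually.of_forall fun q => ?_)
  simp [family]

theorem logForm_family (hG : ContDiffOn ℝ ∞ G (space n)) (hN : ContDiff ℝ ∞ N) (s : ℝ)
    {q : Ambient n} (hq : q ∈ space n) :
    logForm (family G N s) q = logForm G q + s • logForm N q := by
  rw [logForm, (hasFDerivAt_family hG hN s hq).fderiv, ContinuousLinearMap.add_comp,
    ContinuousLinearMap.smul_comp, logForm, logForm]

theorem contDiffOn_logForm_family (hG : ContDiffOn ℝ ∞ G (space n)) (hN : ContDiff ℝ ∞ N) :
    ContDiffOn ℝ ∞ (fun x : ℝ × Ambient n => logForm (family G N x.1) x.2)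
      (univ ×ˢ space n) := by
  have hsplit : ContDiffOn ℝ ∞ (fun x : ℝ × Ambient n => logForm G x.2 + x.1 • logForm N x.2)
      (univ ×ˢ space n) :=
    ((contDiffOn_logForm hG).comp contDiffOn_snd fun x hx => hx.2).add
      (contDiff_fst.smul ((contDiff_logForm hN).comp contDiff_snd)).contDiffOn
  exact hsplit.congr fun x hx => logForm_family hG hN x.1 hx.2

variable {κ : ℝ → ℝ}

theorem transportHam_of_eq_zero {s : ℝ} {q : Ambient n} (hq : N q = 0) :
    transportHam κ G N s q = 0 := by
  simp [transportHam, transportRe, transportIm, hq]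

theorem IsTransportData.contDiff_coeff (h : IsTransportData G N K) (hκ : ContDiff ℝ ∞ κ)
    (A : ℂ →L[ℝ] ℝ) : ContDiff ℝ ∞
    (fun x : ℝ × Ambient n => κ (poisson (logForm (family G N x.1) x.2)) * A (N x.2)) := by
  refine contDiff_of_contDiffOn_of_eq_zero isOpen_univ_prod_space
    (isClosed_univ.prod h.isCompact.isClosed) (prod_mono le_rfl h.subset) ?_ fun x hx => ?_
  · exact ((hκ.comp contDiff_poisson).comp_contDiffOn
      (contDiffOn_logForm_family h.smooth h.smooth_pert)).mul
      (A.contDiff.comp (h.smooth_pert.comp contDiff_snd)).contDiffOn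
  · rw [h.eq_zero x.2 fun h => hx ⟨mem_univ _, h⟩, map_zero, mul_zero]

theorem IsTransportData.contDiff_transportRe (h : IsTransportData G N K) (hκ : ContDiff ℝ ∞ κ) :
    ContDiff ℝ ∞ (Function.uncurry (transportRe κ G N)) :=
  (h.contDiff_coeff hκ Complex.imCLM).neg

theorem IsTransportData.contDiff_transportIm (h : IsTransportData G N K) (hκ : ContDiff ℝ ∞ κ) :
    ContDiff ℝ ∞ (Function.uncurry (transportIm κ G N)) :=
  h.contDiff_coeff hκ Complex.reCLM

theorem IsTransportData.contDiff_transportHam (h : IsTransportData G N K) (hκ : ContDiff ℝ ∞ κ) :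
    ContDiff ℝ ∞ (Function.uncurry (transportHam κ G N)) := by
  have hf := contDiffOn_family h.smooth h.smooth_pert
  refine contDiff_of_contDiffOn_of_eq_zero isOpen_univ_prod_space
    (isClosed_univ.prod h.isCompact.isClosed) (prod_mono le_rfl h.subset) ?_ fun x hx =>
      transportHam_of_eq_zero (h.eq_zero x.2 fun h => hx ⟨mem_univ _, h⟩)
  exact ((h.contDiff_transportRe hκ).contDiffOn.mul (Complex.reCLM.contDiff.comp_contDiffOn hf)).add
    ((h.contDiff_transportIm hκ).contDiffOn.mul (Complex.imCLM.contDiff.comp_contDiffOn hf))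

theorem IsTransportData.logHam_eq_zero (h : IsTransportData G N K) (s : ℝ) {q : Ambient n}
    (hq : q ∉ K) : logHam (transportHam κ G N s) q = 0 := by
  have hzero : transportHam κ G N s =ᶠ[nhds q] fun _ => 0 :=
    Filter.eventuallyEq_of_mem (h.isCompact.isClosed.isOpen_compl.mem_nhds hq)
      fun y hy => transportHam_of_eq_zero (h.eq_zero y hy)
  simp [logHam, logForm, hzero.fderiv_eq]

theorem IsTransportData.logForm_transportHam (h : IsTransportData G N K) (hκ : ContDiff ℝ ∞ κ)
    (s : ℝ) {q : Ambient n} (hq : q ∈ space n) :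
    logForm (transportHam κ G N s) q =
      transportRe κ G N s q • (Complex.reCLM ∘L logForm (family G N s) q) +
      (family G N s q).re • logForm (transportRe κ G N s) q +
      (transportIm κ G N s q • (Complex.imCLM ∘L logForm (family G N s) q) +
      (family G N s q).im • logForm (transportIm κ G N s) q) := by
  have hfamily : HasFDerivAt (family G N s) (fderiv ℝ (family G N s) q) q :=
    (hasFDerivAt_family h.smooth h.smooth_pert s hq).differentiableAt.hasFDerivAt
  have hslice : ∀ {F : ℝ → Ambient n → ℝ}, ContDiff ℝ ∞ (Function.uncurry F) →
      HasFDerivAt (F s) (fderiv ℝ (F s) q) q := fun hF =>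
    ((hF.comp (contDiff_const.prodMk contDiff_id)).differentiable (by simp) q).hasFDerivAt
  have hham := ((hslice (h.contDiff_transportRe hκ)).mul
    (Complex.reCLM.hasFDerivAt.comp q hfamily)).add
    ((hslice (h.contDiff_transportIm hκ)).mul (Complex.imCLM.hasFDerivAt.comp q hfamily))
  have hfderiv : fderiv ℝ (transportHam κ G N s) q = _ := hham.fderiv
  rw [logForm, hfderiv]
  rfl

theorem IsTransportData.add_logForm_logHam (h : IsTransportData G N K) (hκ : ContDiff ℝ ∞ κ)
    (s : ℝ) {q : Ambient n} (hq : q ∈ space n) :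
    N q + logForm (family G N s) q (logHam (transportHam κ G N s) q) =
      ((1 - κ (poisson (logForm (family G N s) q)) * poisson (logForm (family G N s) q) : ℝ) : ℂ) *
          N q +
        (family G N s q).re * logForm (family G N s) q (logHam (transportRe κ G N s) q) +
        (family G N s q).im * logForm (family G N s) q (logHam (transportIm κ G N s) q) := by
  rw [logHam, h.logForm_transportHam hκ s hq]
  simp only [map_add, map_smul, apply_sgrad_re, apply_sgrad_im, logHam, transportRe, transportIm,
    Complex.real_smul]
  push_cast
  conv_rhs => rw [← Complex.re_add_im (N q)]
  conv_lhs => enter [1]; rw [← Complex.re_add_im (N q)]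
  ring

theorem IsTransportData.continuousOn_logForm_family (h : IsTransportData G N K) :
    ContinuousOn (fun x : ℝ × Ambient n => logForm (family G N x.1) x.2) (Icc 0 1 ×ˢ K) :=
  (contDiffOn_logForm_family h.smooth h.smooth_pert).continuousOn.mono
    (prod_mono (subset_univ _) h.subset)

theorem IsTransportData.exists_norm_logForm_logHam_le (h : IsTransportData G N K)
    {F : ℝ → Ambient n → ℝ} (hF : ContDiff ℝ ∞ (Function.uncurry F)) :
    ∃ C : ℝ, 0 ≤ C ∧ ∀ s ∈ Icc (0 : ℝ) 1, ∀ q ∈ K,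
      ‖logForm (family G N s) q (logHam (F s) q)‖ ≤ C := by
  obtain ⟨C, hC⟩ := (isCompact_Icc.prod h.isCompact).exists_bound_of_continuousOn
    (h.continuousOn_logForm_family.clm_apply (contDiff_logHam_uncurry hF).continuous.continuousOn)
  exact ⟨max C 0, le_max_right _ _, fun s hs q hq => (hC (s, q) ⟨hs, hq⟩).trans (le_max_left _ _)⟩

theorem IsTransportData.exists_norm_defect_le (h : IsTransportData G N K) (hκ : ContDiff ℝ ∞ κ)
    {c η : ℝ} (hc : 0 < c) (hη : 0 < η) (hκc : ∀ x, c ≤ x → κ x = x⁻¹)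
    (hP : ∀ s ∈ Icc (0 : ℝ) 1, ∀ q ∈ K, ‖family G N s q‖ < η →
      c ≤ poisson (logForm (family G N s) q)) :
    ∃ C : ℝ, 0 ≤ C ∧ ∀ s ∈ Icc (0 : ℝ) 1, ∀ q ∈ K,
      ‖((1 - κ (poisson (logForm (family G N s) q)) * poisson (logForm (family G N s) q) : ℝ) : ℂ) *
        N q‖ ≤ C * ‖family G N s q‖ := by
  have hpoisson : ContinuousOn (fun x : ℝ × Ambient n => poisson (logForm (family G N x.1) x.2))
      (Icc 0 1 ×ˢ K) :=
    contDiff_poisson.continuous.comp_continuousOn h.continuousOn_logForm_family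
  obtain ⟨C, hC⟩ := (isCompact_Icc.prod h.isCompact).exists_bound_of_continuousOn
    ((Complex.continuous_ofReal.comp_continuousOn (continuousOn_const.sub
      ((hκ.continuous.comp_continuousOn hpoisson).mul hpoisson))).mul
      (h.smooth_pert.continuous.comp continuous_snd).continuousOn)
  refine ⟨max (C / η) 0, le_max_right _ _, fun s hs q hq => ?_⟩
  have hbound := hC (s, q) ⟨hs, hq⟩
  rcases lt_or_ge ‖family G N s q‖ η with hlt | hge
  · have hcP := hP s hs q hq hlt
    rw [hκc _ hcP, inv_mul_cancel₀ (hc.trans_le hcP).ne', sub_self, Complex.ofReal_zero, zero_mul,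
      norm_zero]
    positivity
  · have hC₀ : 0 ≤ C := (norm_nonneg _).trans hbound
    calc _ ≤ C := hbound
      _ = C / η * η := (div_mul_cancel₀ _ hη.ne').symm
      _ ≤ max (C / η) 0 * ‖family G N s q‖ := by gcongr; exact le_max_left _ _

theorem IsTransportData.exists_norm_add_logForm_logHam_le (h : IsTransportData G N K)
    (hκ : ContDiff ℝ ∞ κ) {c η : ℝ} (hc : 0 < c) (hη : 0 < η) (hκc : ∀ x, c ≤ x → κ x = x⁻¹)
    (hP : ∀ s ∈ Icc (0 : ℝ) 1, ∀ q ∈ K, ‖family G N s q‖ < η →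
      c ≤ poisson (logForm (family G N s) q)) :
    ∃ C : ℝ, ∀ s ∈ Icc (0 : ℝ) 1, ∀ q,
      ‖N q + logForm (family G N s) q (logHam (transportHam κ G N s) q)‖ ≤
        C * ‖family G N s q‖ := by
  obtain ⟨A, hA₀, hA⟩ := h.exists_norm_defect_le hκ hc hη hκc hP
  obtain ⟨B, hB₀, hB⟩ := h.exists_norm_logForm_logHam_le (h.contDiff_transportRe hκ)
  obtain ⟨C, hC₀, hC⟩ := h.exists_norm_logForm_logHam_le (h.contDiff_transportIm hκ)
  refine ⟨A + B + C, fun s hs q => ?_⟩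
  by_cases hq : q ∈ K
  · rw [h.add_logForm_logHam hκ s (h.subset hq)]
    have hmul : ∀ {x y : ℂ} {r M : ℝ}, |r| ≤ ‖x‖ → ‖y‖ ≤ M → ‖(r : ℂ) * y‖ ≤ M * ‖x‖ := by
      intro x y r M hr hy
      rw [norm_mul, Complex.norm_real, Real.norm_eq_abs, mul_comm]
      exact mul_le_mul hy hr (abs_nonneg _) ((norm_nonneg _).trans hy)
    refine norm_add₃_le.trans ?_
    rw [add_mul, add_mul]
    exact add_le_add_three (hA s hs q hq) (hmul (Complex.abs_re_le_norm _) (hB s hs q hq))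
      (hmul (Complex.abs_im_le_norm _) (hC s hs q hq))
  · rw [h.eq_zero q hq, h.logHam_eq_zero s hq, map_zero, add_zero, norm_zero]
    positivity

theorem hasDerivWithinAt_family (hG : ContDiffOn ℝ ∞ G (space n)) (hN : ContDiff ℝ ∞ N)
    {H : ℝ → Ambient n → ℝ} {γ : ℝ → Ambient n} {s : ℝ} {S : Set ℝ} (hs : γ s ∈ space n)
    (hγ : HasDerivWithinAt γ (hamField (H s) (γ s)) S s) :
    HasDerivWithinAt (fun s => family G N s (γ s))
      (N (γ s) + logForm (family G N s) (γ s) (logHam (H s) (γ s))) S s := by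
  have hG' : HasFDerivAt G (fderiv ℝ G (γ s)) (γ s) :=
    ((hG.contDiffAt (isOpen_space.mem_nhds hs)).differentiableAt (by simp)).hasFDerivAt
  have hN' : HasFDerivAt N (fderiv ℝ N (γ s)) (γ s) :=
    (hN.differentiable (by simp) _).hasFDerivAt
  refine ((hG'.comp_hasDerivWithinAt s hγ).add ((hasDerivAt_id s).ofReal_comp.hasDerivWithinAt.mul
    (hN'.comp_hasDerivWithinAt s hγ))).congr_deriv ?_
  rw [logForm_family hG hN _ hs]
  simp [logForm, hamField]
  ring

theorem IsTransportData.exists_isSupportedSymplecto (h : IsTransportData G N K) {c η : ℝ}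
    (hc : 0 < c) (hη : 0 < η)
    (hP : ∀ s ∈ Icc (0 : ℝ) 1, ∀ q ∈ K, ‖family G N s q‖ < η →
      c ≤ poisson (logForm (family G N s) q)) :
    ∃ Φ Ψ, IsSupportedSymplecto K Φ Ψ ∧
      ∀ q ∈ space n, family G N 0 q = 0 ↔ family G N 1 (Φ q) = 0 := by
  obtain ⟨κ, hκ, hκc⟩ := exists_contDiff_eq_inv_of_le hc
  obtain ⟨C, hC⟩ := h.exists_norm_add_logForm_logHam_le hκ hc hη hκc hP
  obtain ⟨φ, Ψ, hφ, hΦ, hspace⟩ := exists_hamiltonian_flow h.isCompact h.subset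
    (h.contDiff_transportHam hκ) fun s q hq => by rw [hamField, h.logHam_eq_zero s hq, map_zero]
  refine ⟨φ 1, Ψ, hΦ, fun q hq => ?_⟩
  have hderiv : ∀ s ∈ Icc (0 : ℝ) 1, HasDerivWithinAt (fun s => family G N s (φ s q))
      (N (φ s q) + logForm (family G N s) (φ s q) (logHam (transportHam κ G N s) (φ s q)))
      (Icc 0 1) s := fun s hs =>
    hasDerivWithinAt_family h.smooth h.smooth_pert (hspace q hq s hs)
      (hφ.isIntegralCurveOn q s hs)
  have hzero : (0 : ℝ) ∈ Icc (0 : ℝ) 1 := left_mem_Icc.2 zero_le_one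
  have hone : (1 : ℝ) ∈ Icc (0 : ℝ) 1 := right_mem_Icc.2 zero_le_one
  have hvanish : ∀ {r s : ℝ}, r ∈ Icc (0 : ℝ) 1 → s ∈ Icc (0 : ℝ) 1 →
      family G N r (φ r q) = 0 → family G N s (φ s q) = 0 := fun hr hs h₀ =>
    eq_zero_of_norm_deriv_le_mul_norm (g := fun s => family G N s (φ s q)) hderiv
      (fun s hs => hC s hs _) hr h₀ hs
  nth_rewrite 1 [← hφ.map_zero q]
  exact ⟨hvanish hzero hone, hvanish hone hzero⟩

end Transport

/-! ### Tangent spaces of submanifolds with boundary -/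

section Tangent

open Filter Topology

variable {E F : Type*} [NormedAddCommGroup E] [NormedSpace ℝ E]
  [NormedAddCommGroup F] [NormedSpace ℝ F]

theorem eventually_lt_zero_of_hasDerivAt {h : ℝ → ℝ} {h' : ℝ} (hh : HasDerivAt h h' 0)
    (hle : h 0 ≤ 0) (hneg : h 0 = 0 → h' < 0) : ∀ᶠ s in 𝓝[>] (0 : ℝ), h s < 0 := by
  rcases hle.lt_or_eq with hlt | heq
  · exact (hh.continuousAt.eventually_lt_const hlt).filter_mono nhdsWithin_le_nhds
  · have hslope := (hasDerivAt_iff_tendsto_slope.1 hh).mono_left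
      (nhdsWithin_mono _ fun _ hx => ne_of_gt hx : 𝓝[>] (0 : ℝ) ≤ 𝓝[≠] 0)
    filter_upwards [hslope.eventually_lt_const (hneg heq), self_mem_nhdsWithin] with s hs hpos
    rw [slope_def_field, heq, sub_zero, sub_zero] at hs
    by_contra! hge
    exact hs.not_ge (div_nonneg hge (le_of_lt hpos))

theorem mem_tangentConeAt_of_hasDerivAt {S : Set E} {a ξ : E} {c : ℝ → E} (h₀ : c 0 = a)
    (hc : HasDerivAt c ξ 0) (hS : ∀ᶠ s in 𝓝[>] (0 : ℝ), c s ∈ S) :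
    ξ ∈ tangentConeAt ℝ S a := by
  refine mem_tangentConeAt_of_seq (𝓝[>] (0 : ℝ)) (fun s => s⁻¹) (fun s => c s - a) ?_
    (by simpa using hS) ?_
  · have hlim := hc.continuousAt.tendsto.mono_left (nhdsWithin_le_nhds (s := Ioi (0 : ℝ)))
    rw [h₀] at hlim
    simpa using hlim.sub_const a
  · have hslope := (hasDerivAt_iff_tendsto_slope.1 hc).mono_left
      (nhdsWithin_mono _ fun _ hx => ne_of_gt hx : 𝓝[>] (0 : ℝ) ≤ 𝓝[≠] 0)
    simpa [slope_fun_def, h₀] using hslope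

variable {S W : Set E} {f : E → F} {g : E → ℝ} {f' : E →L[ℝ] F} {g' : E →L[ℝ] ℝ} {a : E}

theorem tangentConeAt_subset_ker (ha : a ∈ S) (hW : W ∈ 𝓝 a) (hS : ∀ x ∈ S ∩ W, f x = 0)
    (hf : HasFDerivAt f f' a) : tangentConeAt ℝ S a ⊆ f'.ker := by
  have hconst : HasFDerivWithinAt f (0 : E →L[ℝ] F) S a :=
    (hasFDerivWithinAt_const (0 : F) a S).congr_of_eventuallyEq
      (eventually_of_mem (inter_mem_nhdsWithin S hW) hS) (hS a ⟨ha, mem_of_mem_nhds hW⟩)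
  exact fun ξ hξ => hf.hasFDerivWithinAt.unique_on hconst hξ

theorem surjective_prod_of_exists_lt {f' : E →L[ℝ] F} {g' : E →L[ℝ] ℝ}
    (hf' : Function.Surjective f') (hb : ∃ ζ, f' ζ = 0 ∧ g' ζ < 0) :
    Function.Surjective (fun ξ => (f' ξ, g' ξ)) := by
  obtain ⟨ζ, hζ, hgζ⟩ := hb
  rintro ⟨w, r⟩
  obtain ⟨ξ, hξ⟩ := hf' w
  refine ⟨ξ + ((r - g' ξ) / g' ζ) • ζ, Prod.ext ?_ ?_⟩
  · simp [hξ, hζ]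
  · simp [div_mul_cancel₀ _ hgζ.ne]

variable [FiniteDimensional ℝ F] [CompleteSpace E]

theorem exists_hasDerivAt_of_mem_ker {ξ : E} (hf : HasStrictFDerivAt f f' a)
    (hf' : Function.Surjective f') (hξ : f' ξ = 0) :
    ∃ c : ℝ → E, c 0 = a ∧ HasDerivAt c ξ 0 ∧ ∀ᶠ s in 𝓝 (0 : ℝ), f (c s) = f a := by
  have hrange : f'.range = ⊤ := LinearMap.range_eq_top.2 hf'
  let k : f'.ker := ⟨ξ, hξ⟩
  have hk : HasDerivAt (fun s : ℝ => s • k) k 0 := by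
    simpa using (hasDerivAt_id (0 : ℝ)).smul_const k
  refine ⟨fun s => hf.implicitFunction f f' hrange (f a) (s • k), by simp, ?_, ?_⟩
  · have himplicit : HasFDerivAt (hf.implicitFunction f f' hrange (f a)) f'.ker.subtypeL
        ((0 : ℝ) • k) := by
      rw [zero_smul]
      exact (hf.to_implicitFunction hrange).hasFDerivAt
    exact himplicit.comp_hasDerivAt 0 hk
  · have hline : Tendsto (fun s : ℝ => (f a, s • k)) (𝓝 0) (𝓝 (f a, 0)) :=
      tendsto_const_nhds.prodMk_nhds (by simpa using hk.continuousAt.tendsto)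
    exact hline.eventually (hf.map_implicitFunction_eq hrange)

theorem mem_tangentConeAt_of_mem_ker {ξ : E} (ha : a ∈ S) (hW : W ∈ 𝓝 a)
    (hS : S ∩ W = {x | x ∈ W ∧ f x = 0 ∧ g x ≤ 0}) (hf : HasStrictFDerivAt f f' a)
    (hf' : Function.Surjective f') (hg : HasFDerivAt g g' a) (hξ : f' ξ = 0)
    (hgξ : g a = 0 → g' ξ < 0) : ξ ∈ tangentConeAt ℝ S a := by
  obtain ⟨-, hfa, hga⟩ : a ∈ {x | x ∈ W ∧ f x = 0 ∧ g x ≤ 0} := hS ▸ ⟨ha, mem_of_mem_nhds hW⟩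
  obtain ⟨c, rfl, hc, hfc⟩ := exists_hasDerivAt_of_mem_ker hf hf' hξ
  refine mem_tangentConeAt_of_hasDerivAt rfl hc ?_
  have hcW : ∀ᶠ s in 𝓝 (0 : ℝ), c s ∈ W := hc.continuousAt.eventually_mem hW
  filter_upwards [(hfc.and hcW).filter_mono nhdsWithin_le_nhds,
    eventually_lt_zero_of_hasDerivAt (hg.comp_hasDerivAt 0 hc) hga hgξ] with s hs hgs
  have hmem : c s ∈ S ∩ W := hS ▸ ⟨hs.2, hs.1.trans hfa, le_of_lt hgs⟩
  exact hmem.1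

theorem span_tangentConeAt_eq_ker (ha : a ∈ S) (hW : W ∈ 𝓝 a)
    (hS : S ∩ W = {x | x ∈ W ∧ f x = 0 ∧ g x ≤ 0}) (hf : HasStrictFDerivAt f f' a)
    (hf' : Function.Surjective f') (hg : HasFDerivAt g g' a)
    (hb : g a = 0 → ∃ ξ, f' ξ = 0 ∧ g' ξ < 0) :
    Submodule.span ℝ (tangentConeAt ℝ S a) = f'.ker := by
  refine le_antisymm (Submodule.span_le.2 <| tangentConeAt_subset_ker ha hW
    (fun x hx => (hS.subset hx).2.1) hf.hasFDerivAt) fun ξ hξ => ?_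
  have hξ : f' ξ = 0 := hξ
  by_cases hga : g a = 0
  · obtain ⟨ζ, hζ, hgζ⟩ := hb hga
    -- Both `ζ` and `ξ + c • ζ`, for a large `c`, point into the half space `g' < 0`.
    set c : ℝ := (|g' ξ| + 1) / -(g' ζ) with hc
    have hshift : g' (ξ + c • ζ) < 0 := by
      have hcζ : c * g' ζ = -(|g' ξ| + 1) := by
        rw [hc, div_mul_eq_mul_div, div_eq_iff (neg_ne_zero.2 hgζ.ne)]
        ring
      rw [map_add, map_smul, smul_eq_mul, hcζ]
      linarith [le_abs_self (g' ξ)]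
    have hmem_shift : ξ + c • ζ ∈ tangentConeAt ℝ S a :=
      mem_tangentConeAt_of_mem_ker ha hW hS hf hf' hg (by simp [hξ, hζ]) fun _ => hshift
    have hmem : ζ ∈ tangentConeAt ℝ S a :=
      mem_tangentConeAt_of_mem_ker ha hW hS hf hf' hg hζ fun _ => hgζ
    simpa using Submodule.sub_mem _ (Submodule.subset_span hmem_shift)
      (Submodule.smul_mem _ c (Submodule.subset_span hmem))
  · exact Submodule.subset_span
      (mem_tangentConeAt_of_mem_ker ha hW hS hf hf' hg hξ fun h => absurd h hga)

end Tangent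

section SymplecticEquation

variable {n : ℕ} {S : Set (Ambient n)} {q : Ambient n} {f : Ambient n → ℂ}

/-- Near its point `q`, the set `S` is a manifold with boundary `{f = 0, g ≤ 0}`, and the
hypersurface `{f = 0}` is symplectic at `q` because the real and imaginary part of `f` do not
Poisson commute there. -/
def HasSymplecticEquation (S : Set (Ambient n)) (q : Ambient n) (f : Ambient n → ℂ) : Prop :=
  ∃ (W : Set (Ambient n)) (g : Ambient n → ℝ), IsOpen W ∧ q ∈ W ∧ ContDiffOn ℝ ∞ f W ∧
    ContDiffOn ℝ ∞ g W ∧ S ∩ W = {x | x ∈ W ∧ f x = 0 ∧ g x ≤ 0} ∧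
    poisson (logForm f q) ≠ 0 ∧ (g q = 0 → ∃ ξ, fderiv ℝ f q ξ = 0 ∧ fderiv ℝ g q ξ < 0)

theorem HasSymplecticEquation.surjective_fderiv (h : HasSymplecticEquation S q f) :
    Function.Surjective (fderiv ℝ f q) := by
  obtain ⟨W, g, -, -, -, -, -, hp, -⟩ := h
  exact Function.Surjective.of_comp (g := twist q) (surjective_of_poisson_ne_zero hp)

theorem HasSymplecticEquation.tangentAt_eq (hq : q ∈ S) (h : HasSymplecticEquation S q f) :
    tangentAt S q = (fderiv ℝ f q).ker := by
  have hsurj := h.surjective_fderiv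
  obtain ⟨W, g, hW, hqW, hf, hg, hS, -, hb⟩ := h
  have hWq := hW.mem_nhds hqW
  exact span_tangentConeAt_eq_ker hq hWq hS
    ((hf.contDiffAt hWq).hasStrictFDerivAt (by simp)) hsurj
    ((hg.contDiffAt hWq).differentiableAt (by simp)).hasFDerivAt hb

theorem isSymplecticSubmanifold_of_hasSymplecticEquation
    (hS : ∀ q ∈ S, q ∈ space n ∧ ∃ f, HasSymplecticEquation S q f) :
    IsSymplecticSubmanifold S := by
  intro q hq
  obtain ⟨hqn, f, h⟩ := hS q hq
  have hsurj := h.surjective_fderiv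
  have htangent := h.tangentAt_eq hq
  obtain ⟨W, g, hW, hqW, hf, hg, hSW, hp, hb⟩ := h
  refine ⟨hqn, ⟨W, f, g, hW, hqW, hf, hg, hSW, hsurj,
    fun hgq => surjective_prod_of_exists_lt hsurj (hb hgq)⟩, fun ξ hξ hω => ?_⟩
  rw [htangent] at hξ hω
  have hξ_zero : untwist q ξ = 0 := by
    refine eq_zero_of_poisson_ne_zero hp ?_ fun y hy => ?_
    · rw [logForm, ContinuousLinearMap.comp_apply, twist_untwist hqn]
      exact hξ
    · have hpair := hω (twist q y) hy
      rw [omega_eq, untwist_twist hqn] at hpair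
      simpa using hpair
  rw [← twist_untwist hqn ξ, hξ_zero, map_zero]

theorem IsSupportedSymplecto.isSymplectomorphism {K T : Set (Ambient n)}
    {Φ Ψ : Ambient n → Ambient n} (h : IsSupportedSymplecto K Φ Ψ)
    (hS : IsSymplecticSubmanifold S) (hT : IsSymplecticSubmanifold T)
    (hΦ : ∀ q, q ∈ S ↔ Φ q ∈ T) : IsSymplectomorphism S T Φ where
  source := hS
  target := hT
  bijOn := ⟨fun q hq => (hΦ q).1 hq, h.left_inv.injective.injOn, fun q hq =>
    ⟨Ψ q, (hΦ _).2 (by rwa [h.right_inv q]), h.right_inv q⟩⟩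
  smooth := h.smooth.contDiffOn
  smooth_inv := ⟨Ψ, ⟨fun q _ => h.left_inv q, fun q _ => h.right_inv q⟩, h.smooth_inv.contDiffOn⟩
  pullback := by
    intro q hq L hL ξ hξ η hη
    have hΦq : HasFDerivWithinAt Φ (fderiv ℝ Φ q) S q :=
      (h.smooth.differentiable (by simp) q).hasFDerivAt.hasFDerivWithinAt
    have heq : EqOn L (fderiv ℝ Φ q) (tangentAt S q) :=
      LinearMap.eqOn_span (f := (L : Ambient n →ₗ[ℝ] Ambient n))
        (g := (fderiv ℝ Φ q : Ambient n →ₗ[ℝ] Ambient n)) (hL.unique_on hΦq)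
    rw [heq hξ, heq hη]
    exact h.omega_eq q (hS q hq).1 ξ η

end SymplecticEquation

/-! ### Toric preliminaries -/

section Toric

open scoped Topology

variable {n p : ℕ}

/-- The ray generator `v_j` as a vector of `ℝⁿ`. -/
def realRay (fan : SmoothCompleteFan n p) (j : Fin p) : Fin n → ℝ := fun i => (fan.ray j i : ℝ)

theorem SmoothCompleteFan.exists_sum_ray_mul_eq (fan : SmoothCompleteFan n p)
    {σ : Finset (Fin p)} (hσ : σ ∈ fan.maxCones) (a : Fin p → ℤ) :
    ∃ y : Fin n → ℤ, ∀ i ∈ σ, ∑ l, fan.ray i l * y l = a i := by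
  have hspan : ⊤ ≤ Submodule.span ℤ (range fun i : σ => fan.ray i) := by
    have hrange : range (fun i : σ => fan.ray i) = fan.ray '' (σ : Set (Fin p)) := by
      ext x; simp
    rw [hrange, fan.spans σ hσ]
  let b := Module.Basis.mk (fan.linInd σ hσ) hspan
  let f : (Fin n → ℤ) →ₗ[ℤ] ℤ := b.constr ℤ fun i => a i
  refine ⟨fun l => f (Pi.single l 1), fun i hi => ?_⟩
  have hf : f (fan.ray i) = a i := by
    have hb : b ⟨i, hi⟩ = fan.ray i := by simp [b]
    rw [← hb]
    exact b.constr_basis ℤ (fun i : σ => a i) ⟨i, hi⟩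
  calc ∑ l, fan.ray i l * f (Pi.single l 1) = f (∑ l, fan.ray i l • Pi.single l 1) := by
        simp only [map_sum, map_smul, smul_eq_mul]
    _ = a i := by rw [← pi_eq_sum_univ', hf]

theorem SmoothCompleteFan.exists_sum_ray_mul_eq_one (fan : SmoothCompleteFan n p) (j : Fin p) :
    ∃ l : Fin n → ℤ, ∑ i, fan.ray j i * l i = 1 := by
  obtain ⟨σ, hσ, hj⟩ := fan.ray_mem j
  obtain ⟨y, hy⟩ := fan.exists_sum_ray_mul_eq hσ fun _ => 1
  exact ⟨y, hy j hj⟩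

theorem pairing_add (v : Fin n → ℤ) (x y : Fin n → ℝ) :
    pairing v (x + y) = pairing v x + pairing v y := by
  simp [pairing, mul_add, Finset.sum_add_distrib]

theorem pairing_smul (v : Fin n → ℤ) (c : ℝ) (x : Fin n → ℝ) :
    pairing v (c • x) = c * pairing v x := by
  simp only [pairing, Finset.mul_sum, Pi.smul_apply, smul_eq_mul]
  exact Finset.sum_congr rfl fun i _ => by ring

theorem continuous_pairing (v : Fin n → ℤ) : Continuous (pairing v) := by
  unfold pairing; fun_prop

theorem pairing_intCast (v y : Fin n → ℤ) :
    pairing v (fun i => (y i : ℝ)) = ((∑ i, v i * y i : ℤ) : ℝ) := by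
  simp [pairing]

theorem chi_add_smul (fan : SmoothCompleteFan n p) (lam : Fin p → ℝ) (k : Fin p)
    (x y : Fin n → ℝ) (c : ℝ) :
    chi fan lam k (x + c • y) = chi fan lam k x + c * pairing (fan.ray k) y := by
  rw [chi, pairing_add, pairing_smul, chi, add_assoc]

/- Move from the vertex `m` dual to a maximal cone containing `j`, where `χ_i` vanishes for the rays
`i` of the cone and is positive for the others, a little in the direction that increases `χ_i` for
all rays `i ≠ j` of the cone and leaves `χ_j` alone. -/
theorem SmoothCompleteFan.exists_facet_point (fan : SmoothCompleteFan n p) {lam : Fin p → ℝ}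
    (hlam : fan.IsAmple lam) (j : Fin p) :
    ∃ x, chi fan lam j x = 0 ∧ ∀ k, k ≠ j → 0 < chi fan lam k x := by
  classical
  obtain ⟨σ, hσ, hj⟩ := fan.ray_mem j
  obtain ⟨m, hm, hm'⟩ := hlam σ hσ
  obtain ⟨y, hy⟩ := fan.exists_sum_ray_mul_eq hσ fun i => if i = j then 0 else 1
  let d : Fin n → ℝ := fun i => y i
  have hd : ∀ i ∈ σ, pairing (fan.ray i) d = if i = j then 0 else 1 := fun i hi => by
    rw [pairing_intCast, hy i hi]; split_ifs <;> simp
  have hvertex : ∀ i ∈ σ, chi fan lam i m = 0 := fun i hi => by rw [chi, hm i hi, add_neg_cancel]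
  have hpos : ∀ᶠ ε in 𝓝[>] (0 : ℝ), ∀ k, k ≠ j → 0 < chi fan lam k (m + ε • d) := by
    rw [Filter.eventually_all]
    intro k
    by_cases hk : k ∈ σ
    · filter_upwards [self_mem_nhdsWithin] with ε hε hkj
      rw [chi_add_smul, hvertex k hk, hd k hk, if_neg hkj, zero_add, mul_one]
      exact hε
    · have hcont : Continuous fun ε : ℝ => chi fan lam k (m + ε • d) := by
        simp only [chi_add_smul]; fun_prop
      have hm_pos : 0 < chi fan lam k (m + (0 : ℝ) • d) := by
        rw [zero_smul, add_zero, chi]; linarith [hm' k hk]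
      filter_upwards [(hcont.tendsto 0).eventually_const_lt hm_pos |>.filter_mono
        nhdsWithin_le_nhds] with ε hε _ using hε
  obtain ⟨ε, hε⟩ := hpos.exists
  refine ⟨m + ε • d, ?_, hε⟩
  rw [chi_add_smul, hvertex j hj, hd j hj, if_pos rfl, mul_zero, add_zero]

/-- The squared Euclidean length `|v_j|²` of a ray generator. -/
def raySq (fan : SmoothCompleteFan n p) (j : Fin p) : ℝ := ∑ i, (fan.ray j i : ℝ) ^ 2

theorem one_le_raySq (fan : SmoothCompleteFan n p) (j : Fin p) : 1 ≤ raySq fan j := by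
  obtain ⟨l, hl⟩ := fan.exists_sum_ray_mul_eq_one j
  obtain ⟨i, hi⟩ : ∃ i, fan.ray j i ≠ 0 := by
    by_contra! h
    simp [h] at hl
  have hone : (1 : ℝ) ≤ (fan.ray j i : ℝ) ^ 2 := by
    have : (1 : ℤ) ≤ fan.ray j i ^ 2 := Int.add_one_le_of_lt (sq_pos_of_ne_zero hi)
    exact_mod_cast this
  exact hone.trans (Finset.single_le_sum (f := fun i => (fan.ray j i : ℝ) ^ 2)
    (fun i _ => sq_nonneg _) (Finset.mem_univ i))

theorem raySq_pos (fan : SmoothCompleteFan n p) (j : Fin p) : 0 < raySq fan j :=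
  zero_lt_one.trans_le (one_le_raySq fan j)

theorem pairing_realRay (fan : SmoothCompleteFan n p) (j : Fin p) :
    pairing (fan.ray j) (realRay fan j) = raySq fan j := by
  simp [pairing, realRay, raySq, sq]

/-- The gauge of the cylinders around `x₀` with axis `v_j`: it controls `⟨v_j, x - x₀⟩` and the
component of `x - x₀` orthogonal to `v_j` separately. -/
def cylGauge (fan : SmoothCompleteFan n p) (j : Fin p) (x₀ x : Fin n → ℝ) : ℝ :=
  max |pairing (fan.ray j) (x - x₀)|
    ‖(x - x₀) - (pairing (fan.ray j) (x - x₀) / raySq fan j) • realRay fan j‖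

/-- The open cylinder of radius `r` around `x₀`, with axis `v_j`. -/
def cyl (fan : SmoothCompleteFan n p) (j : Fin p) (x₀ : Fin n → ℝ) (r : ℝ) : Set (Fin n → ℝ) :=
  {x | cylGauge fan j x₀ x < r}

variable (fan : SmoothCompleteFan n p) (j : Fin p) (x₀ : Fin n → ℝ)

theorem continuous_cylGauge : Continuous (cylGauge fan j x₀) := by
  have := continuous_pairing (fan.ray j)
  unfold cylGauge
  fun_prop

theorem isOpen_cyl (r : ℝ) : IsOpen (cyl fan j x₀ r) :=
  isOpen_lt (continuous_cylGauge fan j x₀) continuous_const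

theorem center_mem_cyl {r : ℝ} (hr : 0 < r) : x₀ ∈ cyl fan j x₀ r := by
  simpa [cyl, cylGauge, pairing] using hr

theorem norm_sub_le_of_cylGauge {x : Fin n → ℝ} {r : ℝ} (h : cylGauge fan j x₀ x ≤ r) :
    ‖x - x₀‖ ≤ (1 + ‖realRay fan j‖) * r := by
  obtain ⟨haxis, horth⟩ := max_le_iff.1 h
  set c := pairing (fan.ray j) (x - x₀)
  have hproj : ‖(c / raySq fan j) • realRay fan j‖ ≤ r * ‖realRay fan j‖ := by
    rw [norm_smul, Real.norm_eq_abs, abs_div, abs_of_pos (raySq_pos fan j)]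
    gcongr
    exact (div_le_self (abs_nonneg c) (one_le_raySq fan j)).trans haxis
  calc ‖x - x₀‖ = ‖((x - x₀) - (c / raySq fan j) • realRay fan j) +
        (c / raySq fan j) • realRay fan j‖ := by rw [sub_add_cancel]
    _ ≤ r + r * ‖realRay fan j‖ := norm_add_le_of_le horth hproj
    _ = (1 + ‖realRay fan j‖) * r := by ring

theorem closure_cyl_subset (r : ℝ) : closure (cyl fan j x₀ r) ⊆ {x | cylGauge fan j x₀ x ≤ r} :=
  closure_minimal (fun x hx => (show cylGauge fan j x₀ x < r from hx).le)
    (isClosed_le (continuous_cylGauge fan j x₀) continuous_const)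

theorem isCompact_closedCyl (r : ℝ) : IsCompact {x | cylGauge fan j x₀ x ≤ r} := by
  refine (isCompact_closedBall x₀ ((1 + ‖realRay fan j‖) * r)).of_isClosed_subset
    (isClosed_le (continuous_cylGauge fan j x₀) continuous_const) fun x hx => ?_
  rw [mem_closedBall_iff_norm]
  exact norm_sub_le_of_cylGauge fan j x₀ hx

theorem relCompactIn_cyl {r r' : ℝ} (h : r < r') :
    RelCompactIn (cyl fan j x₀ r) (cyl fan j x₀ r') :=
  ⟨(isCompact_closedCyl fan j x₀ r).of_isClosed_subset isClosed_closure
    (closure_cyl_subset fan j x₀ r), fun _ hx => (closure_cyl_subset fan j x₀ r hx).trans_lt h⟩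

theorem exists_cyl_subset {S : Set (Fin n → ℝ)} (hS : S ∈ 𝓝 x₀) :
    ∃ r, 0 < r ∧ cyl fan j x₀ r ⊆ S := by
  obtain ⟨ε, hε, h⟩ := Metric.mem_nhds_iff.1 hS
  refine ⟨ε / (2 * (1 + ‖realRay fan j‖)), by positivity, fun x hx => h ?_⟩
  rw [mem_ball_iff_norm]
  refine (norm_sub_le_of_cylGauge fan j x₀ (le_of_lt hx)).trans_lt ?_
  field_simp
  linarith

theorem add_smul_mem_cyl {x : Fin n → ℝ} {r s : ℝ} (hx : x ∈ cyl fan j x₀ r)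
    (h₀ : pairing (fan.ray j) (x - x₀) = 0) (hs : |s| * raySq fan j < r) :
    x + s • realRay fan j ∈ cyl fan j x₀ r := by
  have horth := (max_lt_iff.1 (show max _ _ < r from hx)).2
  rw [h₀, zero_div, zero_smul, sub_zero] at horth
  have hpair : pairing (fan.ray j) (x + s • realRay fan j - x₀) = s * raySq fan j := by
    rw [add_sub_right_comm, pairing_add, pairing_smul, h₀, pairing_realRay, zero_add]
  change max _ _ < r
  rw [hpair, mul_div_cancel_right₀ _ (raySq_pos fan j).ne', add_sub_right_comm,
    add_sub_cancel_right, abs_mul, abs_of_pos (raySq_pos fan j)]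
  exact max_lt hs horth

end Toric

/-! ### Cutoff functions -/

section Cutoff

variable {E : Type*} [NormedAddCommGroup E] [NormedSpace ℝ E]

/-- A smooth cutoff function: one with values in `[0,1]` whose derivative is bounded by `C`. -/
structure IsSmoothCutoff (C : ℝ) (f : E → ℝ) : Prop where
  smooth : ContDiff ℝ ∞ f
  mem_Icc : ∀ x, f x ∈ Icc (0 : ℝ) 1
  norm_fderiv_le : ∀ x, ‖fderiv ℝ f x‖ ≤ C

theorem IsSmoothCutoff.nonneg {C : ℝ} {f : E → ℝ} (hf : IsSmoothCutoff C f) : 0 ≤ C :=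
  (norm_nonneg _).trans (hf.norm_fderiv_le 0)

theorem IsSmoothCutoff.comp_smul {C : ℝ} {f : E → ℝ} (hf : IsSmoothCutoff C f) {c : ℝ}
    (hc : |c| ≤ 1) : IsSmoothCutoff C fun x => f (c • x) where
  smooth := hf.smooth.comp (contDiff_id.const_smul c)
  mem_Icc x := hf.mem_Icc _
  norm_fderiv_le x := by
    rw [fderiv_comp_smul, norm_smul, Real.norm_eq_abs]
    exact (mul_le_of_le_one_left (norm_nonneg _) hc).trans (hf.norm_fderiv_le _)

open scoped Topology in
theorem exists_isSmoothCutoff [FiniteDimensional ℝ E] {A O K : Set E} (hA : IsClosed A)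
    (hO : IsOpen O) (hAO : A ⊆ O) (hOK : O ⊆ K) (hK : IsCompact K) :
    ∃ C f, IsSmoothCutoff C f ∧ (∀ x ∈ A, f x = 1) ∧ ∀ x, x ∉ O → f x = 0 := by
  obtain ⟨f, hf_zero, hf_one, hfI⟩ := exists_contMDiffMap_zero_one_of_isClosed (n := ⊤)
    (modelWithCornersSelf ℝ E) hO.isClosed_compl hA
    (disjoint_compl_left_iff_subset.2 hAO)
  have hfs : ContDiff ℝ ∞ f := f.contMDiff.contDiff
  obtain ⟨C, hC⟩ := hK.exists_bound_of_continuousOn (hfs.continuous_fderiv (by simp)).continuousOn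
  refine ⟨max C 0, f, ⟨hfs, hfI, fun x => ?_⟩, fun x hx => hf_one hx, fun x hx => hf_zero hx⟩
  by_cases hx : x ∈ K
  · exact (hC x hx).trans (le_max_left _ _)
  · have hzero : f =ᶠ[𝓝 x] fun _ => 0 := by
      filter_upwards [hK.isClosed.isOpen_compl.mem_nhds hx] with y hy
      exact hf_zero fun h => hy (hOK h)
    simp [hzero.fderiv_eq]

end Cutoff

/-! ### Positivity of the Poisson bracket -/

section Poisson

variable {n : ℕ}

/-- The `ℂ`-linear form on `ℂⁿ × ℂ²` with coefficients `l`. -/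
def complexForm (l : Ambient n) : Ambient n →L[ℝ] ℂ :=
  (∑ i, l.1 i • (ContinuousLinearMap.proj (R := ℝ) (φ := fun _ : Fin n => ℂ) i ∘L
    ContinuousLinearMap.fst ℝ (Fin n → ℂ) (ℂ × ℂ))) +
  l.2.1 • (ContinuousLinearMap.fst ℝ ℂ ℂ ∘L ContinuousLinearMap.snd ℝ (Fin n → ℂ) (ℂ × ℂ)) +
  l.2.2 • (ContinuousLinearMap.snd ℝ ℂ ℂ ∘L ContinuousLinearMap.snd ℝ (Fin n → ℂ) (ℂ × ℂ))

theorem complexForm_apply (l ξ : Ambient n) :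
    complexForm l ξ = (∑ i, l.1 i * ξ.1 i) + l.2.1 * ξ.2.1 + l.2.2 * ξ.2.2 := by
  simp [complexForm]

/-- The squared Hermitian norm of a coefficient vector. -/
def coeffSq (l : Ambient n) : ℝ := (∑ i, ‖l.1 i‖ ^ 2) + ‖l.2.1‖ ^ 2 + ‖l.2.2‖ ^ 2

theorem poisson_complexForm (l : Ambient n) : poisson (complexForm l) = coeffSq l := by
  have hre : sgrad (Complex.reCLM ∘L complexForm l) = Complex.I • star l := by
    symm
    refine eq_sgrad_of_forall_sympl_eq fun η => ?_
    simp only [sympl_apply, ContinuousLinearMap.comp_apply, complexForm_apply,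
      Complex.reCLM_apply, Complex.add_re, Complex.re_sum]
    have h : ∀ a b : ℂ, (Complex.I • star a * star b).im = (a * b).re := fun a b => by
      simp; ring
    simp only [Prod.smul_fst, Prod.smul_snd, Prod.fst_star, Prod.snd_star, Pi.smul_apply,
      Pi.star_apply, h]
  have him : sgrad (Complex.imCLM ∘L complexForm l) = -star l := by
    symm
    refine eq_sgrad_of_forall_sympl_eq fun η => ?_
    simp only [sympl_apply, ContinuousLinearMap.comp_apply, complexForm_apply,
      Complex.imCLM_apply, Complex.add_im, Complex.im_sum]
    have h : ∀ a b : ℂ, (-star a * star b).im = (a * b).im := fun a b => by simp; ring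
    simp only [Prod.fst_neg, Prod.snd_neg, Prod.fst_star, Prod.snd_star, Pi.neg_apply,
      Pi.star_apply, h]
  have h : ∀ a : ℂ, (-star a * star (Complex.I • star a)).im = ‖a‖ ^ 2 := fun a => by
    rw [← Complex.normSq_eq_norm_sq, Complex.normSq_apply]; simp
  rw [poisson, hre, him, sympl_apply, coeffSq]
  simp only [Prod.smul_fst, Prod.smul_snd, Prod.fst_star, Prod.snd_star, Pi.smul_apply,
    Pi.star_apply, Prod.fst_neg, Prod.snd_neg, Pi.neg_apply, h]

theorem norm_complexForm_le (l : Ambient n) : ‖complexForm l‖ ≤ (n + 2) * ‖l‖ := by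
  refine ContinuousLinearMap.opNorm_le_bound _ (by positivity) fun ξ => ?_
  have hprod : ∀ {a b : ℂ}, ‖a‖ ≤ ‖l‖ → ‖b‖ ≤ ‖ξ‖ → ‖a * b‖ ≤ ‖l‖ * ‖ξ‖ := fun ha hb => by
    rw [norm_mul]; gcongr
  have hz : ‖∑ i, l.1 i * ξ.1 i‖ ≤ n * (‖l‖ * ‖ξ‖) :=
    (norm_sum_le_of_le _ fun i _ => hprod ((norm_le_pi_norm l.1 i).trans (norm_fst_le l))
      ((norm_le_pi_norm ξ.1 i).trans (norm_fst_le ξ))).trans (by simp)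
  have hu := hprod ((norm_fst_le l.2).trans (norm_snd_le l))
    ((norm_fst_le ξ.2).trans (norm_snd_le ξ))
  have hv := hprod ((norm_snd_le l.2).trans (norm_snd_le l))
    ((norm_snd_le ξ.2).trans (norm_snd_le ξ))
  rw [complexForm_apply]
  linarith [norm_add₃_le (a := ∑ i, l.1 i * ξ.1 i) (b := l.2.1 * ξ.2.1) (c := l.2.2 * ξ.2.2)]

theorem norm_le_sqrt_coeffSq (l : Ambient n) : ‖l‖ ≤ Real.sqrt (coeffSq l) := by
  have hz : ∀ i, ‖l.1 i‖ ^ 2 ≤ ∑ i, ‖l.1 i‖ ^ 2 := fun i =>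
    Finset.single_le_sum (f := fun i => ‖l.1 i‖ ^ 2) (fun i _ => sq_nonneg _) (Finset.mem_univ i)
  have hsum : 0 ≤ ∑ i, ‖l.1 i‖ ^ 2 := Finset.sum_nonneg fun i _ => sq_nonneg _
  have hu := sq_nonneg ‖l.2.1‖
  have hv := sq_nonneg ‖l.2.2‖
  refine max_le ((pi_norm_le_iff_of_nonneg (Real.sqrt_nonneg _)).2 fun i => ?_) (max_le ?_ ?_) <;>
    refine Real.le_sqrt_of_sq_le ?_ <;> rw [coeffSq]
  · linarith [hz i]
  · linarith
  · linarith

theorem exists_abs_poisson_add_sub_le (n : ℕ) : ∃ C : ℝ, 0 ≤ C ∧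
    ∀ L M : Ambient n →L[ℝ] ℂ, |poisson (L + M) - poisson L| ≤ C * (‖L‖ + ‖M‖) * ‖M‖ := by
  let σ := LinearMap.toContinuousBilinearMap (sympl (n := n))
  let c (A : ℂ →L[ℝ] ℝ) : ℝ := ‖(sgrad : _ →L[ℝ] Ambient n)‖ * ‖A‖
  have hsgrad (A : ℂ →L[ℝ] ℝ) (L : Ambient n →L[ℝ] ℂ) : ‖sgrad (A ∘L L)‖ ≤ c A * ‖L‖ := by
    rw [mul_assoc]
    exact ContinuousLinearMap.le_opNorm_of_le _ (ContinuousLinearMap.opNorm_comp_le _ _)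
  let B (L M : Ambient n →L[ℝ] ℂ) : ℝ :=
    sympl (sgrad (Complex.imCLM ∘L L)) (sgrad (Complex.reCLM ∘L M))
  let K : ℝ := ‖σ‖ * c Complex.imCLM * c Complex.reCLM
  have hK : 0 ≤ K := by positivity
  have hB (L M : Ambient n →L[ℝ] ℂ) : |B L M| ≤ K * (‖L‖ * ‖M‖) := by
    calc |B L M| ≤ ‖σ‖ * ‖sgrad (Complex.imCLM ∘L L)‖ * ‖sgrad (Complex.reCLM ∘L M)‖ :=
          σ.le_opNorm₂ _ _
      _ ≤ ‖σ‖ * (c Complex.imCLM * ‖L‖) * (c Complex.reCLM * ‖M‖) := by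
          gcongr <;> exact hsgrad _ _
      _ = K * (‖L‖ * ‖M‖) := by ring
  refine ⟨2 * K, by positivity, fun L M => ?_⟩
  have hexpand : poisson (L + M) - poisson L = B L M + B M L + B M M := by
    simp only [poisson, B, ContinuousLinearMap.comp_add, map_add, LinearMap.add_apply]
    ring
  calc |poisson (L + M) - poisson L| ≤ |B L M| + |B M L| + |B M M| := by
        rw [hexpand]; exact abs_add_three _ _ _
    _ ≤ K * (‖L‖ * ‖M‖) + K * (‖M‖ * ‖L‖) + K * (‖M‖ * ‖M‖) :=
        add_le_add_three (hB L M) (hB M L) (hB M M)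
    _ ≤ 2 * K * (‖L‖ + ‖M‖) * ‖M‖ := by
        linarith [mul_nonneg hK (mul_self_nonneg ‖M‖)]

theorem exists_poisson_complexForm_add_ge (n : ℕ) : ∃ ε : ℝ, 0 < ε ∧
    ∀ (l : Ambient n) (L : Ambient n →L[ℝ] ℂ), 1 / 4 ≤ coeffSq l → ‖L‖ ≤ ε →
      1 / 8 ≤ poisson (complexForm l + L) := by
  obtain ⟨C, hC, hbound⟩ := exists_abs_poisson_add_sub_le n
  let ε : ℝ := 1 / (16 * (C + 1) * (n + 2))
  have hε : 0 < ε := by positivity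
  have hCε : (C + 1) * ε * (n + 2) = 1 / 16 := by simp only [ε]; field_simp
  refine ⟨ε, hε, fun l L hl hL => ?_⟩
  set S := Real.sqrt (coeffSq l)
  have hS : 1 / 2 ≤ S := Real.le_sqrt_of_sq_le (by norm_num; linarith)
  have hform : ‖complexForm l‖ ≤ (n + 2) * S := (norm_complexForm_le l).trans (by
    gcongr; exact norm_le_sqrt_coeffSq l)
  have hε_le : ε ≤ 1 / 16 := by
    rw [← hCε, mul_right_comm]
    exact le_mul_of_one_le_left hε.le (by nlinarith [Nat.cast_nonneg (α := ℝ) n])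
  have herr : |poisson (complexForm l + L) - S ^ 2| ≤ S / 16 + 1 / 256 := by
    calc |poisson (complexForm l + L) - S ^ 2|
        = |poisson (complexForm l + L) - poisson (complexForm l)| := by
          rw [poisson_complexForm, Real.sq_sqrt (by linarith)]
      _ ≤ C * (‖complexForm l‖ + ‖L‖) * ‖L‖ := hbound _ _
      _ ≤ (C + 1) * ((n + 2) * S + ε) * ε := by gcongr; linarith
      _ = (C + 1) * ε * (n + 2) * S + (C + 1) * ε * ε := by ring
      _ ≤ (C + 1) * ε * (n + 2) * S + (C + 1) * ε * (n + 2) * (1 / 16) := by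
          rw [mul_assoc _ (_ + 2 : ℝ) (1 / 16)]
          gcongr
          nlinarith [Nat.cast_nonneg (α := ℝ) n]
      _ = S / 16 + 1 / 256 := by rw [hCε]; ring
  nlinarith [(abs_le.1 herr).1]

end Poisson

/-! ### Logarithmic differentials of the functions in the mirror equation -/

section LogCalculus

variable {n : ℕ}

theorem hasDerivAt_const_add_smul {E : Type*} [NormedAddCommGroup E] [NormedSpace ℝ E] (x y : E)
    (s : ℝ) : HasDerivAt (fun s : ℝ => x + s • y) y s := by
  simpa using ((hasDerivAt_id s).smul_const y).const_add x

theorem hasDerivAt_const_mul_exp_ofReal_mul (a b : ℂ) :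
    HasDerivAt (fun s : ℝ => a * Complex.exp (s * b)) (a * b) 0 := by
  have hlin : HasDerivAt (fun s : ℝ => (s : ℂ) * b) b 0 := by
    simpa using hasDerivAt_const_add_smul 0 b 0
  simpa using hlin.cexp.const_mul a

/-- The curve through `q` with constant logarithmic velocity `ξ`: its `z`-components move
exponentially and its `(u, v)`-component linearly. -/
def logCurve (q ξ : Ambient n) (s : ℝ) : Ambient n :=
  (fun i => q.1 i * Complex.exp (s * ξ.1 i), q.2 + s • ξ.2)

theorem logCurve_zero (q ξ : Ambient n) : logCurve q ξ 0 = q := by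
  simp [logCurve]

theorem logCurve_mem_space {q : Ambient n} (hq : q ∈ space n) (ξ : Ambient n) (s : ℝ) :
    logCurve q ξ s ∈ space n := fun i => mul_ne_zero (hq i) (Complex.exp_ne_zero _)

theorem hasDerivAt_logCurve (q ξ : Ambient n) : HasDerivAt (logCurve q ξ) (twist q ξ) 0 := by
  rw [twist_apply]
  exact (hasDerivAt_pi.2 fun i => hasDerivAt_const_mul_exp_ofReal_mul (q.1 i) (ξ.1 i)).prodMk
    (hasDerivAt_const_add_smul q.2 ξ.2 0)

theorem hasDerivAt_comp_logCurve {E : Type*} [NormedAddCommGroup E] [NormedSpace ℝ E]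
    {F : Ambient n → E} {q : Ambient n} (hF : DifferentiableAt ℝ F q) (ξ : Ambient n) :
    HasDerivAt (fun s => F (logCurve q ξ s)) (logForm F q ξ) 0 := by
  have hF' : HasFDerivAt F (fderiv ℝ F q) (logCurve q ξ 0) := by
    rw [logCurve_zero]; exact hF.hasFDerivAt
  exact hF'.comp_hasDerivAt 0 (hasDerivAt_logCurve q ξ)

theorem logForm_apply_eq {E : Type*} [NormedAddCommGroup E] [NormedSpace ℝ E]
    {F : Ambient n → E} {q ξ : Ambient n} (hF : DifferentiableAt ℝ F q) {d : E}
    (hd : HasDerivAt (fun s => F (logCurve q ξ s)) d 0) : logForm F q ξ = d :=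
  (hasDerivAt_comp_logCurve hF ξ).unique hd

theorem norm_logForm_ofReal_le {E : Type*} [NormedAddCommGroup E] [NormedSpace ℝ E]
    {F : Ambient n → ℝ} {f : E → ℝ} {q : Ambient n} {x : E} {y : Ambient n → E} {C : ℝ}
    (hF : DifferentiableAt ℝ (fun q => (F q : ℂ)) q) (hf : DifferentiableAt ℝ f x)
    (hC : ‖fderiv ℝ f x‖ ≤ C) (hcurve : ∀ ξ s, F (logCurve q ξ s) = f (x + s • y ξ))
    (hy : ∀ ξ, ‖y ξ‖ ≤ ‖ξ‖) : ‖logForm (fun q => (F q : ℂ)) q‖ ≤ C := by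
  refine ContinuousLinearMap.opNorm_le_bound _ ((norm_nonneg _).trans hC) fun ξ => ?_
  have hf' : HasFDerivAt f (fderiv ℝ f x) (x + (0 : ℝ) • y ξ) := by
    rw [zero_smul, add_zero]; exact hf.hasFDerivAt
  have hderiv : logForm (fun q => (F q : ℂ)) q ξ = (fderiv ℝ f x (y ξ) : ℝ) := by
    refine logForm_apply_eq hF ?_
    simp only [hcurve]
    exact (hf'.comp_hasDerivAt 0 (hasDerivAt_const_add_smul x (y ξ) 0)).ofReal_comp
  rw [hderiv, Complex.norm_real]
  exact ContinuousLinearMap.le_of_opNorm_le_of_le _ hC (hy ξ)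

theorem logForm_mul {F G : Ambient n → ℂ} {q : Ambient n} (hF : DifferentiableAt ℝ F q)
    (hG : DifferentiableAt ℝ G q) :
    logForm (fun q => F q * G q) q = F q • logForm G q + G q • logForm F q := by
  refine ContinuousLinearMap.ext fun ξ => ?_
  exact congrArg (fun L => L (twist q ξ)) (hF.hasFDerivAt.mul hG.hasFDerivAt).fderiv

theorem norm_logForm_mul_le {F G : Ambient n → ℂ} {q : Ambient n} (hF : DifferentiableAt ℝ F q)
    (hG : DifferentiableAt ℝ G q) {a b a' b' : ℝ} (hFa : ‖F q‖ ≤ a) (hGb : ‖G q‖ ≤ b)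
    (hFa' : ‖logForm F q‖ ≤ a') (hGb' : ‖logForm G q‖ ≤ b') :
    ‖logForm (fun q => F q * G q) q‖ ≤ a * b' + b * a' := by
  have ha : 0 ≤ a := (norm_nonneg _).trans hFa
  have hb : 0 ≤ b := (norm_nonneg _).trans hGb
  rw [logForm_mul hF hG]
  refine norm_add_le_of_le ?_ ?_ <;> rw [norm_smul] <;> gcongr

theorem differentiableAt_of_contDiffOn_space {E : Type*} [NormedAddCommGroup E] [NormedSpace ℝ E]
    {F : Ambient n → E} (hF : ContDiffOn ℝ ∞ F (space n)) {q : Ambient n} (hq : q ∈ space n) :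
    DifferentiableAt ℝ F q :=
  (hF.contDiffAt (isOpen_space.mem_nhds hq)).differentiableAt (by simp)

end LogCalculus

/-! ### The terms of the potential -/

section Terms

variable {n p : ℕ} (fan : SmoothCompleteFan n p) (lam : Fin p → ℝ) (t : ℝ)

theorem contDiffOn_zpow (m : ℤ) : ContDiffOn ℝ ∞ (fun z : ℂ => z ^ m) {z | z ≠ 0} := by
  cases m with
  | ofNat a => simpa using (contDiff_id.pow a).contDiffOn
  | negSucc a =>
    simp only [zpow_negSucc]
    exact (contDiff_id.pow (a + 1)).contDiffOn.inv fun z hz => pow_ne_zero _ hz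

theorem contDiffOn_term (k : Fin p) :
    ContDiffOn ℝ ∞ (term fan lam t k) (torus n) := by
  refine contDiffOn_const.mul (contDiffOn_prod fun i _ => ?_)
  exact (contDiffOn_zpow _).comp (contDiff_apply ℝ ℂ i).contDiffOn fun z hz => hz i

theorem contDiffOn_term_fst (k : Fin p) :
    ContDiffOn ℝ ∞ (fun q : Ambient n => term fan lam t k q.1) (space n) :=
  (contDiffOn_term fan lam t k).comp contDiff_fst.contDiffOn fun _ hq => hq

/-- The `ℂ`-linear form `ξ ↦ ⟨v, ξ⟩` on the `z`-components: the logarithmic differential of the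
monomial `z^v`. -/
def rayForm (v : Fin n → ℤ) : Ambient n →L[ℝ] ℂ := complexForm (fun i => (v i : ℂ), 0, 0)

theorem rayForm_apply (v : Fin n → ℤ) (ξ : Ambient n) : rayForm v ξ = ∑ i, (v i : ℂ) * ξ.1 i := by
  simp [rayForm, complexForm_apply]

theorem term_mul_exp (k : Fin p) (z ζ : Fin n → ℂ) :
    term fan lam t k (fun i => z i * Complex.exp (ζ i)) =
      term fan lam t k z * Complex.exp (∑ i, (fan.ray k i : ℂ) * ζ i) := by
  simp only [term, mul_zpow, Finset.prod_mul_distrib, Complex.exp_sum, ← Complex.exp_int_mul]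
  ring

theorem logForm_term (k : Fin p) {q : Ambient n} (hq : q ∈ space n) :
    logForm (fun q : Ambient n => term fan lam t k q.1) q =
      term fan lam t k q.1 • rayForm (fan.ray k) := by
  refine ContinuousLinearMap.ext fun ξ => ?_
  refine logForm_apply_eq (differentiableAt_of_contDiffOn_space
    (contDiffOn_term_fst fan lam t k) hq) ?_
  have hcurve : (fun s : ℝ => term fan lam t k (logCurve q ξ s).1) =
      fun s : ℝ => term fan lam t k q.1 * Complex.exp (s * rayForm (fan.ray k) ξ) := by
    funext s
    simp only [logCurve, term_mul_exp, rayForm_apply, Finset.mul_sum, mul_left_comm]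
  rw [hcurve]
  exact hasDerivAt_const_mul_exp_ofReal_mul _ _

theorem norm_eq_exp_logMapT {t : ℝ} (ht : Real.log t ≠ 0) {z : Fin n → ℂ} (hz : z ∈ torus n)
    (i : Fin n) : ‖z i‖ = Real.exp (Real.log t * logMapT t z i) := by
  have hlog : Real.log t * logMapT t z i = Real.log ‖z i‖ := by
    simp only [logMapT, logMap, Pi.smul_apply, smul_eq_mul]
    field_simp
  rw [hlog, Real.exp_log (norm_pos_iff.2 (hz i))]

theorem norm_term {t : ℝ} (ht : 0 < t) (hlog : Real.log t ≠ 0) (k : Fin p) {z : Fin n → ℂ}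
    (hz : z ∈ torus n) :
    ‖term fan lam t k z‖ = Real.exp (Real.log t * chi fan lam k (logMapT t z)) := by
  rw [term, norm_mul, Complex.norm_real, Real.norm_of_nonneg (by positivity), norm_prod,
    Real.rpow_def_of_pos ht, chi, mul_add, Real.exp_add, pairing, Finset.mul_sum, Real.exp_sum]
  congr 1
  refine Finset.prod_congr rfl fun i _ => ?_
  rw [norm_zpow, norm_eq_exp_logMapT hlog hz, ← Real.rpow_intCast, ← Real.exp_mul]
  ring_nf

/-- The part of the potential that the simplification near the facet of `j` removes: the sum of
the terms other than the one of `j`. -/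
def tail (j : Fin p) (q : Ambient n) : ℂ := ∑ k ∈ Finset.univ.erase j, term fan lam t k q.1

/-- The function `uv - W` whose zero locus is the mirror. -/
def mirrorFun (q : Ambient n) : ℂ := q.2.1 * q.2.2 - potential fan lam t q.1

theorem contDiffOn_tail (j : Fin p) : ContDiffOn ℝ ∞ (tail fan lam t j) (space n) :=
  ContDiffOn.sum fun k _ => contDiffOn_term_fst fan lam t k

theorem contDiffOn_mirrorFun : ContDiffOn ℝ ∞ (mirrorFun fan lam t) (space n) := by
  refine ContDiffOn.sub ?_ (contDiffOn_const.add
    (ContDiffOn.sum fun k _ => contDiffOn_term_fst fan lam t k))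
  exact ((contDiff_fst.comp contDiff_snd).mul (contDiff_snd.comp contDiff_snd)).contDiffOn

theorem potential_eq (j : Fin p) (q : Ambient n) :
    potential fan lam t q.1 = 1 + (term fan lam t j q.1 + tail fan lam t j q) := by
  rw [potential, tail, Finset.add_sum_erase _ (fun k => term fan lam t k q.1) (Finset.mem_univ j)]

theorem logForm_tail (j : Fin p) {q : Ambient n} (hq : q ∈ space n) :
    logForm (tail fan lam t j) q =
      ∑ k ∈ Finset.univ.erase j, term fan lam t k q.1 • rayForm (fan.ray k) := by
  have hfderiv : fderiv ℝ (tail fan lam t j) q = _ :=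
    (HasFDerivAt.fun_sum (u := Finset.univ.erase j) fun k _ => (differentiableAt_of_contDiffOn_space
      (contDiffOn_term_fst fan lam t k) hq).hasFDerivAt).fderiv
  rw [logForm, hfderiv, ContinuousLinearMap.finsetSum_comp]
  exact Finset.sum_congr rfl fun k _ => logForm_term fan lam t k hq

/-- The coefficients of the logarithmic differential of `uv - 1 - t^{λ_j} z^{v_j}`, the leading part
of the one of `uv - W` near the facet of `j`. -/
def leadCoeff (j : Fin p) (q : Ambient n) : Ambient n :=
  (fun i => -(term fan lam t j q.1 * (fan.ray j i : ℂ)), q.2.2, q.2.1)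

theorem logForm_mirrorFun (j : Fin p) {q : Ambient n} (hq : q ∈ space n) :
    logForm (mirrorFun fan lam t) q =
      complexForm (leadCoeff fan lam t j q) - logForm (tail fan lam t j) q := by
  refine ContinuousLinearMap.ext fun ξ => ?_
  have hterm := hasDerivAt_comp_logCurve (differentiableAt_of_contDiffOn_space
    (contDiffOn_term_fst fan lam t j) hq) ξ
  have htail := hasDerivAt_comp_logCurve (differentiableAt_of_contDiffOn_space
    (contDiffOn_tail fan lam t j) hq) ξ
  have hu : HasDerivAt (fun s : ℝ => (logCurve q ξ s).2.1) ξ.2.1 0 :=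
    hasDerivAt_const_add_smul q.2.1 ξ.2.1 0
  have hv : HasDerivAt (fun s : ℝ => (logCurve q ξ s).2.2) ξ.2.2 0 :=
    hasDerivAt_const_add_smul q.2.2 ξ.2.2 0
  refine logForm_apply_eq (differentiableAt_of_contDiffOn_space
    (contDiffOn_mirrorFun fan lam t) hq) ?_
  simp only [mirrorFun, potential_eq fan lam t j]
  refine ((hu.mul hv).sub ((hterm.add htail).const_add 1)).congr_deriv ?_
  rw [logForm_term fan lam t j hq, logCurve_zero, sub_apply, complexForm_apply]
  simp only [leadCoeff, smul_apply, rayForm_apply, smul_eq_mul, Finset.mul_sum, neg_mul,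
    Finset.sum_neg_distrib, mul_assoc]
  ring

theorem coeffSq_leadCoeff (j : Fin p) (q : Ambient n) : coeffSq (leadCoeff fan lam t j q) =
    ‖term fan lam t j q.1‖ ^ 2 * raySq fan j + ‖q.2.2‖ ^ 2 + ‖q.2.1‖ ^ 2 := by
  simp only [coeffSq, leadCoeff, raySq, Finset.mul_sum, norm_neg, norm_mul, mul_pow,
    Complex.norm_intCast, sq_abs]

-- Where `uv` is close to `1 + t^{λ_j} z^{v_j}`, the term and `uv` cannot both be small.
theorem one_div_four_le_coeffSq_leadCoeff (j : Fin p) {q : Ambient n}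
    (h : ‖1 + term fan lam t j q.1 - q.2.1 * q.2.2‖ ≤ 1 / 4) :
    1 / 4 ≤ coeffSq (leadCoeff fan lam t j q) := by
  have hr := one_le_raySq fan j
  rw [coeffSq_leadCoeff]
  set w := term fan lam t j q.1
  rcases le_total (1 / 2) ‖w‖ with hw | hw
  · nlinarith [sq_nonneg ‖q.2.1‖, sq_nonneg ‖q.2.2‖, sq_nonneg ‖w‖]
  · have huv : 1 / 4 ≤ ‖q.2.1‖ * ‖q.2.2‖ := by
      have hone : ‖(1 + w - q.2.1 * q.2.2) + (-w) + q.2.1 * q.2.2‖ = 1 := by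
        rw [← norm_one (α := ℂ)]; ring_nf
      have htri := norm_add₃_le (a := 1 + w - q.2.1 * q.2.2) (b := -w) (c := q.2.1 * q.2.2)
      rw [hone, norm_neg, norm_mul] at htri
      linarith
    have hterm : 0 ≤ ‖w‖ ^ 2 * raySq fan j := by positivity
    nlinarith [sq_nonneg (‖q.2.1‖ - ‖q.2.2‖)]

end Terms

/-! ### Cutoff functions on the torus and on the fibre -/

section Cutoffs

variable {n : ℕ}

theorem logMapT_mul_exp (t : ℝ) {z : Fin n → ℂ} (hz : z ∈ torus n) (ζ : Fin n → ℂ) :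
    logMapT t (fun i => z i * Complex.exp (ζ i)) =
      logMapT t z + (Real.log t)⁻¹ • fun i => (ζ i).re := by
  ext i
  simp only [logMapT, logMap, Pi.add_apply, Pi.smul_apply, smul_eq_mul]
  rw [norm_mul, Complex.norm_exp, Real.log_mul (norm_ne_zero_iff.2 (hz i)) (Real.exp_ne_zero _),
    Real.log_exp, mul_add]

theorem contDiffOn_logMapT (t : ℝ) : ContDiffOn ℝ ∞ (logMapT (n := n) t) (torus n) := by
  refine ContDiffOn.const_smul _ ?_
  rw [contDiffOn_pi]
  intro i
  refine ContDiffOn.log ?_ fun z hz => norm_ne_zero_iff.2 (hz i)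
  exact (contDiff_apply ℝ ℂ i).contDiffOn.norm ℝ fun z hz => hz i

/-- The pullback by `Log_t` of a function on `ℝⁿ`, extended by zero off the torus: there `logMapT`
has junk values, and the perturbations built from it have to vanish. -/
def baseCut (t : ℝ) (f : (Fin n → ℝ) → ℝ) (z : Fin n → ℂ) : ℝ :=
  (torus n).indicator (fun z => f (logMapT t z)) z

theorem baseCut_of_mem (t : ℝ) (f : (Fin n → ℝ) → ℝ) {z : Fin n → ℂ} (hz : z ∈ torus n) :
    baseCut t f z = f (logMapT t z) := indicator_of_mem hz _

theorem baseCut_mem_Icc {t : ℝ} {f : (Fin n → ℝ) → ℝ} (hf : ∀ x, f x ∈ Icc (0 : ℝ) 1)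
    (z : Fin n → ℂ) : baseCut t f z ∈ Icc (0 : ℝ) 1 := by
  by_cases hz : z ∈ torus n
  · rw [baseCut_of_mem t f hz]; exact hf _
  · rw [baseCut, indicator_of_notMem hz]; exact ⟨le_rfl, zero_le_one⟩

theorem contDiffOn_baseCut (t : ℝ) {f : (Fin n → ℝ) → ℝ} (hf : ContDiff ℝ ∞ f) :
    ContDiffOn ℝ ∞ (baseCut t f) (torus n) :=
  (hf.comp_contDiffOn (contDiffOn_logMapT t)).congr fun _ hz => baseCut_of_mem t f hz

theorem contDiffOn_baseCut_fst (t : ℝ) {f : (Fin n → ℝ) → ℝ} (hf : ContDiff ℝ ∞ f) :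
    ContDiffOn ℝ ∞ (fun q : Ambient n => (baseCut t f q.1 : ℂ)) (space n) :=
  Complex.ofRealCLM.contDiff.comp_contDiffOn
    ((contDiffOn_baseCut t hf).comp contDiff_fst.contDiffOn fun _ hq => hq)

theorem norm_logForm_baseCut_le {t : ℝ} (ht : 1 ≤ |Real.log t|) {f : (Fin n → ℝ) → ℝ} {C : ℝ}
    (hf : IsSmoothCutoff C f) {q : Ambient n} (hq : q ∈ space n) :
    ‖logForm (fun q : Ambient n => (baseCut t f q.1 : ℂ)) q‖ ≤ C := by
  refine norm_logForm_ofReal_le (y := fun ξ : Ambient n => (Real.log t)⁻¹ • fun i => (ξ.1 i).re)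
    (differentiableAt_of_contDiffOn_space (contDiffOn_baseCut_fst t hf.smooth) hq)
    (hf.smooth.differentiable (by simp) (logMapT t q.1)) (hf.norm_fderiv_le _)
    (fun ξ s => ?_) fun ξ => ?_
  · rw [baseCut_of_mem t f (logCurve_mem_space hq ξ s), logCurve, logMapT_mul_exp t hq,
      smul_comm s]
    congr 3
    ext i
    simp
  · have hre : ‖fun i => (ξ.1 i).re‖ ≤ ‖ξ‖ :=
      (pi_norm_le_iff_of_nonneg (norm_nonneg _)).2 fun i =>
        (Complex.abs_re_le_norm _).trans ((norm_le_pi_norm ξ.1 i).trans (norm_fst_le ξ))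
    rw [norm_smul, norm_inv, Real.norm_eq_abs]
    exact (mul_le_of_le_one_left (norm_nonneg _) (inv_le_one_of_one_le₀ ht)).trans hre

theorem norm_logForm_comp_snd_le {τ : ℂ × ℂ → ℝ} {C : ℝ} (hτ : IsSmoothCutoff C τ)
    (q : Ambient n) : ‖logForm (fun q : Ambient n => (τ q.2 : ℂ)) q‖ ≤ C := by
  have hsmooth : ContDiff ℝ ∞ fun q : Ambient n => (τ q.2 : ℂ) :=
    Complex.ofRealCLM.contDiff.comp (hτ.smooth.comp contDiff_snd)
  exact norm_logForm_ofReal_le (y := fun ξ : Ambient n => ξ.2)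
    (hsmooth.differentiable (by simp) q) (hτ.smooth.differentiable (by simp) q.2)
    (hτ.norm_fderiv_le _) (fun ξ s => rfl) norm_snd_le

/-- The points `(z, w)` with `Log_t z ∈ A` and `w ∈ D`: the supports of the perturbations of the
mirror equation are of this form. -/
def tube (t : ℝ) (A : Set (Fin n → ℝ)) (D : Set (ℂ × ℂ)) : Set (Ambient n) :=
  {q | q ∈ space n ∧ logMapT t q.1 ∈ A ∧ q.2 ∈ D}

/-- The point with `Log_t z = x`, arguments given by the unit complex numbers `y i`, and
`(u, v) = w`: polar coordinates on the ambient space. -/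
def polar (t : ℝ) (a : (Fin n → ℝ) × (Fin n → ℂ) × (ℂ × ℂ)) : Ambient n :=
  (fun i => (Real.exp (Real.log t * a.1 i) : ℂ) * a.2.1 i, a.2.2)

theorem logMapT_polar {t : ℝ} (ht : Real.log t ≠ 0) {x : Fin n → ℝ} {y : Fin n → ℂ}
    (hy : ∀ i, ‖y i‖ = 1) (w : ℂ × ℂ) : logMapT t (polar t (x, y, w)).1 = x := by
  ext i
  simp only [logMapT, logMap, polar, Pi.smul_apply, smul_eq_mul]
  rw [norm_mul, hy, mul_one, Complex.norm_real, Real.norm_eq_abs, Real.abs_exp, Real.log_exp,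
    inv_mul_cancel_left₀ ht]

theorem polar_mem_space {t : ℝ} {x : Fin n → ℝ} {y : Fin n → ℂ} (hy : ∀ i, ‖y i‖ = 1)
    (w : ℂ × ℂ) : polar t (x, y, w) ∈ space n := fun i =>
  mul_ne_zero (by exact_mod_cast Real.exp_ne_zero _) (norm_ne_zero_iff.1 (by simp [hy]))

theorem polar_logMapT {t : ℝ} (ht : Real.log t ≠ 0) {q : Ambient n} (hq : q ∈ space n) :
    polar t (logMapT t q.1, fun i => q.1 i / ‖q.1 i‖, q.2) = q := by
  refine Prod.ext (funext fun i => ?_) rfl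
  have hnorm : (‖q.1 i‖ : ℂ) ≠ 0 := by exact_mod_cast norm_ne_zero_iff.2 (hq i)
  simp only [polar]
  rw [← norm_eq_exp_logMapT ht hq, mul_div_cancel₀ _ hnorm]

theorem tube_eq_image_polar {t : ℝ} (ht : Real.log t ≠ 0) (A : Set (Fin n → ℝ))
    (D : Set (ℂ × ℂ)) :
    tube t A D = polar t '' (A ×ˢ ((univ.pi fun _ => Metric.sphere (0 : ℂ) 1) ×ˢ D)) := by
  ext q
  constructor
  · rintro ⟨hq, hqA, hqD⟩
    refine ⟨_, ⟨hqA, fun i _ => ?_, hqD⟩, polar_logMapT ht hq⟩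
    simp [div_self (norm_ne_zero_iff.2 (hq i))]
  · rintro ⟨⟨x, y, w⟩, ⟨hx, hy, hw⟩, rfl⟩
    have hy_norm : ∀ i, ‖y i‖ = 1 := fun i => by simpa using hy i (mem_univ i)
    refine ⟨polar_mem_space hy_norm w, ?_, hw⟩
    rwa [logMapT_polar ht hy_norm]

theorem isCompact_tube {t : ℝ} (ht : Real.log t ≠ 0) {A : Set (Fin n → ℝ)} (hA : IsCompact A)
    {D : Set (ℂ × ℂ)} (hD : IsCompact D) : IsCompact (tube t A D) := by
  have hpolar : Continuous (polar (n := n) t) := by unfold polar; fun_prop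
  rw [tube_eq_image_polar ht]
  exact (hA.prod ((isCompact_univ_pi fun _ => isCompact_sphere _ _).prod hD)).image hpolar

theorem mem_box {t : ℝ} (ht : Real.log t ≠ 0) {R : ℝ} {U : Set (Fin n → ℝ)} {q : Ambient n} :
    q ∈ box t R U ↔ q ∈ space n ∧ logMapT t q.1 ∈ U ∧ ‖q.2.1‖ ^ 2 / 2 ≤ R ∧
      ‖q.2.2‖ ^ 2 / 2 ≤ R := by
  have hU : logMap q.1 ∈ Real.log t • U ↔ logMapT t q.1 ∈ U := by
    rw [mem_smul_set_iff_inv_smul_mem₀ ht]; rfl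
  have hnonneg : ∀ x : ℂ, 0 ≤ ‖x‖ ^ 2 / 2 := fun x => by positivity
  simp only [box, momentMap, mem_ofPred_eq, mem_prod, mem_Icc, hU, hnonneg, true_and]
  rfl

end Cutoffs

section Perturbation

variable {n p : ℕ} (fan : SmoothCompleteFan n p) (lam : Fin p → ℝ) (t : ℝ) (j : Fin p)

/-- The function `τ ρ ∑_{k ≠ j} t^{λ_k} z^{v_k}` whose addition to the equation of the mirror gives
the equation of the simplified mirror. -/
def pert (τ : ℂ × ℂ → ℝ) (ρ : (Fin n → ℂ) → ℝ) (q : Ambient n) : ℂ :=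
  ((τ q.2 : ℂ) * (ρ q.1 : ℂ)) * tail fan lam t j q

/-- Over `U` the sum of the terms other than the leading one is bounded by `κ`, and so is its
logarithmic derivative. -/
structure HasSmallTail (U : Set (Fin n → ℝ)) (κ : ℝ) : Prop where
  norm_tail_le : ∀ q ∈ space n, logMapT t q.1 ∈ U → ‖tail fan lam t j q‖ ≤ κ
  norm_logForm_tail_le : ∀ q ∈ space n, logMapT t q.1 ∈ U → ‖logForm (tail fan lam t j) q‖ ≤ κ

variable {fan lam t j}

theorem mirror_eq_family (τ : ℂ × ℂ → ℝ) (ρ : (Fin n → ℂ) → ℝ) : mirror fan lam t =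
    {q | q ∈ space n ∧ family (mirrorFun fan lam t) (pert fan lam t j τ ρ) 0 q = 0} := by
  ext q
  simp only [mirror, family, mirrorFun, Complex.ofReal_zero, zero_mul, add_zero, mem_ofPred_eq,
    sub_eq_zero]
  rfl

theorem cutMirror_eq_family (τ : ℂ × ℂ → ℝ) (ρ : (Fin n → ℂ) → ℝ) : cutMirror fan lam t j τ ρ =
    {q | q ∈ space n ∧ family (mirrorFun fan lam t) (pert fan lam t j τ ρ) 1 q = 0} := by
  ext q
  have hfamily : family (mirrorFun fan lam t) (pert fan lam t j τ ρ) 1 q =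
      q.2.1 * q.2.2 - cutPotential fan lam t j τ ρ q := by
    simp only [family, mirrorFun, pert, cutPotential, tail]; push_cast; ring
  simp only [cutMirror, mem_ofPred_eq, hfamily, sub_eq_zero]
  rfl

theorem pert_eq_zero_of_notMem_tube {τ : ℂ × ℂ → ℝ} {f : (Fin n → ℝ) → ℝ} {A : Set (Fin n → ℝ)}
    {D : Set (ℂ × ℂ)} (hfA : ∀ x, x ∉ A → f x = 0) (hτD : ∀ w, w ∉ D → τ w = 0) {q : Ambient n}
    (hq : q ∉ tube t A D) : pert fan lam t j τ (baseCut t f) q = 0 := by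
  rw [pert]
  by_cases hq_torus : q.1 ∈ torus n
  · by_cases hqA : logMapT t q.1 ∈ A
    · rw [hτD _ fun hqD => hq ⟨hq_torus, hqA, hqD⟩]
      simp
    · rw [baseCut_of_mem t f hq_torus, hfA _ hqA]
      simp
  · rw [baseCut, indicator_of_notMem hq_torus]
    simp

theorem isTransportData_pert {τ : ℂ × ℂ → ℝ} (hτ : ContDiff ℝ ∞ τ) {f : (Fin n → ℝ) → ℝ}
    (hf : ContDiff ℝ ∞ f) {A : Set (Fin n → ℝ)} (hA : IsCompact A) (hfA : ∀ x, x ∉ A → f x = 0)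
    {D : Set (ℂ × ℂ)} (hD : IsCompact D) (hτD : ∀ w, w ∉ D → τ w = 0) (ht : Real.log t ≠ 0) :
    IsTransportData (mirrorFun fan lam t) (pert fan lam t j τ (baseCut t f)) (tube t A D) where
  smooth := contDiffOn_mirrorFun fan lam t
  smooth_pert := by
    refine contDiff_of_contDiffOn_of_eq_zero isOpen_space (isCompact_tube ht hA hD).isClosed
      (fun q hq => hq.1) ?_ fun q hq => pert_eq_zero_of_notMem_tube hfA hτD hq
    exact ((Complex.ofRealCLM.contDiff.comp (hτ.comp contDiff_snd)).contDiffOn.mul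
      (contDiffOn_baseCut_fst t hf)).mul (contDiffOn_tail fan lam t j)
  isCompact := isCompact_tube ht hA hD
  subset q hq := hq.1
  eq_zero q hq := pert_eq_zero_of_notMem_tube hfA hτD hq

theorem norm_mul_sub_family_le {τ : ℂ × ℂ → ℝ} (hτ : ∀ w, τ w ∈ Icc (0 : ℝ) 1)
    {ρ : (Fin n → ℂ) → ℝ} (hρ : ∀ z, ρ z ∈ Icc (0 : ℝ) 1) {s : ℝ} (hs : s ∈ Icc (0 : ℝ) 1)
    (q : Ambient n) :
    ‖q.2.1 * q.2.2 - (1 + term fan lam t j q.1) -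
      family (mirrorFun fan lam t) (pert fan lam t j τ ρ) s q‖ ≤ ‖tail fan lam t j q‖ := by
  obtain ⟨hc₀, hc₁⟩ := Icc.mem_iff_one_sub_mem.1
    (unitInterval.mul_mem hs (unitInterval.mul_mem (hτ q.2) (hρ q.1)))
  have hdiff : q.2.1 * q.2.2 - (1 + term fan lam t j q.1) -
      family (mirrorFun fan lam t) (pert fan lam t j τ ρ) s q =
        (1 - s * (τ q.2 * ρ q.1) : ℝ) * tail fan lam t j q := by
    rw [family, mirrorFun, potential_eq fan lam t j, pert]; push_cast; ring
  rw [hdiff, norm_mul, Complex.norm_real, Real.norm_of_nonneg hc₀]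
  exact mul_le_of_le_one_left (norm_nonneg _) hc₁

theorem norm_mul_norm_le_of_family_eq_zero {τ : ℂ × ℂ → ℝ} (hτ : ∀ w, τ w ∈ Icc (0 : ℝ) 1)
    {ρ : (Fin n → ℂ) → ℝ} (hρ : ∀ z, ρ z ∈ Icc (0 : ℝ) 1) {s : ℝ} (hs : s ∈ Icc (0 : ℝ) 1)
    {q : Ambient n} (h : family (mirrorFun fan lam t) (pert fan lam t j τ ρ) s q = 0) :
    ‖q.2.1‖ * ‖q.2.2‖ ≤ 1 + ∑ k, ‖term fan lam t k q.1‖ := by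
  have hdiff := norm_mul_sub_family_le (fan := fan) (lam := lam) (t := t) (j := j) hτ hρ hs q
  rw [h, sub_zero] at hdiff
  have htail : ‖tail fan lam t j q‖ ≤ ∑ k ∈ Finset.univ.erase j, ‖term fan lam t k q.1‖ :=
    norm_sum_le _ _
  have hlead : ‖1 + term fan lam t j q.1‖ ≤ 1 + ‖term fan lam t j q.1‖ :=
    (norm_add_le _ _).trans_eq (by rw [norm_one])
  rw [← norm_mul, ← Finset.add_sum_erase _ (fun k => ‖term fan lam t k q.1‖) (Finset.mem_univ j)]
  linarith [norm_le_norm_add_norm_sub' (q.2.1 * q.2.2) (1 + term fan lam t j q.1)]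

theorem norm_logForm_pert_le (ht : 1 ≤ |Real.log t|) {τ : ℂ × ℂ → ℝ} {f : (Fin n → ℝ) → ℝ}
    {C₁ C₂ : ℝ} (hτ : IsSmoothCutoff C₁ τ) (hf : IsSmoothCutoff C₂ f) {q : Ambient n}
    (hq : q ∈ space n) {κ : ℝ} (hκ : ‖tail fan lam t j q‖ ≤ κ)
    (hκ' : ‖logForm (tail fan lam t j) q‖ ≤ κ) :
    ‖logForm (pert fan lam t j τ (baseCut t f)) q‖ ≤ (1 + C₁ + C₂) * κ := by
  have norm_le_one : ∀ x ∈ Icc (0 : ℝ) 1, ‖(x : ℂ)‖ ≤ 1 := fun x hx => by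
    rw [Complex.norm_real, Real.norm_of_nonneg hx.1]; exact hx.2
  have hτ_diff : DifferentiableAt ℝ (fun q : Ambient n => (τ q.2 : ℂ)) q :=
    (Complex.ofRealCLM.contDiff.comp (hτ.smooth.comp contDiff_snd)).differentiable (by simp) q
  have hf_diff := differentiableAt_of_contDiffOn_space (contDiffOn_baseCut_fst t hf.smooth) hq
  have htail_diff := differentiableAt_of_contDiffOn_space (contDiffOn_tail fan lam t j) hq
  have hτ_le := norm_le_one _ (hτ.mem_Icc q.2)
  have hf_le := norm_le_one _ (baseCut_mem_Icc (t := t) hf.mem_Icc q.1)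
  have hcut := norm_logForm_mul_le hτ_diff hf_diff hτ_le hf_le (norm_logForm_comp_snd_le hτ q)
    (norm_logForm_baseCut_le ht hf hq)
  have hcut_le : ‖(τ q.2 : ℂ) * (baseCut t f q.1 : ℂ)‖ ≤ 1 := by
    rw [norm_mul]
    exact mul_le_one₀ hτ_le (norm_nonneg _) hf_le
  refine (norm_logForm_mul_le (hτ_diff.mul hf_diff) htail_diff hcut_le hκ hcut hκ').trans_eq ?_
  ring

theorem HasSmallTail.poisson_family_ge {U : Set (Fin n → ℝ)} {κ ε C₁ C₂ : ℝ}
    (htail : HasSmallTail fan lam t j U κ) (hκ : κ ≤ 1 / 16) (hκε : (2 + C₁ + C₂) * κ ≤ ε)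
    (hε : ∀ (l : Ambient n) (L : Ambient n →L[ℝ] ℂ),
      1 / 4 ≤ coeffSq l → ‖L‖ ≤ ε → 1 / 8 ≤ poisson (complexForm l + L))
    (ht : 1 ≤ |Real.log t|) {τ : ℂ × ℂ → ℝ} {f : (Fin n → ℝ) → ℝ} (hτ : IsSmoothCutoff C₁ τ)
    (hf : IsSmoothCutoff C₂ f) (hsmooth : ContDiff ℝ ∞ (pert fan lam t j τ (baseCut t f))) {s : ℝ}
    (hs : s ∈ Icc (0 : ℝ) 1) {q : Ambient n} (hq : q ∈ space n) (hqU : logMapT t q.1 ∈ U)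
    (hfamily : ‖family (mirrorFun fan lam t) (pert fan lam t j τ (baseCut t f)) s q‖ ≤ 1 / 8) :
    1 / 8 ≤ poisson
      (logForm (family (mirrorFun fan lam t) (pert fan lam t j τ (baseCut t f)) s) q) := by
  have hT := htail.norm_tail_le q hq hqU
  have hT' := htail.norm_logForm_tail_le q hq hqU
  rw [logForm_family (contDiffOn_mirrorFun fan lam t) hsmooth s hq,
    logForm_mirrorFun fan lam t j hq, sub_add_eq_add_sub, add_sub_assoc]
  refine hε _ _ (one_div_four_le_coeffSq_leadCoeff fan lam t j ?_) ?_
  · have hdiff := norm_mul_sub_family_le (fan := fan) (lam := lam) (t := t) (j := j) hτ.mem_Icc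
      (baseCut_mem_Icc (t := t) hf.mem_Icc) hs q
    rw [norm_sub_rev]
    linarith [norm_le_norm_add_norm_sub' (q.2.1 * q.2.2 - (1 + term fan lam t j q.1))
      (family (mirrorFun fan lam t) (pert fan lam t j τ (baseCut t f)) s q)]
  · have hpert := norm_logForm_pert_le ht hτ hf hq hT hT'
    refine (norm_sub_le _ _).trans ?_
    rw [norm_smul, Real.norm_of_nonneg hs.1]
    linarith [mul_le_of_le_one_left
      (norm_nonneg (logForm (pert fan lam t j τ (baseCut t f)) q)) hs.2]

end Perturbation

/-! ### Hypersurfaces in a box -/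

section Submanifold

variable {n p : ℕ} {fan : SmoothCompleteFan n p} {lam : Fin p → ℝ} {t : ℝ}

/-- The set of points of `ℂ²` with `|u|²/2, |v|²/2 ≤ a`. -/
def bidisc (a : ℝ) : Set (ℂ × ℂ) := {w | ‖w.1‖ ^ 2 / 2 ≤ a ∧ ‖w.2‖ ^ 2 / 2 ≤ a}

theorem isClosed_bidisc (a : ℝ) : IsClosed (bidisc a) := by
  have hu : Continuous fun w : ℂ × ℂ => ‖w.1‖ ^ 2 / 2 := by fun_prop
  have hv : Continuous fun w : ℂ × ℂ => ‖w.2‖ ^ 2 / 2 := by fun_prop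
  exact (isClosed_le hu continuous_const).inter (isClosed_le hv continuous_const)

theorem isCompact_bidisc (a : ℝ) : IsCompact (bidisc a) := by
  have le_add_one : ∀ b : ℝ, 0 ≤ b → b ^ 2 / 2 ≤ a → b ≤ a + 1 := fun b _ hba => by
    nlinarith [sq_nonneg (b - 1)]
  refine (isCompact_closedBall (0 : ℂ × ℂ) (a + 1)).of_isClosed_subset (isClosed_bidisc a)
    fun w hw => ?_
  rw [mem_closedBall_zero_iff]
  exact norm_prod_le_iff.2
    ⟨le_add_one _ (norm_nonneg _) hw.1, le_add_one _ (norm_nonneg _) hw.2⟩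

theorem fderiv_half_norm_sq_sub {E F : Type*} [NormedAddCommGroup E] [NormedSpace ℝ E]
    [NormedAddCommGroup F] [InnerProductSpace ℝ F] (L : E →L[ℝ] F) (R : ℝ) (q ξ : E) :
    fderiv ℝ (fun x => ‖L x‖ ^ 2 / 2 - R) q ξ = inner ℝ (L q) (L ξ) := by
  have hderiv := ((L.hasFDerivAt (x := q)).norm_sq.mul_const (2⁻¹ : ℝ)).sub_const R
  simp only [← div_eq_mul_inv] at hderiv
  rw [hderiv.fderiv]
  simp

theorem hasSymplecticEquation_of_half_norm_sq {Ω S : Set (Ambient n)} {f : Ambient n → ℂ}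
    {L L' : Ambient n →L[ℝ] ℂ} {R : ℝ} (hΩ : IsOpen Ω) (hf : ContDiffOn ℝ ∞ f Ω)
    (hS : S = {x | x ∈ Ω ∧ f x = 0 ∧ ‖L x‖ ^ 2 / 2 ≤ R ∧ ‖L' x‖ ^ 2 / 2 ≤ R}) (hR : 0 < R)
    {q : Ambient n} (hq : q ∈ Ω) (hq' : ‖L' q‖ ^ 2 / 2 < R) (hp : poisson (logForm f q) ≠ 0)
    (hb : ‖L q‖ ^ 2 / 2 = R → ∃ ξ, fderiv ℝ f q ξ = 0 ∧ L ξ = -L q) :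
    HasSymplecticEquation S q f := by
  refine ⟨Ω ∩ {x | ‖L' x‖ ^ 2 / 2 < R}, fun x => ‖L x‖ ^ 2 / 2 - R,
    hΩ.inter (isOpen_lt (by fun_prop) continuous_const), ⟨hq, hq'⟩, hf.mono inter_subset_left,
    (((L.contDiff.norm_sq ℝ).div_const 2).sub contDiff_const).contDiffOn, ?_, hp, fun hqR => ?_⟩
  · ext x
    rw [hS]
    constructor
    · rintro ⟨⟨-, hfx, hL, -⟩, hx⟩
      exact ⟨hx, hfx, sub_nonpos.2 hL⟩
    · rintro ⟨hx, hfx, hL⟩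
      exact ⟨⟨hx.1, hfx, sub_nonpos.1 hL, (show _ < _ from hx.2).le⟩, hx⟩
  · have hqR : ‖L q‖ ^ 2 / 2 = R := sub_eq_zero.1 hqR
    obtain ⟨ξ, hξ, hLξ⟩ := hb hqR
    refine ⟨ξ, hξ, ?_⟩
    rw [fderiv_half_norm_sq_sub, hLξ, inner_neg_right, real_inner_self_eq_norm_sq]
    linarith

theorem fderiv_family_of_eventuallyEq_zero {G N : Ambient n → ℂ} {q : Ambient n}
    (hN : N =ᶠ[nhds q] 0) (s : ℝ) : fderiv ℝ (family G N s) q = fderiv ℝ G q :=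
  Filter.EventuallyEq.fderiv_eq (hN.mono fun x hx => by simp [family, hx])

-- Infinitesimal form of the symmetry `(z, u, v) ↦ (z, e⁻ᶜ u, eᶜ v)` of `uv = W(z)`.
theorem fderiv_mirrorFun_rotation (j : Fin p) {q : Ambient n} (hq : q ∈ space n) (c : ℂ) :
    fderiv ℝ (mirrorFun fan lam t) q (0, -(c * q.2.1), c * q.2.2) = 0 := by
  have htwist : twist q (0, -(c * q.2.1), c * q.2.2) = (0, -(c * q.2.1), c * q.2.2) := by
    rw [twist_apply]; simp
  rw [← htwist]
  change logForm (mirrorFun fan lam t) q _ = 0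
  rw [logForm_mirrorFun fan lam t j hq, logForm_tail fan lam t j hq, sub_apply, complexForm_apply]
  simp [leadCoeff, rayForm_apply, sum_apply]
  ring

theorem half_sq_lt_of_mul_le {a b B R : ℝ} (ha : 0 ≤ a) (hb : 0 ≤ b) (haR : a ^ 2 / 2 = R)
    (hab : a * b ≤ B) (hB : B < 2 * R) : b ^ 2 / 2 < R := by
  by_contra! hR
  have hle : a ≤ b := (sq_le_sq₀ ha hb).1 (by linarith)
  nlinarith

theorem isOpen_logMapT_preimage {U : Set (Fin n → ℝ)} (hU : IsOpen U) :
    IsOpen {q : Ambient n | q ∈ space n ∧ logMapT t q.1 ∈ U} :=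
  ((contDiffOn_logMapT t).continuousOn.comp continuous_fst.continuousOn
    fun _ hq => hq).isOpen_inter_preimage isOpen_space hU

theorem isSymplecticSubmanifold_family (j : Fin p) (ht : Real.log t ≠ 0)
    {N : Ambient n → ℂ} (hN : ContDiff ℝ ∞ N) {U : Set (Fin n → ℝ)} (hU : IsOpen U)
    {R R' B : ℝ} (hBR : B < 2 * R) (hR : R' < R) (hN₀ : ∀ q : Ambient n, q.2 ∉ bidisc R' → N q = 0)
    {s : ℝ} (h : ∀ q ∈ space n, logMapT t q.1 ∈ U → family (mirrorFun fan lam t) N s q = 0 →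
      poisson (logForm (family (mirrorFun fan lam t) N s) q) ≠ 0 ∧ ‖q.2.1‖ * ‖q.2.2‖ ≤ B) :
    IsSymplecticSubmanifold
      ({q | q ∈ space n ∧ family (mirrorFun fan lam t) N s q = 0} ∩ box t R U) := by
  set F := family (mirrorFun fan lam t) N s
  set S := {q | q ∈ space n ∧ F q = 0} ∩ box t R U with hS_def
  have hF : ContDiffOn ℝ ∞ F (space n) :=
    (contDiffOn_mirrorFun fan lam t).add (contDiffOn_const.mul hN.contDiffOn)
  set Ω := {q : Ambient n | q ∈ space n ∧ logMapT t q.1 ∈ U}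
  have hΩ : IsOpen Ω := isOpen_logMapT_preimage hU
  have hFΩ : ContDiffOn ℝ ∞ F Ω := hF.mono fun _ hx => hx.1
  let pr : Ambient n →L[ℝ] ℂ × ℂ := .snd ℝ _ _
  let u : Ambient n →L[ℝ] ℂ := .fst ℝ ℂ ℂ ∘L pr
  let v : Ambient n →L[ℝ] ℂ := .snd ℝ ℂ ℂ ∘L pr
  have hS : S = {x | x ∈ Ω ∧ F x = 0 ∧ ‖u x‖ ^ 2 / 2 ≤ R ∧ ‖v x‖ ^ 2 / 2 ≤ R} := by
    ext x
    rw [hS_def, mem_inter_iff, mem_box ht]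
    exact ⟨fun hx => ⟨⟨hx.1.1, hx.2.2.1⟩, hx.1.2, hx.2.2.2⟩,
      fun hx => ⟨⟨hx.1.1, hx.2.1⟩, hx.1.1, hx.1.2, hx.2.2⟩⟩
  have hS' : S = {x | x ∈ Ω ∧ F x = 0 ∧ ‖v x‖ ^ 2 / 2 ≤ R ∧ ‖u x‖ ^ 2 / 2 ≤ R} := by
    simp only [hS, and_comm (a := ‖u _‖ ^ 2 / 2 ≤ R)]
  refine isSymplecticSubmanifold_of_hasSymplecticEquation fun q hq => ?_
  obtain ⟨hqΩ, hFq, hu, -⟩ := hS ▸ hq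
  obtain ⟨hp, hB⟩ := h q hqΩ.1 hqΩ.2 hFq
  have hR₀ : 0 < R := by linarith [mul_nonneg (norm_nonneg q.2.1) (norm_nonneg q.2.2)]
  have hrot : q.2 ∉ bidisc R' → ∀ c : ℂ, fderiv ℝ F q (0, -(c * q.2.1), c * q.2.2) = 0 := by
    intro hqR' c
    have hN_zero : N =ᶠ[nhds q] 0 := Filter.eventually_of_mem
      (((isClosed_bidisc R').isOpen_compl.preimage continuous_snd).mem_nhds hqR') hN₀
    rw [fderiv_family_of_eventuallyEq_zero hN_zero, fderiv_mirrorFun_rotation j hqΩ.1]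
  refine ⟨hqΩ.1, F, ?_⟩
  rcases hu.lt_or_eq with hu | hu
  · refine hasSymplecticEquation_of_half_norm_sq hΩ hFΩ hS' hR₀ hqΩ hu hp fun hv => ?_
    exact ⟨_, hrot (fun hqR' => (hqR'.2.trans_lt hR).ne hv) (-1), by simp [v, pr]⟩
  · have hv : ‖v q‖ ^ 2 / 2 < R := half_sq_lt_of_mul_le (norm_nonneg _) (norm_nonneg _) hu hB hBR
    refine hasSymplecticEquation_of_half_norm_sq hΩ hFΩ hS hR₀ hqΩ hv hp fun _ => ?_
    exact ⟨_, hrot (fun hqR' => (hqR'.1.trans_lt hR).ne hu) 1, by simp [u, pr]⟩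

end Submanifold

/-! ### The equation `exp ζ = 1 + r` with a small right hand side -/

section ExpEquation

open Function
open scoped Topology

theorem exists_continuousOn_fixedPoint {X E : Type*} [TopologicalSpace X] [MetricSpace E]
    {S : Set X} {D : Set E} (hD : IsComplete D) (hD₀ : D.Nonempty) {K : NNReal} (hK : K < 1)
    {f : X → E → E} (hmaps : ∀ θ ∈ S, MapsTo (f θ) D D)
    (hlip : ∀ θ ∈ S, LipschitzOnWith K (f θ) D)
    (hcont : ∀ a ∈ D, ContinuousOn (fun θ => f θ a) S) :
    ∃ ζ : X → E, ContinuousOn ζ S ∧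
      ∀ θ ∈ S, ζ θ ∈ D ∧ ∀ a ∈ D, IsFixedPt (f θ) a ↔ a = ζ θ := by
  obtain ⟨x, hx⟩ := hD₀
  have : Nonempty E := ⟨x⟩
  have hK' : 0 < 1 - (K : ℝ) := sub_pos.2 (by exact_mod_cast hK)
  have hdist : ∀ θ ∈ S, ∀ a ∈ D, IsFixedPt (f θ) a → ∀ b ∈ D,
      dist a b ≤ dist (f θ b) b / (1 - K) := fun θ hθ a ha hfix b hb => by
    rw [le_div_iff₀ hK']
    have hab := (hlip θ hθ).dist_le_mul a ha b hb
    rw [hfix.eq] at hab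
    linarith [dist_triangle a (f θ b) b]
  have hexists : ∀ θ ∈ S, ∃ a ∈ D, IsFixedPt (f θ) a := fun θ hθ => by
    obtain ⟨a, ha, hfix, -⟩ := ContractingWith.exists_fixedPoint' hD (hmaps θ hθ)
      ⟨hK, (hlip θ hθ).mapsToRestrict (hmaps θ hθ)⟩ hx (edist_ne_top _ _)
    exact ⟨a, ha, hfix⟩
  choose! ζ hζD hζ using hexists
  refine ⟨ζ, fun θ₀ hθ₀ => ?_, fun θ hθ => ⟨hζD θ hθ, fun a ha => ⟨fun hfix => ?_, ?_⟩⟩⟩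
  · have htendsto : Filter.Tendsto (fun θ => dist (f θ (ζ θ₀)) (ζ θ₀) / (1 - K)) (𝓝[S] θ₀)
        (𝓝 0) := by
      simpa [(hζ θ₀ hθ₀).eq] using
        ((hcont _ (hζD θ₀ hθ₀) θ₀ hθ₀).dist (tendsto_const_nhds (x := ζ θ₀))).div_const
          (1 - (K : ℝ))
    exact tendsto_iff_dist_tendsto_zero.2 (squeeze_zero'
      (Filter.Eventually.of_forall fun _ => dist_nonneg)
      (Filter.eventually_of_mem self_mem_nhdsWithin fun θ hθ =>
        hdist θ hθ _ (hζD θ hθ) (hζ θ hθ) _ (hζD θ₀ hθ₀)) htendsto)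
  · refine dist_le_zero.1 ((hdist θ hθ a ha hfix _ (hζD θ hθ)).trans_eq ?_)
    rw [(hζ θ hθ).eq, dist_self, zero_div]
  · rintro rfl
    exact hζ θ hθ

theorem norm_sub_exp_sub_le {a b : ℂ} (ha : a ∈ Metric.closedBall (0 : ℂ) (1 / 8))
    (hb : b ∈ Metric.closedBall (0 : ℂ) (1 / 8)) :
    ‖(a - Complex.exp a) - (b - Complex.exp b)‖ ≤ 1 / 4 * ‖a - b‖ := by
  refine (convex_closedBall (0 : ℂ) (1 / 8)).norm_image_sub_le_of_norm_hasDerivWithin_le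
    (f := fun z => z - Complex.exp z) (f' := fun z => 1 - Complex.exp z) (fun z _ =>
      ((hasDerivAt_id z).sub (Complex.hasDerivAt_exp z)).hasDerivWithinAt) (fun z hz => ?_) hb ha
  rw [mem_closedBall_zero_iff] at hz
  rw [norm_sub_rev]
  have hexp := Complex.norm_exp_sub_one_le (x := z) (by linarith)
  linarith

theorem exists_continuousOn_exp_eq_one_add {X : Type*} [TopologicalSpace X] {S : Set X}
    {r : X → ℂ → ℂ}
    (hcont : ∀ ζ ∈ Metric.closedBall (0 : ℂ) (1 / 8), ContinuousOn (fun θ => r θ ζ) S)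
    (hsmall : ∀ θ ∈ S, ‖r θ 0‖ ≤ 1 / 16)
    (hlip : ∀ θ ∈ S, LipschitzOnWith (1 / 4) (r θ) (Metric.closedBall 0 (1 / 8))) :
    ∃ ζ : X → ℂ, ContinuousOn ζ S ∧ ∀ θ ∈ S, ‖ζ θ‖ ≤ 1 / 8 ∧
      ∀ a, ‖a‖ ≤ 1 / 8 → (Complex.exp a = 1 + r θ a ↔ a = ζ θ) := by
  -- The solutions are the fixed points of `a ↦ (a - exp a) + (1 + r θ a)`.
  let f : X → ℂ → ℂ := fun θ a => (a - Complex.exp a) + (1 + r θ a)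
  have hf : ∀ θ ∈ S, LipschitzOnWith (1 / 2) (f θ) (Metric.closedBall 0 (1 / 8)) :=
    fun θ hθ => LipschitzOnWith.of_dist_le_mul fun a ha b hb => by
      have hr := (hlip θ hθ).dist_le_mul a ha b hb
      have hexp := norm_sub_exp_sub_le ha hb
      have hadd := dist_add_add_le (a - Complex.exp a) (1 + r θ a) (b - Complex.exp b) (1 + r θ b)
      rw [dist_add_left, dist_eq_norm (a - Complex.exp a)] at hadd
      rw [dist_eq_norm a b] at hr ⊢
      push_cast at hr ⊢
      linarith
  have hmaps : ∀ θ ∈ S, MapsTo (f θ) (Metric.closedBall 0 (1 / 8)) (Metric.closedBall 0 (1 / 8)) :=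
    fun θ hθ a ha => by
      have hdist := (hf θ hθ).dist_le_mul a ha 0 (Metric.mem_closedBall_self (by norm_num))
      have hzero : ‖f θ 0‖ ≤ 1 / 16 := by simpa [f] using hsmall θ hθ
      rw [mem_closedBall_zero_iff] at ha ⊢
      rw [dist_zero_right, dist_eq_norm] at hdist
      push_cast at hdist
      linarith [norm_le_norm_add_norm_sub' (f θ a) (f θ 0)]
  obtain ⟨ζ, hζ, hfix⟩ := exists_continuousOn_fixedPoint Metric.isClosed_closedBall.isComplete
    ⟨0, Metric.mem_closedBall_self (by norm_num)⟩ (by rw [← NNReal.coe_lt_coe]; norm_num)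
    hmaps hf fun a ha => continuousOn_const.add (continuousOn_const.add (hcont a ha))
  refine ⟨ζ, hζ, fun θ hθ => ⟨mem_closedBall_zero_iff.1 (hfix θ hθ).1, fun a ha => ?_⟩⟩
  rw [← (hfix θ hθ).2 a (mem_closedBall_zero_iff.2 ha), IsFixedPt]
  constructor <;> intro h <;> linear_combination -h

end ExpEquation

/-! ### The amoeba near a facet -/

theorem logCurve_logCurve {n : ℕ} (q ξ : Ambient n) (s s' : ℝ) :
    logCurve (logCurve q ξ s) ξ s' = logCurve q ξ (s + s') := by
  refine Prod.ext (funext fun i => ?_) ?_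
  · simp only [logCurve]
    rw [mul_assoc, ← Complex.exp_add]
    push_cast
    ring_nf
  · simp only [logCurve, add_smul, add_assoc]

theorem norm_logCurve_sub_le {n : ℕ} {F : Ambient n → ℂ}
    (hF : ∀ q ∈ space n, DifferentiableAt ℝ F q) {q ξ : Ambient n} (hq : q ∈ space n) {M : ℝ}
    (hM : ∀ s ∈ Icc (0 : ℝ) 1, ‖logForm F (logCurve q ξ s)‖ ≤ M) :
    ‖F (logCurve q ξ 1) - F q‖ ≤ M * ‖ξ‖ := by
  have hderiv : ∀ s : ℝ, HasDerivAt (fun s => F (logCurve q ξ s))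
      (logForm F (logCurve q ξ s) ξ) s := fun s => by
    have hzero := hasDerivAt_comp_logCurve (hF _ (logCurve_mem_space hq ξ s)) ξ
    simp only [logCurve_logCurve] at hzero
    simpa using HasDerivAt.comp_sub_const s s (by rwa [sub_self])
      (f := fun s' => F (logCurve q ξ (s + s')))
  have hbound := norm_image_sub_le_of_norm_deriv_le_segment_01' (f := fun s => F (logCurve q ξ s))
    (fun s _ => (hderiv s).hasDerivWithinAt) (C := M * ‖ξ‖) fun s hs =>
      ContinuousLinearMap.le_of_opNorm_le _ (hM s ⟨hs.1, hs.2.le⟩) ξ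
  simpa only [logCurve_zero] using hbound

section Amoeba

variable {n p : ℕ} {fan : SmoothCompleteFan n p} {lam : Fin p → ℝ} {t : ℝ} {j : Fin p}

theorem term_exp (ht : 0 < t) (k : Fin p) (w : Fin n → ℂ) :
    term fan lam t k (fun i => Complex.exp (w i)) =
      Complex.exp (Real.log t * lam k + ∑ i, (fan.ray k i : ℂ) * w i) := by
  have h := term_mul_exp fan lam t k (fun _ => 1) w
  simp only [one_mul] at h
  rw [h, term, Real.rpow_def_of_pos ht, Complex.exp_add]
  simp

variable (fan t j) in
/-- The point with `u = v = 0` over the line `x + ℝ v_j` whose logarithmic coordinates are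
`log t · x + iθ + ζ v_j / ‖v_j‖²`, so that `ζ` multiplies the monomial `z^{v_j}` by `e^ζ`. -/
def linePoint (x θ : Fin n → ℝ) (ζ : ℂ) : Ambient n :=
  (fun i => Complex.exp (Real.log t * x i + θ i * Complex.I + ζ * (realRay fan j i / raySq fan j)),
    0, 0)

theorem linePoint_mem_space (x θ : Fin n → ℝ) (ζ : ℂ) : linePoint fan t j x θ ζ ∈ space n :=
  fun _ => Complex.exp_ne_zero _

theorem continuous_linePoint (x : Fin n → ℝ) (ζ : ℂ) :
    Continuous fun θ => linePoint fan t j x θ ζ := by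
  unfold linePoint
  fun_prop

theorem logMapT_linePoint (hlog : Real.log t ≠ 0) (x θ : Fin n → ℝ) (ζ : ℂ) :
    logMapT t (linePoint fan t j x θ ζ).1 =
      x + (ζ.re / (raySq fan j * Real.log t)) • realRay fan j := by
  have hr := (raySq_pos fan j).ne'
  funext i
  have hre : (ζ * ((realRay fan j i : ℂ) / (raySq fan j : ℂ))).re =
      ζ.re * (realRay fan j i / raySq fan j) := by
    rw [← Complex.ofReal_div, Complex.re_mul_ofReal]
  simp only [logMapT, logMap, linePoint, Pi.smul_apply, Pi.add_apply, smul_eq_mul,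
    Complex.norm_exp, Real.log_exp, Complex.add_re, hre, Complex.re_ofReal_mul, Complex.ofReal_re,
    Complex.I_re, mul_zero, add_zero]
  field_simp

theorem term_linePoint (ht : 0 < t) (x θ : Fin n → ℝ) (ζ : ℂ) :
    term fan lam t j (linePoint fan t j x θ ζ).1 = Complex.exp
      (Real.log t * chi fan lam j x + pairing (fan.ray j) θ * Complex.I + ζ) := by
  have hr : (raySq fan j : ℂ) ≠ 0 := by exact_mod_cast (raySq_pos fan j).ne'
  have hsum : ∑ i, (fan.ray j i : ℂ) * (Real.log t * x i + θ i * Complex.I +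
      ζ * (realRay fan j i / raySq fan j)) = Real.log t * (pairing (fan.ray j) x : ℝ) +
        (pairing (fan.ray j) θ : ℝ) * Complex.I +
          ζ * ((pairing (fan.ray j) (realRay fan j) : ℝ) / raySq fan j) := by
    simp only [pairing, Complex.ofReal_sum, Complex.ofReal_mul, Complex.ofReal_intCast,
      Finset.mul_sum, Finset.sum_mul, Finset.sum_div, ← Finset.sum_add_distrib]
    exact Finset.sum_congr rfl fun i _ => by ring
  simp only [linePoint]
  rw [term_exp ht, hsum, pairing_realRay, div_self hr, chi]
  push_cast
  ring_nf

theorem linePoint_eq_logCurve (x θ : Fin n → ℝ) (ζ w : ℂ) (s : ℝ) :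
    linePoint fan t j x θ (ζ + s * w) = logCurve (linePoint fan t j x θ ζ)
      (fun i => w * (realRay fan j i / raySq fan j), 0, 0) s := by
  refine Prod.ext (funext fun i => ?_) ?_
  · simp only [linePoint, logCurve, ← Complex.exp_add]
    ring_nf
  · simp [linePoint, logCurve]

theorem linePoint_sub_smul_realRay (x θ : Fin n → ℝ) (ζ : ℂ) (c : ℝ) :
    linePoint fan t j x (θ - (c / raySq fan j) • realRay fan j) (ζ + c * Complex.I) =
      linePoint fan t j x θ ζ := by
  refine Prod.ext (funext fun i => ?_) rfl
  simp only [linePoint, Pi.sub_apply, Pi.smul_apply, smul_eq_mul]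
  push_cast
  ring_nf

theorem linePoint_sub_two_pi_smul (x θ : Fin n → ℝ) (ζ : ℂ) (l : Fin n → ℤ) :
    linePoint fan t j x (θ - (2 * Real.pi) • fun i => (l i : ℝ)) ζ = linePoint fan t j x θ ζ := by
  refine Prod.ext (funext fun i => ?_) rfl
  simp only [linePoint, Pi.sub_apply, Pi.smul_apply, smul_eq_mul]
  refine Complex.exp_eq_exp_iff_exists_int.2 ⟨-l i, ?_⟩
  push_cast
  ring

theorem eq_linePoint_arg (hlog : Real.log t ≠ 0) {x : Fin n → ℝ} {z : Fin n → ℂ}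
    (hz : z ∈ torus n) {s : ℝ} (hs : logMapT t z = x + s • realRay fan j) :
    ((z, 0, 0) : Ambient n) =
      linePoint fan t j x (fun i => (z i).arg) (Real.log t * s * raySq fan j : ℝ) := by
  have hr : (raySq fan j : ℂ) ≠ 0 := by exact_mod_cast (raySq_pos fan j).ne'
  refine Prod.ext (funext fun i => ?_) rfl
  have hnorm := norm_eq_exp_logMapT hlog hz i
  rw [hs, Pi.add_apply, Pi.smul_apply, smul_eq_mul] at hnorm
  refine (Complex.norm_mul_exp_arg_mul_I (z i)).symm.trans ?_
  simp only [linePoint]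
  rw [hnorm, Complex.ofReal_exp, ← Complex.exp_add]
  push_cast
  field_simp
  ring_nf

theorem exists_eq_linePoint (ht : 0 < t) (hlog : Real.log t ≠ 0) {x : Fin n → ℝ}
    (hx : chi fan lam j x = 0) {z : Fin n → ℂ} (hz : z ∈ torus n)
    (hline : logMapT t z ∈ rayLine fan j x) {ζ : ℂ} (hζ : term fan lam t j z = -Complex.exp ζ) :
    ∃ θ, pairing (fan.ray j) θ = Real.pi ∧ ((z, 0, 0) : Ambient n) = linePoint fan t j x θ ζ := by
  obtain ⟨s, hs⟩ := hline
  obtain ⟨l, hl⟩ := fan.exists_sum_ray_mul_eq_one j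
  set a : ℝ := Real.log t * s * raySq fan j
  set θ₀ : Fin n → ℝ := fun i => (z i).arg
  have hz₀ : ((z, 0, 0) : Ambient n) = linePoint fan t j x θ₀ a := eq_linePoint_arg hlog hz hs
  have hexp : Complex.exp (pairing (fan.ray j) θ₀ * Complex.I + a) =
      Complex.exp (ζ + Real.pi * Complex.I) := by
    have hterm := term_linePoint (fan := fan) (lam := lam) (j := j) ht x θ₀ a
    rw [← hz₀, hζ, hx, Complex.ofReal_zero, mul_zero, zero_add] at hterm
    rw [← hterm, Complex.exp_add, Complex.exp_pi_mul_I, mul_neg_one]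
  obtain ⟨m, hm⟩ := Complex.exp_eq_exp_iff_exists_int.1 hexp
  have hre : a = ζ.re := by simpa using congrArg Complex.re hm
  have him : pairing (fan.ray j) θ₀ = ζ.im + Real.pi + m * (2 * Real.pi) := by
    simpa using congrArg Complex.im hm
  -- Moving `ζ.im` from the angles to `ζ` leaves a multiple of `2π`, removed by the lattice vector.
  refine ⟨θ₀ - (ζ.im / raySq fan j) • realRay fan j - (2 * Real.pi) • fun i => ((m * l i : ℤ) : ℝ),
    ?_, ?_⟩
  · have hml : ∑ i, fan.ray j i * (m * l i) = m := by
      simp only [mul_left_comm _ m, ← Finset.mul_sum, hl, mul_one]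
    rw [sub_eq_add_neg, ← neg_smul, sub_eq_add_neg, ← neg_smul, pairing_add, pairing_add,
      pairing_smul, pairing_smul, pairing_realRay, pairing_intCast, hml, him, neg_mul,
      div_mul_cancel₀ _ (raySq_pos fan j).ne']
    ring
  · rw [linePoint_sub_two_pi_smul, hz₀, ← Complex.re_add_im ζ, ← hre, Complex.add_im]
    simp [linePoint_sub_smul_realRay]

theorem abs_realRay_div_le (i : Fin n) : |realRay fan j i / raySq fan j| ≤ 1 := by
  have hle_sq : |realRay fan j i| ≤ realRay fan j i ^ 2 := by
    simp only [realRay]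
    exact_mod_cast (Int.abs_eq_natAbs _).trans_le (Int.natAbs_le_self_sq (fan.ray j i))
  have hsq_le : realRay fan j i ^ 2 ≤ raySq fan j :=
    Finset.single_le_sum (f := fun i => (fan.ray j i : ℝ) ^ 2)
      (fun i _ => sq_nonneg _) (Finset.mem_univ i)
  rw [abs_div, abs_of_pos (raySq_pos fan j)]
  exact div_le_one_of_le₀ (hle_sq.trans hsq_le) (raySq_pos fan j).le

theorem isConnected_setOf_pairing_ray_eq (fan : SmoothCompleteFan n p) (j : Fin p) (c : ℝ) :
    IsConnected {θ | pairing (fan.ray j) θ = c} := by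
  refine ⟨⟨(c / raySq fan j) • realRay fan j, ?_⟩, Convex.isPreconnected ?_⟩
  · rw [mem_ofPred_eq, pairing_smul, pairing_realRay, div_mul_cancel₀ _ (raySq_pos fan j).ne']
  · intro a (ha : _ = _) b (hb : _ = _) u v _ _ huv
    rw [mem_ofPred_eq, pairing_add, pairing_smul, pairing_smul, ha, hb, ← add_mul, huv, one_mul]

section RayLine

variable {x : Fin n → ℝ} {U : Set (Fin n → ℝ)} {F : Ambient n → ℂ}

theorem logMapT_linePoint_mem (hlog : Real.log t ≠ 0)
    (hU : ∀ s : ℝ, |s| * raySq fan j * |Real.log t| ≤ 1 / 8 → x + s • realRay fan j ∈ U)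
    (θ : Fin n → ℝ) {ζ : ℂ} (hζ : ‖ζ‖ ≤ 1 / 8) : logMapT t (linePoint fan t j x θ ζ).1 ∈ U := by
  rw [logMapT_linePoint hlog]
  refine hU _ (le_of_eq_of_le ?_ ((Complex.abs_re_le_norm ζ).trans hζ))
  have hr := (raySq_pos fan j).ne'
  have hlog' := abs_ne_zero.2 hlog
  rw [abs_div, abs_mul, abs_of_pos (raySq_pos fan j)]
  field_simp

theorem lipschitzOnWith_comp_linePoint (hlog : Real.log t ≠ 0)
    (hU : ∀ s : ℝ, |s| * raySq fan j * |Real.log t| ≤ 1 / 8 → x + s • realRay fan j ∈ U)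
    (hF : ∀ q ∈ space n, DifferentiableAt ℝ F q) {M : NNReal}
    (hM : ∀ q ∈ space n, logMapT t q.1 ∈ U → ‖logForm F q‖ ≤ M) (θ : Fin n → ℝ) :
    LipschitzOnWith M (fun ζ => F (linePoint fan t j x θ ζ)) (Metric.closedBall 0 (1 / 8)) := by
  refine LipschitzOnWith.of_dist_le_mul fun a ha b hb => ?_
  let ξ : Ambient n := (fun i => (a - b) * (realRay fan j i / raySq fan j), 0, 0)
  have hξ : ‖ξ‖ ≤ ‖a - b‖ := by
    refine norm_prod_le_iff.2
      ⟨(pi_norm_le_iff_of_nonneg (norm_nonneg _)).2 fun i => ?_, by simp [ξ]⟩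
    rw [norm_mul, ← Complex.ofReal_div, Complex.norm_real, Real.norm_eq_abs]
    exact mul_le_of_le_one_right (norm_nonneg _) (abs_realRay_div_le i)
  have hsegment : ∀ s ∈ Icc (0 : ℝ) 1,
      ‖logForm F (logCurve (linePoint fan t j x θ b) ξ s)‖ ≤ M := fun s hs => by
    have hmem := (convex_closedBall (0 : ℂ) (1 / 8)).add_smul_sub_mem hb ha hs
    rw [mem_closedBall_zero_iff, Complex.real_smul] at hmem
    rw [← linePoint_eq_logCurve]
    exact hM _ (linePoint_mem_space x θ _) (logMapT_linePoint_mem hlog hU θ hmem)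
  have hbound := norm_logCurve_sub_le hF (linePoint_mem_space x θ b) hsegment
  rw [← linePoint_eq_logCurve, Complex.ofReal_one, one_mul, add_sub_cancel] at hbound
  rw [dist_eq_norm, dist_eq_norm]
  exact hbound.trans (mul_le_mul_of_nonneg_left hξ M.2)

theorem exists_norm_le_exp_eq_one_add {w : ℂ} (hw : ‖w‖ ≤ 1 / 16) :
    ∃ a : ℂ, ‖a‖ ≤ 1 / 8 ∧ Complex.exp a = 1 + w := by
  refine ⟨Complex.log (1 + w), ?_, Complex.exp_log fun h => ?_⟩
  · linarith [Complex.norm_log_one_add_half_le_self (z := w) (by linarith)]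
  · rw [eq_neg_of_add_eq_zero_right h, norm_neg, norm_one] at hw
    norm_num at hw

theorem rayLine_inter_amoebaOf_eq_image (ht : 0 < t) (hlog : Real.log t ≠ 0)
    (hx : chi fan lam j x = 0)
    (hU : ∀ s : ℝ, |s| * raySq fan j * |Real.log t| ≤ 1 / 8 → x + s • realRay fan j ∈ U)
    (hF : ∀ q ∈ space n, logMapT t q.1 ∈ U → ‖F q‖ ≤ 1 / 16) {S : Set (Ambient n)}
    (hS : ∀ z ∈ torus n, ((z, 0, 0) : Ambient n) ∈ S ↔
      logMapT t z ∈ U ∧ 1 + term fan lam t j z + F (z, 0, 0) = 0) {ζ : (Fin n → ℝ) → ℂ}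
    (hζ : ∀ θ, pairing (fan.ray j) θ = Real.pi → ‖ζ θ‖ ≤ 1 / 8 ∧ ∀ a, ‖a‖ ≤ 1 / 8 →
      (Complex.exp a = 1 + F (linePoint fan t j x θ a) ↔ a = ζ θ)) :
    rayLine fan j x ∩ amoebaOf t S =
      (fun θ => logMapT t (linePoint fan t j x θ (ζ θ)).1) ''
        {θ | pairing (fan.ray j) θ = Real.pi} := by
  refine Subset.antisymm ?_ ?_
  · rintro _ ⟨hline, z, ⟨hz, hzS⟩, rfl⟩
    obtain ⟨hzU, heq⟩ := (hS z hz).1 hzS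
    obtain ⟨a, ha, hexp⟩ := exists_norm_le_exp_eq_one_add (hF (z, 0, 0) hz hzU)
    obtain ⟨θ, hθ, hzθ⟩ := exists_eq_linePoint ht hlog hx hz hline (ζ := a)
      (by rw [hexp]; linear_combination heq)
    refine ⟨θ, hθ, ?_⟩
    rw [hzθ] at hexp
    simp only [← ((hζ θ hθ).2 a ha).1 hexp, ← hzθ]
  · rintro _ ⟨θ, hθ, rfl⟩
    obtain ⟨hsmall, hiff⟩ := hζ θ hθ
    have hterm : term fan lam t j (linePoint fan t j x θ (ζ θ)).1 = -Complex.exp (ζ θ) := by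
      rw [term_linePoint ht, hx, hθ, Complex.ofReal_zero, mul_zero, zero_add, Complex.exp_add,
        Complex.exp_pi_mul_I, neg_one_mul]
    refine ⟨⟨_, logMapT_linePoint hlog x θ _⟩, _, ⟨linePoint_mem_space x θ _, ?_⟩, rfl⟩
    refine (hS _ (linePoint_mem_space x θ _)).2 ⟨logMapT_linePoint_mem hlog hU θ hsmall, ?_⟩
    rw [hterm, (hiff _ hsmall).2 rfl, linePoint]
    ring

theorem isConnected_rayLine_inter_amoebaOf (ht : 0 < t) (hlog : Real.log t ≠ 0)
    (hx : chi fan lam j x = 0)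
    (hU : ∀ s : ℝ, |s| * raySq fan j * |Real.log t| ≤ 1 / 8 → x + s • realRay fan j ∈ U)
    (hF : ∀ q ∈ space n, DifferentiableAt ℝ F q)
    (hF_small : ∀ q ∈ space n, logMapT t q.1 ∈ U → ‖F q‖ ≤ 1 / 16)
    (hlogForm_small : ∀ q ∈ space n, logMapT t q.1 ∈ U → ‖logForm F q‖ ≤ 1 / 4)
    {S : Set (Ambient n)}
    (hS : ∀ z ∈ torus n, ((z, 0, 0) : Ambient n) ∈ S ↔
      logMapT t z ∈ U ∧ 1 + term fan lam t j z + F (z, 0, 0) = 0) :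
    IsConnected (rayLine fan j x ∩ amoebaOf t S) := by
  -- Over the line the equation of `S` becomes `exp ζ = 1 + F`, one small solution for each `θ`.
  obtain ⟨ζ, hζ_cont, hζ⟩ := exists_continuousOn_exp_eq_one_add
    (S := {θ | pairing (fan.ray j) θ = Real.pi}) (r := fun θ a => F (linePoint fan t j x θ a))
    (fun a _ => Continuous.continuousOn <| continuous_iff_continuousAt.2 fun θ =>
      ContinuousAt.comp (f := fun θ => linePoint fan t j x θ a)
        (hF _ (linePoint_mem_space x θ a)).continuousAt (continuous_linePoint x a).continuousAt)
    (fun θ _ => hF_small _ (linePoint_mem_space x θ 0)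
      (logMapT_linePoint_mem hlog hU θ (by simp)))
    (fun θ _ => lipschitzOnWith_comp_linePoint hlog hU hF (by simpa using hlogForm_small) θ)
  rw [rayLine_inter_amoebaOf_eq_image ht hlog hx hU hF_small hS hζ]
  refine (isConnected_setOf_pairing_ray_eq fan j _).image _ ?_
  simp only [logMapT_linePoint hlog]
  exact continuousOn_const.add
    (((Complex.continuous_re.comp_continuousOn hζ_cont).div_const _).smul continuousOn_const)

end RayLine

end Amoeba

/-! ### Estimates near a facet -/

section Estimates

variable {n p : ℕ} {fan : SmoothCompleteFan n p} {lam : Fin p → ℝ} {t : ℝ} {j : Fin p}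

theorem hasSmallTail_of_norm_term_le {U : Set (Fin n → ℝ)} {e : ℝ} (he : 0 ≤ e)
    (h : ∀ z ∈ torus n, logMapT t z ∈ U → ∀ k, k ≠ j → ‖term fan lam t k z‖ ≤ e) :
    HasSmallTail fan lam t j U ((∑ k, (1 + ‖rayForm (fan.ray k)‖)) * e) := by
  have sum_le : ∀ {E : Type} [NormedAddCommGroup E] (a : Fin p → E),
      (∀ k, k ≠ j → ‖a k‖ ≤ (1 + ‖rayForm (fan.ray k)‖) * e) →
        ‖∑ k ∈ Finset.univ.erase j, a k‖ ≤ (∑ k, (1 + ‖rayForm (fan.ray k)‖)) * e := by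
    intro E _ a ha
    rw [Finset.sum_mul]
    exact (norm_sum_le_of_le _ fun k hk => ha k (Finset.ne_of_mem_erase hk)).trans
      (Finset.sum_le_sum_of_subset_of_nonneg (Finset.subset_univ _) fun k _ _ => by positivity)
  refine ⟨fun q hq hqU => sum_le _ fun k hk => ?_, fun q hq hqU => ?_⟩
  · nlinarith [h q.1 hq hqU k hk, norm_nonneg (rayForm (fan.ray k))]
  · rw [logForm_tail fan lam t j hq]
    refine sum_le _ fun k hk => ?_
    rw [norm_smul]
    nlinarith [h q.1 hq hqU k hk, norm_nonneg (rayForm (fan.ray k))]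

open scoped Topology in
theorem eventually_hasSmallTail {δ κ : ℝ} (hδ : 0 < δ) (hκ : 0 < κ) :
    ∀ᶠ t in 𝓝[>] (0 : ℝ), ∀ U : Set (Fin n → ℝ), (∀ x ∈ U, ∀ k, k ≠ j → δ ≤ chi fan lam k x) →
      HasSmallTail fan lam t j U κ := by
  have htendsto : Filter.Tendsto
      (fun t => (∑ k, (1 + ‖rayForm (fan.ray k)‖)) * Real.exp (Real.log t * δ)) (𝓝[>] 0) (𝓝 0) := by
    simpa using (Real.tendsto_exp_atBot.comp
      (Real.tendsto_log_nhdsGT_zero.atBot_mul_const hδ)).const_mul _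
  filter_upwards [htendsto.eventually_le_const hκ, self_mem_nhdsWithin,
    Real.tendsto_log_nhdsGT_zero.eventually_lt_atBot 0] with t hle ht hlog U hU
  have htail := hasSmallTail_of_norm_term_le (fan := fan) (lam := lam) (j := j) (U := U)
    (Real.exp_pos _).le fun z hz hzU k hk =>
      (norm_term fan lam ht hlog.ne k hz).trans_le
        (Real.exp_le_exp.2 (mul_le_mul_of_nonpos_left (hU _ hzU k hk) hlog.le))
  exact ⟨fun q hq hqU => (htail.norm_tail_le q hq hqU).trans hle,
    fun q hq hqU => (htail.norm_logForm_tail_le q hq hqU).trans hle⟩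

theorem continuous_chi (k : Fin p) : Continuous (chi fan lam k) :=
  continuous_const.add (continuous_pairing _)

theorem chi_eq_pairing_sub {x₀ : Fin n → ℝ} (hx₀ : chi fan lam j x₀ = 0) (x : Fin n → ℝ) :
    chi fan lam j x = pairing (fan.ray j) (x - x₀) := by
  have hadd := pairing_add (fan.ray j) (x - x₀) x₀
  rw [sub_add_cancel] at hadd
  rw [chi] at hx₀ ⊢
  linarith

theorem exists_isLUB_terms (ht : 0 < t) (hlog : Real.log t ≠ 0) {U : Set (Fin n → ℝ)}
    (hne : U.Nonempty) (hU : IsCompact (closure U)) :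
    ∃ B, IsLUB ((fun z => 1 + ∑ k, ‖term fan lam t k z‖) ''
      {z | z ∈ torus n ∧ logMapT t z ∈ U}) B := by
  let g (x : Fin n → ℝ) : ℝ := 1 + ∑ k, Real.exp (Real.log t * chi fan lam k x)
  have hg : Continuous g := continuous_const.add <| continuous_finsetSum _ fun k _ =>
    Real.continuous_exp.comp (continuous_const.mul (continuous_chi k))
  refine ⟨_, isLUB_csSup ?_ ((hU.image hg).bddAbove.mono ?_)⟩
  · obtain ⟨x, hx⟩ := hne
    have hone : ∀ i, ‖(1 : Fin n → ℂ) i‖ = 1 := fun _ => norm_one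
    refine ⟨_, (polar t (x, 1, 0)).1, ⟨polar_mem_space hone 0, ?_⟩, rfl⟩
    rwa [logMapT_polar hlog hone]
  · rintro _ ⟨z, ⟨hz, hzU⟩, rfl⟩
    refine ⟨_, subset_closure hzU, ?_⟩
    simp only [g, norm_term fan lam ht hlog _ hz]

open scoped Topology in
theorem exists_cyl_forall_le_chi {x₀ : Fin n → ℝ} (h : ∀ k, k ≠ j → 0 < chi fan lam k x₀) :
    ∃ δ > 0, ∃ r > 0, ∀ x ∈ cyl fan j x₀ r, ∀ k, k ≠ j → δ ≤ chi fan lam k x := by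
  have hlt : ∀ᶠ δ in 𝓝[>] (0 : ℝ), ∀ k, k ≠ j → δ < chi fan lam k x₀ :=
    Filter.eventually_all.2 fun k => Filter.eventually_imp_distrib_left.2 fun hk =>
      nhdsWithin_le_nhds (eventually_lt_nhds (h k hk))
  obtain ⟨δ, hδx₀, hδ⟩ := (hlt.and self_mem_nhdsWithin).exists
  have hle : ∀ᶠ x in 𝓝 x₀, ∀ k, k ≠ j → δ ≤ chi fan lam k x :=
    Filter.eventually_all.2 fun k => Filter.eventually_imp_distrib_left.2 fun hk =>
      (continuous_chi k).continuousAt.eventually_const_le (hδx₀ k hk)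
  obtain ⟨r, hr, hcyl⟩ := exists_cyl_subset fan j x₀ hle
  exact ⟨δ, hδ, r, hr, hcyl⟩

end Estimates

/-! ### Choice of the cutoff functions -/

section CutoffFunctions

theorem exists_isFiberCutoff_one_two : ∃ C θ, IsFiberCutoff 1 2 θ ∧ IsSmoothCutoff C θ := by
  have hu : Continuous fun w : ℂ × ℂ => ‖w.1‖ ^ 2 / 2 := by fun_prop
  have hv : Continuous fun w : ℂ × ℂ => ‖w.2‖ ^ 2 / 2 := by fun_prop
  obtain ⟨C, θ, hθ, hθ_one, hθ_zero⟩ := exists_isSmoothCutoff (isClosed_bidisc 1)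
    (K := bidisc 2) (O := {w : ℂ × ℂ | ‖w.1‖ ^ 2 / 2 < 2 ∧ ‖w.2‖ ^ 2 / 2 < 2})
    ((isOpen_lt hu continuous_const).inter (isOpen_lt hv continuous_const))
    (fun w hw => ⟨hw.1.trans_lt one_lt_two, hw.2.trans_lt one_lt_two⟩)
    (fun w hw => ⟨hw.1.le, hw.2.le⟩) (isCompact_bidisc 2)
  exact ⟨C, θ, ⟨hθ.smooth, hθ.mem_Icc, fun w hu hv => hθ_one w ⟨hu, hv⟩,
    fun w hw => hθ_zero w fun h => hw ⟨h.1.le, h.2.le⟩⟩, hθ⟩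

theorem IsFiberCutoff.comp_inv_sqrt_smul {θ : ℂ × ℂ → ℝ} {r r' : ℝ} (h : IsFiberCutoff r r' θ)
    {a : ℝ} (ha : 0 < a) : IsFiberCutoff (r * a) (r' * a) fun w => θ ((√a)⁻¹ • w) := by
  have hscale : ∀ (u : ℂ) (b : ℝ), ‖(√a)⁻¹ • u‖ ^ 2 / 2 ≤ b ↔ ‖u‖ ^ 2 / 2 ≤ b * a := by
    intro u b
    rw [norm_smul, mul_pow, norm_inv, Real.norm_of_nonneg (Real.sqrt_nonneg a), inv_pow,
      Real.sq_sqrt ha.le, mul_div_assoc, inv_mul_le_iff₀ ha, mul_comm a]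
  refine ⟨h.smooth.comp (contDiff_id.const_smul _), fun w => h.mem_Icc _,
    fun w hu hv => h.eq_one _ ((hscale _ _).2 hu) ((hscale _ _).2 hv),
    fun w hw => h.eq_zero _ ?_⟩
  rwa [Prod.smul_fst, Prod.smul_snd, hscale, hscale]

theorem IsFiberCutoff.eq_one_zero {τ : ℂ × ℂ → ℝ} {r r' : ℝ} (h : IsFiberCutoff r r' τ)
    (hr : 0 ≤ r) : τ 0 = 1 :=
  h.eq_one 0 (by simpa using hr) (by simpa using hr)

theorem exists_isFiberCutoff :
    ∃ C, ∀ a, 1 ≤ a → ∃ τ, IsFiberCutoff a (2 * a) τ ∧ IsSmoothCutoff C τ := by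
  obtain ⟨C, θ, hθ, hθ_smooth⟩ := exists_isFiberCutoff_one_two
  refine ⟨C, fun a ha => ⟨fun w => θ ((√a)⁻¹ • w), ?_, hθ_smooth.comp_smul ?_⟩⟩
  · simpa only [one_mul] using hθ.comp_inv_sqrt_smul (zero_lt_one.trans_le ha)
  · rw [abs_of_nonneg (inv_nonneg.2 (Real.sqrt_nonneg a))]
    exact inv_le_one_of_one_le₀ (Real.one_le_sqrt.2 ha)

variable {n p : ℕ}

theorem cyl_mono {fan : SmoothCompleteFan n p} {j : Fin p} {x₀ : Fin n → ℝ} {r r' : ℝ}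
    (h : r ≤ r') : cyl fan j x₀ r ⊆ cyl fan j x₀ r' :=
  fun _ hx => lt_of_lt_of_le hx h

theorem exists_isSmoothCutoff_cyl (fan : SmoothCompleteFan n p) (j : Fin p) (x₀ : Fin n → ℝ)
    {r r' : ℝ} (h : r < r') : ∃ C f, IsSmoothCutoff C f ∧ (∀ x ∈ cyl fan j x₀ r, f x = 1) ∧
      ∀ x, x ∉ cyl fan j x₀ r' → f x = 0 := by
  obtain ⟨C, f, hf, hf_one, hf_zero⟩ := exists_isSmoothCutoff isClosed_closure
    (isOpen_cyl fan j x₀ r') (relCompactIn_cyl fan j x₀ h).2 subset_closure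
    (relCompactIn_cyl fan j x₀ (lt_add_one r')).1
  exact ⟨C, f, hf, fun x hx => hf_one x (subset_closure hx), hf_zero⟩

theorem isBaseCutoff_baseCut {t C : ℝ} {f : (Fin n → ℝ) → ℝ} (hf : IsSmoothCutoff C f)
    {U' U'' : Set (Fin n → ℝ)} (hf_one : ∀ x ∈ U'', f x = 1) (hf_zero : ∀ x, x ∉ U' → f x = 0) :
    IsBaseCutoff t U'' U' (baseCut t f) where
  smooth := contDiffOn_baseCut t hf.smooth
  mem_Icc z _ := baseCut_mem_Icc hf.mem_Icc z
  eq_one _ hz hzU := (baseCut_of_mem t f hz).trans (hf_one _ hzU)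
  eq_zero _ hz hzU := (baseCut_of_mem t f hz).trans (hf_zero _ hzU)

end CutoffFunctions

/-! ### The simplified mirror -/

section SimplifiedMirror

variable {n p : ℕ} {fan : SmoothCompleteFan n p} {lam : Fin p → ℝ} {t : ℝ} {j : Fin p}

theorem cutMirror_inter_box_eq {τ : ℂ × ℂ → ℝ} {ρ : (Fin n → ℂ) → ℝ} {R R' R'' : ℝ}
    {U U' U'' : Set (Fin n → ℝ)} (hlog : Real.log t ≠ 0) (hR : R'' ≤ R) (hU : U'' ⊆ U)
    (hτ : IsFiberCutoff R'' R' τ) (hρ : IsBaseCutoff t U'' U' ρ) :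
    cutMirror fan lam t j τ ρ ∩ box t R U ∩ box t R'' U'' =
      binomialLocus fan lam t j ∩ box t R'' U'' := by
  have hbox : box t R'' U'' ⊆ box t R U := fun q hq => by
    obtain ⟨hq_space, hqU, hu, hv⟩ := (mem_box hlog).1 hq
    exact (mem_box hlog).2 ⟨hq_space, hU hqU, hu.trans hR, hv.trans hR⟩
  have hpotential : ∀ q ∈ box t R'' U'',
      cutPotential fan lam t j τ ρ q = 1 + term fan lam t j q.1 := by
    intro q hq
    obtain ⟨hq_space, hqU, hu, hv⟩ := (mem_box hlog).1 hq
    rw [cutPotential, potential_eq fan lam t j, hτ.eq_one _ hu hv, hρ.eq_one _ hq_space hqU, tail]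
    push_cast
    ring
  rw [inter_assoc, inter_eq_right.2 hbox]
  ext q
  refine and_congr_left fun hq => and_congr_right fun _ => ?_
  rw [hpotential q hq]

theorem IsSmoothCutoff.one_sub {E : Type*} [NormedAddCommGroup E] [NormedSpace ℝ E] {C : ℝ}
    {f : E → ℝ} (hf : IsSmoothCutoff C f) : IsSmoothCutoff C fun x => 1 - f x where
  smooth := contDiff_const.sub hf.smooth
  mem_Icc x := Icc.mem_iff_one_sub_mem.1 (hf.mem_Icc x)
  norm_fderiv_le x := by rw [fderiv_const_sub, norm_neg]; exact hf.norm_fderiv_le x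

theorem cutPotential_apply_zero {τ : ℂ × ℂ → ℝ} (hτ : τ 0 = 1) (f : (Fin n → ℝ) → ℝ)
    {z : Fin n → ℂ} (hz : z ∈ torus n) :
    cutPotential fan lam t j τ (baseCut t f) (z, 0, 0) = 1 + term fan lam t j z +
      (baseCut t (fun x => 1 - f x) z : ℂ) * tail fan lam t j (z, 0, 0) := by
  rw [cutPotential, potential_eq fan lam t j, show τ ((0 : ℂ), (0 : ℂ)) = 1 from hτ,
    baseCut_of_mem t _ hz, baseCut_of_mem t _ hz, tail]
  push_cast
  ring

theorem HasSmallTail.norm_baseCut_mul_tail_le {U : Set (Fin n → ℝ)} {κ C : ℝ}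
    (htail : HasSmallTail fan lam t j U κ) (ht : 1 ≤ |Real.log t|) {f : (Fin n → ℝ) → ℝ}
    (hf : IsSmoothCutoff C f) {q : Ambient n} (hq : q ∈ space n) (hqU : logMapT t q.1 ∈ U) :
    ‖(baseCut t f q.1 : ℂ) * tail fan lam t j q‖ ≤ κ ∧
      ‖logForm (fun q => (baseCut t f q.1 : ℂ) * tail fan lam t j q) q‖ ≤ (1 + C) * κ := by
  have hcut : ‖(baseCut t f q.1 : ℂ)‖ ≤ 1 := by
    obtain ⟨h₀, h₁⟩ := baseCut_mem_Icc (t := t) hf.mem_Icc q.1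
    rwa [Complex.norm_real, Real.norm_of_nonneg h₀]
  have hT := htail.norm_tail_le q hq hqU
  constructor
  · rw [norm_mul]
    exact (mul_le_of_le_one_left (norm_nonneg _) hcut).trans hT
  · refine (norm_logForm_mul_le
      (differentiableAt_of_contDiffOn_space (contDiffOn_baseCut_fst t hf.smooth) hq)
      (differentiableAt_of_contDiffOn_space (contDiffOn_tail fan lam t j) hq) hcut hT
      (norm_logForm_baseCut_le ht hf hq) (htail.norm_logForm_tail_le q hq hqU)).trans_eq ?_
    ring

theorem HasSmallTail.isConnected_rayLine_inter_amoebaOf_cutMirror {U : Set (Fin n → ℝ)}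
    {κ C R : ℝ} (htail : HasSmallTail fan lam t j U κ) (hκ : κ ≤ 1 / 16)
    (hκC : (1 + C) * κ ≤ 1 / 4) (ht : 0 < t) (hlog : 1 ≤ |Real.log t|) {x : Fin n → ℝ}
    (hx : chi fan lam j x = 0)
    (hU : ∀ s : ℝ, |s| * raySq fan j * |Real.log t| ≤ 1 / 8 → x + s • realRay fan j ∈ U)
    {τ : ℂ × ℂ → ℝ} (hτ : τ 0 = 1) {f : (Fin n → ℝ) → ℝ} (hf : IsSmoothCutoff C f)
    (hR : 0 ≤ R) :
    IsConnected (rayLine fan j x ∩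
      amoebaOf t (cutMirror fan lam t j τ (baseCut t f) ∩ box t R U)) := by
  have hlog₀ : Real.log t ≠ 0 := abs_pos.1 (zero_lt_one.trans_le hlog)
  have hsmall (q : Ambient n) (hq : q ∈ space n) (hqU : logMapT t q.1 ∈ U) :=
    htail.norm_baseCut_mul_tail_le hlog hf.one_sub hq hqU
  refine isConnected_rayLine_inter_amoebaOf ht hlog₀ hx hU
    (F := fun q => (baseCut t (fun x => 1 - f x) q.1 : ℂ) * tail fan lam t j q)
    (fun q hq => differentiableAt_of_contDiffOn_space
      ((contDiffOn_baseCut_fst t hf.one_sub.smooth).mul (contDiffOn_tail fan lam t j)) hq)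
    (fun q hq hqU => (hsmall q hq hqU).1.trans hκ)
    (fun q hq hqU => (hsmall q hq hqU).2.trans hκC) fun z hz => ?_
  have hbox : ((z, 0, 0) : Ambient n) ∈ box t R U ↔ logMapT t z ∈ U := by
    rw [mem_box hlog₀]
    simp [space, hz, hR]
  have hmirror : ((z, 0, 0) : Ambient n) ∈ cutMirror fan lam t j τ (baseCut t f) ↔
      cutPotential fan lam t j τ (baseCut t f) (z, 0, 0) = 0 := by
    simp [cutMirror, hz, eq_comm]
  rw [mem_inter_iff, hbox, hmirror, cutPotential_apply_zero hτ f hz, and_comm]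

theorem tube_bidisc_subset_box (hlog : Real.log t ≠ 0) {A U : Set (Fin n → ℝ)} (hA : A ⊆ U)
    {R R' : ℝ} (hR : R' ≤ R) : tube t A (bidisc R') ⊆ box t R U := fun _ hq =>
  (mem_box hlog).2 ⟨hq.1, hA hq.2.1, hq.2.2.1.trans hR, hq.2.2.2.trans hR⟩

theorem HasSmallTail.exists_isSymplectomorphism_cutMirror {U U' O : Set (Fin n → ℝ)}
    {κ ε C₁ C₂ B r R R' : ℝ} (htail : HasSmallTail fan lam t j U κ) (hκ : κ ≤ 1 / 16)
    (hκε : (2 + C₁ + C₂) * κ ≤ ε)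
    (hε : ∀ (l : Ambient n) (L : Ambient n →L[ℝ] ℂ),
      1 / 4 ≤ coeffSq l → ‖L‖ ≤ ε → 1 / 8 ≤ poisson (complexForm l + L))
    (hlog : 1 ≤ |Real.log t|) (hU : IsOpen U) (hO : RelCompactIn O U') (hU' : U' ⊆ U)
    {τ : ℂ × ℂ → ℝ} (hτ : IsSmoothCutoff C₁ τ) (hτR : IsFiberCutoff r R' τ)
    {f : (Fin n → ℝ) → ℝ} (hf : IsSmoothCutoff C₂ f) (hfO : ∀ x, x ∉ O → f x = 0)
    (hBR : B < 2 * R) (hR : R' < R)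
    (hB : ∀ z ∈ torus n, logMapT t z ∈ U → 1 + ∑ k, ‖term fan lam t k z‖ ≤ B) :
    ∃ Φ : Ambient n → Ambient n,
      IsSymplectomorphism (mirror fan lam t ∩ box t R U)
        (cutMirror fan lam t j τ (baseCut t f) ∩ box t R U) Φ ∧
      ∀ q, q ∉ box t R' U' → Φ q = q := by
  have hlog₀ : Real.log t ≠ 0 := abs_pos.1 (zero_lt_one.trans_le hlog)
  set N := pert fan lam t j τ (baseCut t f)
  have hdata : IsTransportData (mirrorFun fan lam t) N (tube t (closure O) (bidisc R')) :=
    isTransportData_pert hτ.smooth hf.smooth hO.1 (fun x hx => hfO x fun h => hx (subset_closure h))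
      (isCompact_bidisc R') hτR.eq_zero hlog₀
  have hpoisson {s : ℝ} (hs : s ∈ Icc (0 : ℝ) 1) {q : Ambient n} (hq : q ∈ space n)
      (hqU : logMapT t q.1 ∈ U) (h : ‖family (mirrorFun fan lam t) N s q‖ ≤ 1 / 8) :
      1 / 8 ≤ poisson (logForm (family (mirrorFun fan lam t) N s) q) :=
    htail.poisson_family_ge hκ hκε hε hlog hτ hf hdata.smooth_pert hs hq hqU h
  obtain ⟨Φ, Ψ, hΦ, hΦ_family⟩ := hdata.exists_isSupportedSymplecto (c := 1 / 8) (η := 1 / 8)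
    (by norm_num) (by norm_num) fun s hs q hq h => hpoisson hs hq.1 (hU' (hO.2 hq.2.1)) h.le
  have hsubmanifold (s : ℝ) (hs : s ∈ Icc (0 : ℝ) 1) : IsSymplecticSubmanifold
      ({q | q ∈ space n ∧ family (mirrorFun fan lam t) N s q = 0} ∩ box t R U) := by
    refine isSymplecticSubmanifold_family j hlog₀ hdata.smooth_pert hU hBR hR
      (fun q hq => by simp [N, pert, hτR.eq_zero q.2 hq]) fun q hq hqU h => ⟨?_, ?_⟩
    · exact (lt_of_lt_of_le (by norm_num) (hpoisson hs hq hqU (by simp [h]))).ne'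
    · exact (norm_mul_norm_le_of_family_eq_zero hτ.mem_Icc (baseCut_mem_Icc hf.mem_Icc) hs h).trans
        (hB q.1 hq hqU)
  refine ⟨Φ, ?_, fun q hq => hΦ.eq_self q fun h => hq (tube_bidisc_subset_box hlog₀ hO.2 le_rfl h)⟩
  rw [mirror_eq_family (j := j) τ (baseCut t f), cutMirror_eq_family]
  refine hΦ.isSymplectomorphism (hsubmanifold 0 ⟨le_rfl, zero_le_one⟩)
    (hsubmanifold 1 ⟨zero_le_one, le_rfl⟩) fun q => and_congr ?_
      (hΦ.mem_iff (tube_bidisc_subset_box hlog₀ (hO.2.trans hU') hR.le) q).symm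
  have hspace := (hΦ.mem_iff hdata.subset q).symm
  exact ⟨fun h => ⟨hspace.1 h.1, (hΦ_family q h.1).1 h.2⟩,
    fun h => ⟨hspace.2 h.1, (hΦ_family q (hspace.2 h.1)).2 h.2⟩⟩

theorem mem_facet_of_pos {x : Fin n → ℝ} (hx : chi fan lam j x = 0)
    (h : ∀ k, k ≠ j → 0 < chi fan lam k x) : x ∈ facet fan lam j :=
  ⟨fun k => (eq_or_ne k j).elim (fun hk => hk ▸ hx.ge) fun hk => (h k hk).le, hx⟩

theorem add_smul_mem_cyl_of_chi_eq_zero {x₀ x : Fin n → ℝ} {r s : ℝ} (hr : 0 < r)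
    (hx₀ : chi fan lam j x₀ = 0) (hx : x ∈ cyl fan j x₀ r) (hxj : chi fan lam j x = 0)
    (hlog : 1 / r ≤ |Real.log t|) (hs : |s| * raySq fan j * |Real.log t| ≤ 1 / 8) :
    x + s • realRay fan j ∈ cyl fan j x₀ r := by
  refine add_smul_mem_cyl fan j x₀ hx ((chi_eq_pairing_sub hx₀ x).symm.trans hxj) ?_
  have hr_log : 1 ≤ |Real.log t| * r := (div_le_iff₀ hr).1 hlog
  have hlog_pos : 0 < |Real.log t| := (one_div_pos.2 hr).trans_le hlog
  refine lt_of_mul_lt_mul_right (hs.trans_lt ?_) hlog_pos.le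
  linarith

/-- The simplification of the mirror near the facet `j` at a fixed value of `t`: the part of the
mirror over `U` is symplectomorphic, by a map supported over `U'`, to a hypersurface which over
`U''` is the binomial locus and whose amoeba meets the lines `x + ℝ v_j` in connected sets. -/
def IsSimplifiableOver (fan : SmoothCompleteFan n p) (lam : Fin p → ℝ) (t : ℝ) (j : Fin p)
    (U U' U'' : Set (Fin n → ℝ)) : Prop :=
  ∃ R R' R'' B : ℝ,
    IsLUB ((fun z : Fin n → ℂ => 1 + ∑ k, ‖term fan lam t k z‖) ''
      {z | z ∈ torus n ∧ logMapT t z ∈ U}) B ∧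
    max (1 / 2 * B) 1 < R'' ∧ R'' < R' ∧ R' < R ∧
    ∃ (Yj Yjsimple : Set (Ambient n)) (τ : ℂ × ℂ → ℝ) (ρ : (Fin n → ℂ) → ℝ)
      (Φ : Ambient n → Ambient n),
      Yj = mirror fan lam t ∩ box t R U ∧
      IsFiberCutoff R'' R' τ ∧ IsBaseCutoff t U'' U' ρ ∧
      Yjsimple = cutMirror fan lam t j τ ρ ∩ box t R U ∧
      IsSymplectomorphism Yj Yjsimple Φ ∧
      Yjsimple ∩ box t R'' U'' = binomialLocus fan lam t j ∩ box t R'' U'' ∧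
      (∀ q ∈ Yj \ box t R' U', Φ q = q) ∧
      ∀ x ∈ U ∩ facet fan lam j, IsConnected (rayLine fan j x ∩ amoebaOf t Yjsimple)

theorem HasSmallTail.isSimplifiableOver_cyl {x₀ : Fin n → ℝ} {r κ ε C₁ C₂ : ℝ}
    {f : (Fin n → ℝ) → ℝ} (htail : HasSmallTail fan lam t j (cyl fan j x₀ r) κ) (hr : 0 < r)
    (hx₀ : chi fan lam j x₀ = 0) (hκ : 0 < κ) (hκε : (2 + C₁ + C₂) * κ < min ε (1 / 16))
    (hε : ∀ (l : Ambient n) (L : Ambient n →L[ℝ] ℂ),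
      1 / 4 ≤ coeffSq l → ‖L‖ ≤ ε → 1 / 8 ≤ poisson (complexForm l + L))
    (ht : 0 < t) (hlog : 1 + 1 / r < |Real.log t|)
    (hτ : ∀ a, 1 ≤ a → ∃ τ, IsFiberCutoff a (2 * a) τ ∧ IsSmoothCutoff C₁ τ)
    (hf : IsSmoothCutoff C₂ f) (hf_one : ∀ x ∈ cyl fan j x₀ (r / 4), f x = 1)
    (hf_zero : ∀ x, x ∉ cyl fan j x₀ (r / 2) → f x = 0) :
    IsSimplifiableOver fan lam t j (cyl fan j x₀ r) (cyl fan j x₀ (3 * r / 4))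
      (cyl fan j x₀ (r / 4)) := by
  have hlog_one : 1 ≤ |Real.log t| := by linarith [one_div_pos.2 hr]
  have hlog₀ : Real.log t ≠ 0 := abs_pos.1 (zero_lt_one.trans_le hlog_one)
  obtain ⟨B, hB⟩ := exists_isLUB_terms (fan := fan) (lam := lam) ht hlog₀
    ⟨x₀, center_mem_cyl fan j x₀ hr⟩ (relCompactIn_cyl fan j x₀ (lt_add_one r)).1
  obtain ⟨a, ha, hBa⟩ : ∃ a, 1 < a ∧ B < a :=
    (exists_gt (max 1 B)).imp fun _ => max_lt_iff.1
  obtain ⟨τ, hτ_fiber, hτ_smooth⟩ := hτ a ha.le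
  have hC₁ : 0 ≤ C₁ := hτ_smooth.nonneg
  have hC₂ : 0 ≤ C₂ := hf.nonneg
  obtain ⟨hκε, hκ_lt⟩ := lt_min_iff.1 hκε
  have hκ_le : κ ≤ 1 / 16 := by nlinarith
  have hκ_le' : (1 + C₂) * κ ≤ 1 / 4 := by nlinarith
  obtain ⟨Φ, hΦ, hΦ_eq⟩ := htail.exists_isSymplectomorphism_cutMirror hκ_le hκε.le hε hlog_one
    (isOpen_cyl _ _ _ _) (relCompactIn_cyl fan j x₀ (show r / 2 < 3 * r / 4 by linarith))
    (cyl_mono (by linarith)) hτ_smooth hτ_fiber hf hf_zero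
    (R := 3 * a) (by linarith) (by linarith) fun z hz hzU => hB.1 ⟨z, ⟨hz, hzU⟩, rfl⟩
  have hρ : IsBaseCutoff t (cyl fan j x₀ (r / 4)) (cyl fan j x₀ (3 * r / 4)) (baseCut t f) :=
    isBaseCutoff_baseCut hf hf_one fun x hx => hf_zero x fun h => hx (cyl_mono (by linarith) h)
  refine ⟨3 * a, 2 * a, a, B, hB, max_lt (by linarith) ha, by linarith, by linarith, _, _, τ,
    baseCut t f, Φ, rfl, hτ_fiber, hρ, rfl, hΦ,
    cutMirror_inter_box_eq hlog₀ (by linarith) (cyl_mono (by linarith)) hτ_fiber hρ,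
    fun q hq => hΦ_eq q hq.2, fun x hx => ?_⟩
  exact htail.isConnected_rayLine_inter_amoebaOf_cutMirror hκ_le hκ_le' ht hlog_one hx.2.2
    (fun s => add_smul_mem_cyl_of_chi_eq_zero hr hx₀ hx.1 hx.2.2 (by linarith))
    (hτ_fiber.eq_one_zero (by linarith)) hf (by linarith)

end SimplifiedMirror

end HoriVafa

end

open HoriVafa in
open scoped Topology in
theorem mainTheorem5_general {n p : ℕ} (fan : SmoothCompleteFan n p) (lam : Fin p → ℝ)
    (j : Fin p) {x₀ : Fin n → ℝ} (hx₀ : chi fan lam j x₀ = 0)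
    (hpos : ∀ k, k ≠ j → 0 < chi fan lam k x₀) :
    ∃ U U' U'' : Set (Fin n → ℝ), IsOpen U ∧ IsOpen U' ∧ IsOpen U'' ∧
      RelCompactIn U'' U' ∧ RelCompactIn U' U ∧
      (∃ O : Set (Fin n → ℝ), IsOpen O ∧ (O ∩ facet fan lam j).Nonempty ∧
        O ∩ facet fan lam j ⊆ U'') ∧
      ∃ t₀ : ℝ, 0 < t₀ ∧ ∀ t : ℝ, 0 < t → t < t₀ → IsSimplifiableOver fan lam t j U U' U'' := by
  obtain ⟨δ, hδ, r, hr, hchi⟩ := exists_cyl_forall_le_chi hpos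
  obtain ⟨C₂, f, hf, hf_one, hf_zero⟩ :=
    exists_isSmoothCutoff_cyl fan j x₀ (show r / 4 < r / 2 by linarith)
  obtain ⟨C₁, hτ⟩ := exists_isFiberCutoff
  obtain ⟨ε, hε, hpoisson⟩ := exists_poisson_complexForm_add_ge n
  obtain ⟨κ, hκ, hκε⟩ := exists_pos_mul_lt (lt_min hε (by norm_num : (0 : ℝ) < 1 / 16))
    (2 + C₁ + C₂)
  have hsmall : ∀ᶠ t in 𝓝[>] 0, IsSimplifiableOver fan lam t j (cyl fan j x₀ r)
      (cyl fan j x₀ (3 * r / 4)) (cyl fan j x₀ (r / 4)) := by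
    filter_upwards [eventually_hasSmallTail hδ hκ, self_mem_nhdsWithin,
      (Filter.tendsto_abs_atBot_atTop.comp Real.tendsto_log_nhdsGT_zero).eventually_gt_atTop
        (1 + 1 / r)] with t htail ht hlog
    exact (htail _ hchi).isSimplifiableOver_cyl hr hx₀ hκ hκε hpoisson ht hlog hτ hf hf_one hf_zero
  obtain ⟨t₀, ht₀, hsmall⟩ := mem_nhdsGT_iff_exists_Ioo_subset.1 hsmall
  exact ⟨cyl fan j x₀ r, cyl fan j x₀ (3 * r / 4), cyl fan j x₀ (r / 4), isOpen_cyl _ _ _ _,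
    isOpen_cyl _ _ _ _, isOpen_cyl _ _ _ _, relCompactIn_cyl fan j x₀ (by linarith),
    relCompactIn_cyl fan j x₀ (by linarith), ⟨cyl fan j x₀ (r / 4), isOpen_cyl _ _ _ _,
      ⟨x₀, center_mem_cyl fan j x₀ (by linarith), mem_facet_of_pos hx₀ hpos⟩, inter_subset_left⟩,
    t₀, ht₀, fun t ht htt₀ => hsmall ⟨ht, htt₀⟩⟩

open HoriVafa in
theorem mainTheorem5 {n p : ℕ} (fan : HoriVafa.SmoothCompleteFan n p) (lam : Fin p → ℝ)
    (hlam : fan.IsAmple lam) (j : Fin p) :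
    ∃ U U' U'' : Set (Fin n → ℝ),
      IsOpen U ∧ IsOpen U' ∧ IsOpen U'' ∧
      HoriVafa.RelCompactIn U'' U' ∧ HoriVafa.RelCompactIn U' U ∧
      (∃ O : Set (Fin n → ℝ), IsOpen O ∧ (O ∩ HoriVafa.facet fan lam j).Nonempty ∧
        O ∩ HoriVafa.facet fan lam j ⊆ U'') ∧
      ∃ t₀ : ℝ, 0 < t₀ ∧ ∀ t : ℝ, 0 < t → t < t₀ →
        ∃ R R' R'' B : ℝ,
          IsLUB ((fun z : Fin n → ℂ => 1 + ∑ k, ‖HoriVafa.term fan lam t k z‖) ''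
            {z | z ∈ HoriVafa.torus n ∧ HoriVafa.logMapT t z ∈ U}) B ∧
          max (1 / 2 * B) 1 < R'' ∧ R'' < R' ∧ R' < R ∧
          ∃ (Yj Yjsimple : Set (HoriVafa.Ambient n)) (τ : ℂ × ℂ → ℝ) (ρ : (Fin n → ℂ) → ℝ)
            (Φ : HoriVafa.Ambient n → HoriVafa.Ambient n),
            Yj = HoriVafa.mirror fan lam t ∩ HoriVafa.box t R U ∧
            HoriVafa.IsFiberCutoff R'' R' τ ∧ HoriVafa.IsBaseCutoff t U'' U' ρ ∧
            Yjsimple = HoriVafa.cutMirror fan lam t j τ ρ ∩ HoriVafa.box t R U ∧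
            HoriVafa.IsSymplectomorphism Yj Yjsimple Φ ∧
            Yjsimple ∩ HoriVafa.box t R'' U'' =
              HoriVafa.binomialLocus fan lam t j ∩ HoriVafa.box t R'' U'' ∧
            (∀ q ∈ Yj \ HoriVafa.box t R' U', Φ q = q) ∧
            ∀ x ∈ U ∩ HoriVafa.facet fan lam j,
              IsConnected (HoriVafa.rayLine fan j x ∩ HoriVafa.amoebaOf t Yjsimple) := by
  obtain ⟨x₀, hx₀, hpos⟩ := fan.exists_facet_point hlam j
  exact mainTheorem5_general fan lam j hx₀ hpos
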